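/- Let $G$ be a connected complex reductive linear algebraic group (identified with its complex points), let $\sigma$ be an antiholomorphic involution of the group $G$, and for every subgroup $K$ of $G$ put $K(\mathbb R)=\{g\in K\mid\sigma(g)=g\}$. Let $G_d$ be the derived group of $G$ and let $G_{\mathrm{rad}}$ be the radical of $G$, i.e. its maximal central torus. Let $H$ be a $\sigma$-stable Cartan subgroup (maximal torus) of $G$ such that $H(\mathbb R)$ is relatively compact, i.e. $H(\mathbb R)\cap G_d$ is compact. Put $H_d=H\cap G_d$, and let $H(\mathbb R)^0$ be the identity component of $H(\mathbb R)$ in the usual (Lie group) topology. Then $$Z(G(\mathbb R))\subset G_{\mathrm{rad}}(\mathbb R)\,H(\mathbb R)^0,$$ and moreover $$H(\mathbb R)=G_{\mathrm{rad}}(\mathbb R)\,H_d(\mathbb R).$$ -/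

import Mathlib

open scoped Pointwise ComplexConjugate

namespace RealReductive

variable {n : ℕ}

/-- The entries of an invertible complex matrix, as a point of the affine space `ℂ^(n × n)`. -/
def entries (g : GL (Fin n) ℂ) : Fin n → Fin n → ℂ :=
  fun i j => (g : Matrix (Fin n) (Fin n) ℂ) i j

/-- `K` is a Zariski closed subgroup of `GL_n(ℂ)`, i.e. a linear algebraic group
(identified with its complex points). -/
def IsAlgebraicSubgroup (K : Subgroup (GL (Fin n) ℂ)) : Prop :=
  ∃ S : Set (MvPolynomial (Fin n × Fin n) ℂ), ∀ g : GL (Fin n) ℂ,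
    g ∈ K ↔ ∀ p ∈ S, MvPolynomial.eval (fun ij => entries g ij.1 ij.2) p = 0

/-- Every element of `K` is a unipotent matrix. -/
def IsUnipotent (K : Subgroup (GL (Fin n) ℂ)) : Prop :=
  ∀ g ∈ K, IsNilpotent ((g : Matrix (Fin n) (Fin n) ℂ) - 1)

/-- The elements of `K` are simultaneously diagonalizable. -/
def IsDiagonalizable (K : Subgroup (GL (Fin n) ℂ)) : Prop :=
  ∃ P : GL (Fin n) ℂ, ∀ g ∈ K, ((P * g * P⁻¹ : GL (Fin n) ℂ) : Matrix (Fin n) (Fin n) ℂ).IsDiag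

/-- A complex torus: a connected diagonalizable linear algebraic group. For Zariski closed
subgroups of `GL_n(ℂ)`, being connected means the same in the usual topology (used here) and in
the Zariski topology. -/
structure IsTorus (T : Subgroup (GL (Fin n) ℂ)) : Prop where
  algebraic : IsAlgebraicSubgroup T
  connected : IsConnected (T : Set (GL (Fin n) ℂ))
  diagonalizable : IsDiagonalizable T

/-- A connected complex reductive algebraic group: a connected linear algebraic group
with trivial unipotent radical. -/
structure IsConnectedReductive (G : Subgroup (GL (Fin n) ℂ)) : Prop where
  algebraic : IsAlgebraicSubgroup G
  connected : IsConnected (G : Set (GL (Fin n) ℂ))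
  unipotentRadical_trivial : ∀ U : Subgroup (GL (Fin n) ℂ), U ≤ G → (U.subgroupOf G).Normal →
    IsAlgebraicSubgroup U → IsConnected (U : Set (GL (Fin n) ℂ)) → IsUnipotent U → U = ⊥

/-- A Cartan subgroup of a connected reductive group: a maximal torus. -/
def IsCartanSubgroup (G H : Subgroup (GL (Fin n) ℂ)) : Prop :=
  Maximal (fun T : Subgroup (GL (Fin n) ℂ) => IsTorus T ∧ T ≤ G) H

/-- The center of the group `K`, as a subgroup of `GL_n(ℂ)`. -/
def centerOf (K : Subgroup (GL (Fin n) ℂ)) : Subgroup (GL (Fin n) ℂ) :=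
  (Subgroup.center K).map K.subtype

/-- The identity component of the topological group `K`, as a subgroup of `GL_n(ℂ)`. -/
noncomputable def identityComponent (K : Subgroup (GL (Fin n) ℂ)) : Subgroup (GL (Fin n) ℂ) :=
  (Subgroup.connectedComponentOfOne K).map K.subtype

/-- The radical of a connected reductive group `G`, i.e. its maximal central torus: the subgroup
generated by all the tori contained in the center of `G`. -/
def radical (G : Subgroup (GL (Fin n) ℂ)) : Subgroup (GL (Fin n) ℂ) :=
  sSup {T | IsTorus T ∧ T ≤ centerOf G}

/-- A map from `G` to itself is antiholomorphic if near every point of `G` it is the restriction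
to `G` of the complex conjugate of a holomorphic map on an open subset of `ℂ^(n × n)`. -/
def IsAntiholomorphic {G : Subgroup (GL (Fin n) ℂ)} (σ : G → G) : Prop :=
  ∀ g : G, ∃ (U : Set (Fin n → Fin n → ℂ)) (f : (Fin n → Fin n → ℂ) → (Fin n → Fin n → ℂ)),
    IsOpen U ∧ entries (g : GL (Fin n) ℂ) ∈ U ∧ DifferentiableOn ℂ f U ∧
    ∀ x : G, entries (x : GL (Fin n) ℂ) ∈ U →
      ∀ i j, entries (σ x : GL (Fin n) ℂ) i j = conj (f (entries (x : GL (Fin n) ℂ)) i j)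

/-- A real form of `G`: an antiholomorphic group automorphism of order at most two. -/
structure IsRealForm {G : Subgroup (GL (Fin n) ℂ)} (σ : G →* G) : Prop where
  involutive : Function.Involutive σ
  antiholomorphic : IsAntiholomorphic σ

/-- `K(ℝ) = {g ∈ K | σ g = g}`, for a subgroup `K` of `G`. -/
def realPoints {G : Subgroup (GL (Fin n) ℂ)} (σ : G →* G) (K : Subgroup (GL (Fin n) ℂ)) :
    Subgroup (GL (Fin n) ℂ) :=
  K ⊓ (σ.eqLocus (MonoidHom.id G)).map G.subtype

/-- `H` is a Cartan subgroup of `G` defined over `ℝ` such that `H(ℝ) ∩ G_d` is compact, where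
`G_d` is the derived group of `G`; i.e. `H(ℝ)` is a relatively compact Cartan subgroup
of `G(ℝ)`. -/
structure IsRelativelyCompactCartan {G : Subgroup (GL (Fin n) ℂ)} (σ : G →* G)
    (H : Subgroup (GL (Fin n) ℂ)) : Prop where
  cartan : IsCartanSubgroup G H
  defined_over_real : ∀ g : G, (g : GL (Fin n) ℂ) ∈ H → (σ g : GL (Fin n) ℂ) ∈ H
  compact : IsCompact ((realPoints σ H ⊓ ⁅G, G⁆ : Subgroup (GL (Fin n) ℂ)) : Set (GL (Fin n) ℂ))

end RealReductive

/-! Let `h ∈ H(ℝ)`. Since `G` is its derived group times the exponentials of the `G`-fixed part of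
its Lie algebra, `h = d z` with `d ∈ G_d` and `z ∈ G_rad`. Applying `σ` shows that `d σ(d)⁻¹ = σ(z)
z⁻¹` is both central and in `G_d`, hence of finite order. Write `d = exp x` with `x` in the Lie
algebra of `H`, and let `v` be the image of `x` under the antilinear differential of `σ`. The
elements `exp(-is(x - v))`, `s` real, lie in the compact group `H(ℝ) ∩ G_d`, so `x - v` has real
eigenvalues; the finite order of `exp(x - v)` makes them purely imaginary. So `x = v`, the line
`exp(tx)` joins `1` to `d` inside `H(ℝ)`, and `z` is real because `h` and `d` are
(`IsRelativelyCompactCartan.exists_exp_of_torsion`, `IsRelativelyCompactCartan.exists_mul_exp`).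
This gives the equality and also `H(ℝ) ⊂ G_rad(ℝ) H(ℝ)⁰`. Finally, an element of `Z(G(ℝ))` commutes
with `H(ℝ)`, whose Lie algebra spans that of `H` over `ℂ`; it centralizes `lie H` and therefore lies
in `H`.

The structure theory used here is derived from the definitions. Near `1` an algebraic group is the
exponential of its Lie algebra, and polynomial identities spread from `1` along connected subsets.
The Lie algebra contains all replicas `φ(s)` of the semisimple part `s` of an element, for `φ : ℂ →
ℂ` additive (`replica_mem_lie`). Hence the radical of the trace form consists of nilpotent matrices;
it produces a connected normal unipotent subgroup, so it vanishes
(`IsConnectedReductive.eq_zero_of_trace`). Nondegeneracy gives that `lie H` is its own centralizer,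
and that `G = G_d · exp(centralLie G)`. Passing from Lie algebra centralizers to group centralizers
uses block `LDU` factorizations (`mem_of_commute_dg`). The derived group is replaced, where an
algebraic group is needed, by `isotypicSL G`: it contains `G_d`, its central elements in a torus are
killed by `n!`, and exponentials of `lie (H ⊓ isotypicSL G)` fall back into `G_d`. -/

namespace RealReductive
open Filter Topology

/-! ### Zero sets of analytic functions in the unit group of a finite-dimensional algebra -/

namespace NormedAlg

set_option linter.unusedSectionVars false

variable {R : Type} [NormedRing R] [NormedAlgebra ℂ R] [NormedAlgebra ℚ R]
  [FiniteDimensional ℂ R] [CompleteSpace R]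

/-- A subgroup of the unit group that is the zero set of a family of analytic functions. -/
def IsAnalytic (K : Subgroup Rˣ) : Prop :=
  ∃ S : Set (R → ℂ), (∀ F ∈ S, AnalyticOnNhd ℂ F Set.univ) ∧
    ∀ g : Rˣ, g ∈ K ↔ ∀ F ∈ S, F (g : R) = 0

theorem isEmbedding_val : Topology.IsOpenEmbedding (fun g : Rˣ => (g : R)) :=
  Units.isOpenEmbedding_val

theorem IsAnalytic.isClosed {K : Subgroup Rˣ} (h : IsAnalytic K) : IsClosed (K : Set Rˣ) := by
  obtain ⟨S, hS, h⟩ := h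
  have : (K : Set Rˣ) = ⋂ F ∈ S, {g : Rˣ | F (g : R) = 0} := by
    ext g
    simp [h]
  rw [this]
  refine isClosed_biInter fun F hF => isClosed_eq ?_ continuous_const
  exact (continuousOn_univ.1 (hS F hF).continuousOn).comp isEmbedding_val.continuous

theorem eventually_val {p : Rˣ → Prop} {g : Rˣ} (h : ∀ᶠ x in 𝓝 g, p x) :
    ∀ᶠ m in 𝓝 (g : R), ∀ x : Rˣ, (x : R) = m → p x := by
  rw [isEmbedding_val.isInducing.nhds_eq_comap, eventually_comap] at h
  exact h

theorem eventually_unit {p : R → Prop} {g : Rˣ} (h : ∀ᶠ m in 𝓝 (g : R), p m) :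
    ∀ᶠ x : Rˣ in 𝓝 g, p x :=
  isEmbedding_val.continuous.continuousAt.eventually h

/-! ### The matrix exponential -/

/-- The matrix exponential, as an invertible matrix. -/
noncomputable def expU (x : R) : Rˣ where
  val := NormedSpace.exp x
  inv := NormedSpace.exp (-x)
  val_inv := by rw [← NormedSpace.exp_add_of_commute (Commute.refl x).neg_right]; simp
  inv_val := by rw [← NormedSpace.exp_add_of_commute (Commute.refl x).neg_left]; simp

@[simp] theorem coe_expU (x : R) : (expU x : R) = NormedSpace.exp x := rfl

@[simp] theorem expU_zero : expU (0 : R) = 1 := Units.ext (by simp)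

theorem expU_neg (x : R) : expU (-x) = (expU x)⁻¹ := Units.ext rfl

theorem expU_nsmul (k : ℕ) (x : R) : expU (k • x) = expU x ^ k :=
  Units.ext (by simpa using NormedSpace.exp_nsmul k x)

theorem expU_zsmul (k : ℤ) (x : R) : expU (k • x) = expU x ^ k := by
  obtain ⟨m, rfl | rfl⟩ := k.eq_nat_or_neg
  · simpa using expU_nsmul m x
  · rw [neg_smul, expU_neg, zpow_neg, natCast_zsmul, zpow_natCast, expU_nsmul]

theorem expU_conj (g : Rˣ) (x : R) :
    expU ((g : R) * x * (g⁻¹ : Rˣ)) = g * expU x * g⁻¹ :=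
  Units.ext (NormedSpace.exp_units_conj g x)

theorem continuous_expU : Continuous (expU : R → Rˣ) := by
  rw [isEmbedding_val.isInducing.continuous_iff]
  exact NormedSpace.exp_continuous

theorem analyticOnNhd_exp : AnalyticOnNhd ℂ (NormedSpace.exp : R → R) Set.univ :=
  fun x _ => NormedSpace.exp_analytic x

theorem exists_log : ∃ L : R → R, HasStrictFDerivAt L (1 : R →L[ℂ] R) 1 ∧ L 1 = 0 ∧
    (∀ᶠ g in 𝓝 1, NormedSpace.exp (L g) = g) ∧ ∀ᶠ x in 𝓝 0, L (NormedSpace.exp x) = x := by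
  have h : HasStrictFDerivAt (NormedSpace.exp : R → R)
      ((ContinuousLinearEquiv.refl ℂ R : R →L[ℂ] R)) 0 :=
    hasStrictFDerivAt_exp_zero
  refine ⟨h.localInverse, ?_, ?_, ?_, h.eventually_left_inverse⟩
  · have := h.to_localInverse
    rw [NormedSpace.exp_zero] at this
    exact this
  · have := h.localInverse_apply_image
    rwa [NormedSpace.exp_zero] at this
  · have := h.eventually_right_inverse
    rwa [NormedSpace.exp_zero] at this

/-! ### The Lie algebra of an algebraic group -/

/-- The Lie algebra of an algebraic subgroup of `GL_n(ℂ)`. -/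
noncomputable def lie (K : Subgroup Rˣ) : Submodule ℂ R :=
  Submodule.span ℂ {x | ∀ t : ℂ, expU (t • x) ∈ K}

/-- The multiples `⌊t c k⌋ • x k` exponentiate to powers of `expU (x k)`, which stay in `K`. They
tend to `t • v`, since rounding costs at most `‖x k‖`, which tends to zero. -/
theorem real_smul_mem_of_seq {K : Subgroup Rˣ} (hK : IsClosed (K : Set Rˣ))
    {x : ℕ → R} {c : ℕ → ℝ} {v : R} (hx : Tendsto x atTop (𝓝 0))
    (hcx : Tendsto (fun k => (c k : ℂ) • x k) atTop (𝓝 v)) (h : ∀ᶠ k in atTop, expU (x k) ∈ K)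
    (t : ℝ) : expU ((t : ℂ) • v) ∈ K := by
  have h1 : Tendsto (fun k => (⌊t * c k⌋ : ℤ) • x k) atTop (𝓝 ((t : ℂ) • v)) := by
    have h2 : ∀ k, (⌊t * c k⌋ : ℤ) • x k =
        (t : ℂ) • ((c k : ℂ) • x k) - ((Int.fract (t * c k) : ℝ) : ℂ) • x k := by
      intro k
      rw [smul_smul, ← sub_smul, ← Int.cast_smul_eq_zsmul ℂ]
      congr 1
      rw [Int.fract]
      push_cast
      ring
    simp only [h2]
    have h3 : Tendsto (fun k => ((Int.fract (t * c k) : ℝ) : ℂ) • x k) atTop (𝓝 0) := by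
      refine squeeze_zero_norm (a := fun k => ‖x k‖) (fun k => ?_) (by simpa using hx.norm)
      rw [norm_smul]
      refine mul_le_of_le_one_left (norm_nonneg _) ?_
      rw [Complex.norm_real, Real.norm_eq_abs, abs_of_nonneg (Int.fract_nonneg _)]
      exact (Int.fract_lt_one _).le
    simpa using (hcx.const_smul (t : ℂ)).sub h3
  refine hK.mem_of_tendsto ((continuous_expU.tendsto _).comp h1) ?_
  filter_upwards [h] with k hk
  simp only [Function.comp_apply, expU_zsmul]
  exact K.zpow_mem hk _

/-- Each equation of `K` pulls back to an entire function of `t` that vanishes on the real line,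
hence identically. -/
theorem smul_mem_of_real {K : Subgroup Rˣ} (hK : IsAnalytic K) {v : R}
    (h : ∀ t : ℝ, expU ((t : ℂ) • v) ∈ K) (t : ℂ) : expU (t • v) ∈ K := by
  obtain ⟨S, hS, hK⟩ := hK
  rw [hK]
  intro F hF
  have hc : AnalyticOnNhd ℂ (fun s : ℂ => F (NormedSpace.exp (s • v))) Set.univ := by
    intro s _
    have h1 : AnalyticAt ℂ (fun s : ℂ => s • v) s :=
      ((ContinuousLinearMap.id ℂ ℂ).smulRight v).analyticAt s
    have h2 : AnalyticAt ℂ (fun s : ℂ => NormedSpace.exp (s • v)) s :=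
      AnalyticAt.comp (f := fun s : ℂ => s • v) (analyticOnNhd_exp (s • v) trivial) h1
    exact AnalyticAt.comp (f := fun s : ℂ => NormedSpace.exp (s • v)) (hS F hF _ trivial) h2
  have hz : AnalyticOnNhd ℂ (fun _ : ℂ => (0 : ℂ)) Set.univ := analyticOnNhd_const
  refine congrFun (hc.eq_of_frequently_eq hz (z₀ := 0) ?_) t
  have h1 : Tendsto (fun s : ℝ => (s : ℂ)) (𝓝[≠] 0) (𝓝[≠] 0) := by
    refine tendsto_nhdsWithin_iff.2 ⟨?_, ?_⟩
    · have := (Complex.continuous_ofReal.tendsto 0)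
      simp only [Complex.ofReal_zero] at this
      exact this.mono_left nhdsWithin_le_nhds
    · filter_upwards [self_mem_nhdsWithin] with s hs
      simpa using hs
  refine h1.frequently (Eventually.frequently ?_)
  exact Eventually.of_forall fun s => (hK _).1 (h s) F hF

/-- The logarithms of `γ` at the times `1 / (k + 1)`, rescaled by `k + 1`, converge to `v`, so
`real_smul_mem_of_seq` applies. Only the derivative at `0` matters. -/
theorem mem_of_hasDerivAt {K : Subgroup Rˣ} (hK : IsAnalytic K)
    {γ : ℝ → R} {v : R} (h0 : γ 0 = 1) (hγ : HasDerivAt γ v 0)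
    (h : ∀ s, ∃ g ∈ K, (g : R) = γ s) (t : ℂ) : expU (t • v) ∈ K := by
  obtain ⟨L, hL, hL1, hL2, -⟩ := exists_log (R := R)
  refine smul_mem_of_real hK (fun t => ?_) t
  have hd : HasDerivAt (fun s => L (γ s)) v 0 := by
    have hL' : HasFDerivAt L ((1 : R →L[ℂ] R).restrictScalars ℝ) (γ 0) := by
      rw [h0]
      exact hL.hasFDerivAt.restrictScalars ℝ
    exact hL'.comp_hasDerivAt (0 : ℝ) hγ
  have hs : Tendsto (fun k : ℕ => ((k : ℝ) + 1)⁻¹) atTop (𝓝[≠] 0) := by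
    refine tendsto_nhdsWithin_iff.2 ⟨?_, Eventually.of_forall fun k => ?_⟩
    · simpa using tendsto_one_div_add_atTop_nhds_zero_nat (𝕜 := ℝ)
    · have : ((k : ℝ) + 1) ≠ 0 := by positivity
      simpa using this
  have hs0 := tendsto_nhds_of_tendsto_nhdsWithin hs
  refine real_smul_mem_of_seq hK.isClosed (x := fun k : ℕ => L (γ ((k : ℝ) + 1)⁻¹))
    (c := fun k => (k : ℝ) + 1) ?_ ?_ ?_ t
  · have := hd.continuousAt.tendsto.comp hs0
    simpa [h0, hL1, Function.comp_def] using this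
  · have := (hasDerivAt_iff_tendsto_slope.1 hd).comp hs
    refine this.congr fun k => ?_
    simp only [Function.comp_apply, slope_def_module, h0, hL1, sub_zero, inv_inv]
    rw [← Complex.coe_smul]
  · have h1 := hγ.continuousAt.tendsto.comp hs0
    rw [h0] at h1
    filter_upwards [h1.eventually hL2] with k hk
    obtain ⟨g, hg, hg'⟩ := h ((k : ℝ) + 1)⁻¹
    have : expU (L (γ ((k : ℝ) + 1)⁻¹)) = g := Units.ext (by rw [hg']; exact hk)
    rwa [this]

/-- Taking the span in the definition adds nothing: for generators `x` and `y`, the sum `x + y` is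
the velocity at `0` of the curve `exp(sx) exp(sy)` in `K`. -/
theorem mem_lie {K : Subgroup Rˣ} (hK : IsAnalytic K) {x : R} :
    x ∈ lie K ↔ ∀ t : ℂ, expU (t • x) ∈ K := by
  refine ⟨fun hx => ?_, fun h => Submodule.subset_span h⟩
  induction hx using Submodule.span_induction with
  | mem x h => exact h
  | zero => simp [K.one_mem]
  | add x y _ _ hx hy =>
    refine mem_of_hasDerivAt hK
      (γ := fun s : ℝ => NormedSpace.exp ((s : ℂ) • x) * NormedSpace.exp ((s : ℂ) • y))
      (by simp) ?_ (fun s => ⟨_, K.mul_mem (hx s) (hy s), rfl⟩)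
    have h1 : HasDerivAt (fun s : ℝ => NormedSpace.exp ((s : ℂ) • x)) x 0 :=
      HasDerivAt.scomp (g₁ := fun s : ℂ => NormedSpace.exp (s • x)) (h := fun s : ℝ => (s : ℂ))
        (h' := 1) (g₁' := x) (0 : ℝ) (by simpa using hasDerivAt_exp_smul_const x (0 : ℂ))
        Complex.ofRealCLM.hasDerivAt |>.congr_deriv (one_smul _ _)
    have h2 : HasDerivAt (fun s : ℝ => NormedSpace.exp ((s : ℂ) • y)) y 0 :=
      HasDerivAt.scomp (g₁ := fun s : ℂ => NormedSpace.exp (s • y)) (h := fun s : ℝ => (s : ℂ))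
        (h' := 1) (g₁' := y) (0 : ℝ) (by simpa using hasDerivAt_exp_smul_const y (0 : ℂ))
        Complex.ofRealCLM.hasDerivAt |>.congr_deriv (one_smul _ _)
    simpa using! h1.mul h2
  | smul a x _ hx =>
    intro t
    rw [smul_smul]
    exact hx _

theorem expU_mem {K : Subgroup Rˣ} (hK : IsAnalytic K) {x : R}
    (hx : x ∈ lie K) : expU x ∈ K := by
  simpa using (mem_lie hK).1 hx 1

theorem conj_mem_lie {K : Subgroup Rˣ} (hK : IsAnalytic K) {x : R}
    (hx : x ∈ lie K) {g : Rˣ} (hg : g ∈ K) :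
    (g : R) * x * (g⁻¹ : Rˣ) ∈ lie K := by
  rw [mem_lie hK] at hx ⊢
  intro t
  have : t • ((g : R) * x * (g⁻¹ : Rˣ)) = g * (t • x) * (g⁻¹ : Rˣ) := by
    simp
  rw [this, expU_conj]
  exact K.mul_mem (K.mul_mem hg (hx t)) (K.inv_mem hg)

theorem hasDerivAt_conj_exp (x y : R) :
    HasDerivAt (fun t : ℂ => NormedSpace.exp (t • x) * y * NormedSpace.exp (-(t • x)))
      (x * y - y * x) 0 := by
  have h1 := hasDerivAt_exp_smul_const x (0 : ℂ)
  have h2 := hasDerivAt_exp_smul_const (-x) (0 : ℂ)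
  have := (h1.mul_const y).mul h2
  simp only [smul_neg, zero_smul, neg_zero, NormedSpace.exp_zero, one_mul, mul_one] at this
  simpa [sub_eq_add_neg] using! this

/-- The bracket is the derivative at `0` of `exp(tx) y exp(-tx)`, a curve in `W`, and `W` is closed
because it is finite-dimensional. -/
theorem bracket_mem {K : Subgroup Rˣ} (hK : IsAnalytic K) {x : R}
    (hx : x ∈ lie K) {W : Submodule ℂ R}
    (hW : ∀ g ∈ K, ∀ y ∈ W, (g : R) * y * (g⁻¹ : Rˣ) ∈ W) {y : R} (hy : y ∈ W) :
    x * y - y * x ∈ W := by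
  have h := hasDerivAt_conj_exp x y
  have hc : IsClosed (W : Set R) := W.closed_of_finiteDimensional
  rw [hasDerivAt_iff_tendsto_slope] at h
  refine hc.mem_of_tendsto h (Eventually.of_forall fun t => ?_)
  rw [slope_def_module]
  refine W.smul_mem _ (W.sub_mem ?_ (by simpa using hy))
  have := hW (expU (t • x)) ((mem_lie hK).1 hx t) y hy
  rwa [← expU_neg] at this

theorem mem_of_exp_mem {W : Submodule ℂ R} {x : R} {m : R}
    (h : ∀ t : ℝ, m * NormedSpace.exp ((t : ℂ) • x) - m ∈ W) : m * x ∈ W := by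
  have h1 : HasDerivAt (fun s : ℝ => m * NormedSpace.exp ((s : ℂ) • x)) (m * x) 0 := by
    refine HasDerivAt.const_mul m ?_
    exact HasDerivAt.scomp (g₁ := fun s : ℂ => NormedSpace.exp (s • x)) (h := fun s : ℝ => (s : ℂ))
        (h' := 1) (g₁' := x) (0 : ℝ) (by simpa using hasDerivAt_exp_smul_const x (0 : ℂ))
        Complex.ofRealCLM.hasDerivAt |>.congr_deriv (one_smul _ _)
  have hc : IsClosed (W : Set R) := W.closed_of_finiteDimensional
  rw [hasDerivAt_iff_tendsto_slope] at h1
  refine hc.mem_of_tendsto h1 (Eventually.of_forall fun t => ?_)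
  rw [slope_def_module, ← Complex.coe_smul]
  exact W.smul_mem _ (by simpa using h t)

/-- If nonzero `e k → 0` in `E` had exponentials in `K`, a limit of the normalized directions would
be a unit vector in both `E` and `lie K`. -/
theorem eventually_eq_zero_of_isCompl {K : Subgroup Rˣ} (hK : IsAnalytic K)
    {E : Submodule ℂ R} (hE : Disjoint (lie K) E) :
    ∀ᶠ e : E in 𝓝 0, expU (e : R) ∈ K → e = 0 := by
  by_contra hcon
  rw [not_eventually] at hcon
  obtain ⟨e, he0, he⟩ := exists_seq_forall_of_frequently hcon
  have heK : ∀ k, expU (e k : R) ∈ K := fun k => by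
    by_contra h; exact he k fun h' => absurd h' h
  have hene : ∀ k, e k ≠ 0 := fun k h => he k fun _ => h
  have hu : ∀ k, ((‖e k‖⁻¹ : ℝ) : ℂ) • e k ∈ Metric.sphere (0 : E) 1 := fun k => by
    have := norm_pos_iff.2 (hene k)
    rw [mem_sphere_zero_iff_norm, norm_smul, Complex.norm_real, norm_inv, norm_norm,
      inv_mul_cancel₀ this.ne']
  obtain ⟨u, hu1, φ, hφ, hlim⟩ := (isCompact_sphere (0 : E) 1).tendsto_subseq hu
  have hcoe : Continuous (fun e : E => (e : R)) := continuous_subtype_val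
  have hmem : (u : R) ∈ lie K := by
    rw [mem_lie hK]
    refine smul_mem_of_real hK fun t => ?_
    refine real_smul_mem_of_seq hK.isClosed (x := fun k => (e (φ k) : R))
      (c := fun k => ‖e (φ k)‖⁻¹) ?_ ?_ (Eventually.of_forall fun k => heK _) t
    · have := (hcoe.tendsto 0).comp (he0.comp hφ.tendsto_atTop)
      simpa [Function.comp_def] using this
    · have := (hcoe.tendsto u).comp hlim
      simpa only [Function.comp_def, Submodule.coe_smul] using this
  have h0 : (u : R) = 0 := by
    have := hE.le_bot ⟨hmem, u.2⟩
    simpa using this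
  have : u = 0 := Subtype.ext h0
  rw [this] at hu1
  simp at hu1

/-- The closed subgroup theorem: near the identity, an algebraic group is the exponential
of its Lie algebra. -/
theorem eventually_exists_lie {K : Subgroup Rˣ} (hK : IsAnalytic K)
    {U : Set R} (hU : U ∈ 𝓝 0) :
    ∀ᶠ g in 𝓝 (1 : Rˣ), g ∈ K → ∃ x ∈ lie K, x ∈ U ∧ expU x = g := by
  obtain ⟨E, hE⟩ := (lie K).exists_isCompl
  -- The map `(a, e) ↦ exp a exp e` has the surjective derivative `a + e` at `0`, so it covers a
  -- neighbourhood of `1`. If the product lies in `K`, so does `exp e`, which forces `e = 0`.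
  let Φ : lie K × E → R :=
    (fun p => NormedSpace.exp (p.1 : R)) * (fun p => NormedSpace.exp (p.2 : R))
  have hΦ0 : Φ 0 = 1 := by simp [Φ]
  let A₁ : lie K × E →L[ℂ] R := (lie K).subtypeL ∘L ContinuousLinearMap.fst ℂ _ _
  let A₂ : lie K × E →L[ℂ] R := E.subtypeL ∘L ContinuousLinearMap.snd ℂ _ _
  have hexp : HasStrictFDerivAt (NormedSpace.exp : R → R) (1 : R →L[ℂ] R) 0 :=
    hasStrictFDerivAt_exp_zero
  have h1 : HasStrictFDerivAt (fun p : lie K × E => NormedSpace.exp (p.1 : R)) A₁ 0 :=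
    HasStrictFDerivAt.comp (f := fun p : lie K × E => (p.1 : R)) (0 : lie K × E)
      (by simpa using hexp) A₁.hasStrictFDerivAt
  have h2 : HasStrictFDerivAt (fun p : lie K × E => NormedSpace.exp (p.2 : R)) A₂ 0 :=
    HasStrictFDerivAt.comp (f := fun p : lie K × E => (p.2 : R)) (0 : lie K × E)
      (by simpa using hexp) A₂.hasStrictFDerivAt
  have hΦ := h1.mul' h2
  simp only [Prod.fst_zero, Prod.snd_zero, ZeroMemClass.coe_zero, NormedSpace.exp_zero,
    MulOpposite.op_one, one_smul] at hΦ
  have hmap := hΦ.map_nhds_eq_of_surj (by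
    rw [LinearMap.range_eq_top]
    intro m
    have : m ∈ lie K ⊔ E := by rw [hE.sup_eq_top]; trivial
    obtain ⟨a, ha, b, hb, rfl⟩ := Submodule.mem_sup.1 this
    refine ⟨(⟨a, ha⟩, ⟨b, hb⟩), ?_⟩
    simp [A₁, A₂, add_comm])
  change map Φ (𝓝 0) = 𝓝 (Φ 0) at hmap
  rw [hΦ0] at hmap
  have hev : ∀ᶠ p in 𝓝 (0 : lie K × E), (p.1 : R) ∈ U ∧ (expU (p.2 : R) ∈ K → p.2 = 0) := by
    refine Eventually.and ?_ ?_
    · have hc : Continuous (fun p : lie K × E => (p.1 : R)) :=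
        continuous_subtype_val.comp continuous_fst
      exact hc.continuousAt.eventually (by simpa using hU)
    · have hc : Tendsto (fun p : lie K × E => p.2) (𝓝 0) (𝓝 0) := continuous_snd.tendsto 0
      exact hc.eventually (eventually_eq_zero_of_isCompl hK hE.disjoint)
  have him : Φ '' {p | (p.1 : R) ∈ U ∧ (expU (p.2 : R) ∈ K → p.2 = 0)} ∈
      𝓝 ((1 : Rˣ) : R) := by
    rw [Units.val_one, ← hmap]
    exact image_mem_map hev
  filter_upwards [eventually_unit him] with g ⟨p, ⟨hpU, hp⟩, hpg⟩ hg
  have hg' : expU (p.1 : R) * expU (p.2 : R) = g := Units.ext hpg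
  have hp1 : expU (p.1 : R) ∈ K := expU_mem hK p.1.2
  have hp2 : expU (p.2 : R) ∈ K := by
    have : expU (p.2 : R) = (expU (p.1 : R))⁻¹ * g := by rw [← hg']; group
    rw [this]
    exact K.mul_mem (K.inv_mem hp1) hg
  refine ⟨p.1, p.1.2, hpU, ?_⟩
  rw [← hg', hp hp2]
  simp

/-- A polynomial function vanishing on an algebraic group near the identity vanishes on every
connected subset through the identity. -/
theorem eq_zero_of_eventually {K : Subgroup Rˣ} (hK : IsAnalytic K)
    {F : R → ℂ} (hF : AnalyticOnNhd ℂ F Set.univ)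
    (h : ∀ᶠ g in 𝓝 (1 : Rˣ), g ∈ K → F (g : R) = 0)
    {C : Set Rˣ} (hCK : C ⊆ K) (hC : IsPreconnected C) (h1 : 1 ∈ C)
    {g : Rˣ} (hg : g ∈ C) : F (g : R) = 0 := by
  let u : Set Rˣ := {x | ∀ᶠ g in 𝓝 x, g ∈ K → F (g : R) = 0}
  let v : Set Rˣ := {x | ∀ᶠ a in 𝓝 x, a ∈ K → a ∉ u}
  have hu : IsOpen u := isOpen_setOfPred_eventually_nhds
  have hv : IsOpen v := isOpen_setOfPred_eventually_nhds
  -- If `x` is a limit of points of `K` near which `F` vanishes on `K`, one of them lies in the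
  -- chart `y ↦ x exp y`; the identity theorem on the vector space `lie K` then carries the
  -- vanishing to all of the chart.
  have huv : ∀ x ∈ K, x ∈ u ∪ v := by
    intro x hx
    have hnear : ∀ᶠ g in 𝓝 x, g ∈ K → ∃ y : lie K, x * expU (y : R) = g := by
      have h2 := eventually_exists_lie hK (U := Set.univ) univ_mem
      have hc : Tendsto (fun g => x⁻¹ * g) (𝓝 x) (𝓝 1) := by
        have : Continuous (fun g : Rˣ => x⁻¹ * g) := by fun_prop
        simpa using this.tendsto x
      filter_upwards [hc.eventually h2] with g hg hgK
      obtain ⟨y, hy, -, hyg⟩ := hg (K.mul_mem (K.inv_mem hx) hgK)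
      exact ⟨⟨y, hy⟩, by rw [hyg]; group⟩
    by_cases hxv : x ∈ v
    · exact Or.inr hxv
    left
    have hfr : ∃ᶠ a in 𝓝 x, a ∈ K ∧ a ∈ u := by
      intro hcon
      apply hxv
      filter_upwards [hcon] with a ha haK hau using ha ⟨haK, hau⟩
    obtain ⟨a, ⟨haK, hau⟩, ha⟩ := (hfr.and_eventually hnear).exists
    obtain ⟨y₀, rfl⟩ := ha haK
    have han : AnalyticOnNhd ℂ
        (fun y : lie K => F ((x : R) * NormedSpace.exp (y : R))) Set.univ := by
      intro y _
      refine (hF _ trivial).comp (analyticAt_const.mul ?_)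
      exact (analyticOnNhd_exp (y : R) trivial).comp ((lie K).subtypeL.analyticAt y)
    have hzero := han.eqOn_zero_of_preconnected_of_eventuallyEq_zero isPreconnected_univ
      (z₀ := y₀) trivial (by
        have hc : Continuous (fun y : lie K => x * expU (y : R)) :=
          continuous_const.mul (continuous_expU.comp continuous_subtype_val)
        filter_upwards [hc.continuousAt.eventually hau] with y hy
        exact hy (K.mul_mem hx (expU_mem hK y.2)))
    change ∀ᶠ g in 𝓝 x, g ∈ K → F (g : R) = 0
    filter_upwards [hnear] with g hg hgK
    obtain ⟨y, rfl⟩ := hg hgK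
    exact hzero (Set.mem_univ y)
  have hCu : C ⊆ u := by
    intro x hx
    by_contra hxu
    have hxv : x ∈ v := (huv x (hCK hx)).resolve_left hxu
    obtain ⟨y, hyC, hyu, hyv⟩ := hC u v hu hv (fun y hy => huv y (hCK hy)) ⟨1, h1, h⟩ ⟨x, hx, hxv⟩
    exact (mem_of_mem_nhds (show ∀ᶠ a in 𝓝 y, a ∈ K → a ∉ u from hyv)) (hCK hyC) hyu
  exact (mem_of_mem_nhds (show ∀ᶠ a in 𝓝 g, a ∈ K → F (a : R) = 0 from hCu hg)) (hCK hg)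

/-! ### Sets reached to first order by smooth families -/

/-- The set `S` contains a smooth family of matrices through `1` whose tangent space at `1`
contains `W`. -/
def Reaches (S : Set Rˣ) (W : Submodule ℂ R) : Prop :=
  ∃ (E : Type) (_ : NormedAddCommGroup E) (_ : NormedSpace ℂ E) (_ : CompleteSpace E)
    (Ψ : E → R) (A : E →L[ℂ] R), Ψ 0 = 1 ∧ HasStrictFDerivAt Ψ A 0 ∧
    (∀ w ∈ W, ∃ e, A e = w) ∧ ∀ e, ∃ g ∈ S, (g : R) = Ψ e

theorem Reaches.mono {S S' : Set Rˣ} {W : Submodule ℂ R} (h : Reaches S W)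
    (hS : S ⊆ S') : Reaches S' W := by
  obtain ⟨E, _, _, _, Ψ, A, h0, h1, h2, h3⟩ := h
  refine ⟨E, _, _, ‹_›, Ψ, A, h0, h1, h2, fun e => ?_⟩
  obtain ⟨g, hg, hge⟩ := h3 e
  exact ⟨g, hS hg, hge⟩

theorem Reaches.mul {S S' : Set Rˣ} {W W' : Submodule ℂ R} (h : Reaches S W)
    (h' : Reaches S' W') : Reaches (S * S') (W ⊔ W') := by
  obtain ⟨E, _, _, _, Ψ, A, h0, h1, h2, h3⟩ := h
  obtain ⟨E', _, _, _, Ψ', A', h0', h1', h2', h3'⟩ := h'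
  have e1 : HasStrictFDerivAt (fun p : E × E' => Ψ p.1) (A ∘L ContinuousLinearMap.fst ℂ E E') 0 :=
    HasStrictFDerivAt.comp (f := Prod.fst) (0 : E × E') h1 hasStrictFDerivAt_fst
  have e2 : HasStrictFDerivAt (fun p : E × E' => Ψ' p.2) (A' ∘L ContinuousLinearMap.snd ℂ E E') 0 :=
    HasStrictFDerivAt.comp (f := Prod.snd) (0 : E × E') h1' hasStrictFDerivAt_snd
  have e3 := e1.mul' e2
  simp only [Prod.fst_zero, Prod.snd_zero, h0, h0', MulOpposite.op_one, one_smul] at e3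
  refine ⟨E × E', inferInstance, inferInstance, inferInstance, _, _, ?_, e3, ?_, ?_⟩
  · simp [h0, h0']
  · intro w hw
    obtain ⟨a, ha, b, hb, rfl⟩ := Submodule.mem_sup.1 hw
    obtain ⟨e, rfl⟩ := h2 a ha
    obtain ⟨e', rfl⟩ := h2' b hb
    exact ⟨(e, e'), by simp [add_comm]⟩
  · rintro ⟨e, e'⟩
    obtain ⟨g, hg, hge⟩ := h3 e
    obtain ⟨g', hg', hge'⟩ := h3' e'
    exact ⟨g * g', Set.mul_mem_mul hg hg', by simp [hge, hge']⟩

theorem reaches_exp (W : Submodule ℂ R) : Reaches (expU '' (W : Set R)) W := by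
  have hexp : HasStrictFDerivAt (NormedSpace.exp : R → R) (1 : R →L[ℂ] R) 0 :=
    hasStrictFDerivAt_exp_zero
  refine ⟨W, inferInstance, inferInstance, inferInstance, fun w => NormedSpace.exp (w : R),
    W.subtypeL, by simp, ?_, fun w hw => ⟨⟨w, hw⟩, rfl⟩, fun e => ⟨_, ⟨e, e.2, rfl⟩, rfl⟩⟩
  exact HasStrictFDerivAt.comp (f := fun p : W => (p : R)) (0 : W)
      (by simpa using hexp) W.subtypeL.hasStrictFDerivAt

theorem reaches_commutator (k : Rˣ) (y : R) :
    Reaches {g | ∃ t : ℂ, g = k * expU (t • y) * k⁻¹ * (expU (t • y))⁻¹}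
      (Submodule.span ℂ {(k : R) * y * (k⁻¹ : Rˣ) - y}) := by
  have hd : HasStrictDerivAt (fun t : ℂ => NormedSpace.exp (t • y)) y 0 := by
    simpa using hasStrictDerivAt_exp_smul_const y (0 : ℂ)
  have hd' : HasStrictDerivAt (fun t : ℂ => NormedSpace.exp (-(t • y))) (-y) 0 := by
    simpa using hasStrictDerivAt_exp_smul_const (-y) (0 : ℂ)
  have h3 : HasStrictDerivAt (fun t : ℂ => (k : R) * NormedSpace.exp (t • y) *
      ((k⁻¹ : Rˣ) : R) * NormedSpace.exp (-(t • y)))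
      ((k : R) * y * (k⁻¹ : Rˣ) - y) 0 := by
    have := ((hd.const_mul (k : R)).mul_const ((k⁻¹ : Rˣ) : R)).mul hd'
    convert this using 1
    · rfl
    · rw [zero_smul, neg_zero, NormedSpace.exp_zero, mul_one, mul_one, Units.mul_inv, one_mul,
        sub_eq_add_neg]
  refine ⟨ℂ, inferInstance, inferInstance, inferInstance, _, _, ?_, h3.hasStrictFDerivAt, ?_, ?_⟩
  · rw [zero_smul, neg_zero, NormedSpace.exp_zero, mul_one, mul_one, Units.mul_inv]
  · intro w hw
    obtain ⟨a, rfl⟩ := Submodule.mem_span_singleton.1 hw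
    exact ⟨a, by simp⟩
  · intro t
    refine ⟨_, ⟨t, rfl⟩, ?_⟩
    rw [← expU_neg]
    rfl

/-- After taking logarithms the family maps into `lie K` near `0`, with derivative onto `lie K`, so
it covers a neighbourhood of `0` there. The projection `p` serves only to give the map the target
`lie K`. -/
theorem Reaches.eventually_mem {K : Subgroup Rˣ} (hK : IsAnalytic K)
    {S : Set Rˣ} (hS : S ⊆ K) {W : Submodule ℂ R} (h : Reaches S W)
    (hW : lie K ≤ W) : ∀ᶠ g in 𝓝 (1 : Rˣ), g ∈ K → g ∈ S := by
  obtain ⟨E, _, _, _, Ψ, A, h0, h1, h2, h3⟩ := h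
  obtain ⟨L, hL, hL1, hL2, hL3⟩ := exists_log (R := R)
  obtain ⟨p, hp⟩ := (lie K).subtype.exists_leftInverse_of_injective (lie K).ker_subtype
  have hp' : ∀ x (hx : x ∈ lie K), (p x : R) = x := fun x hx =>
    congrArg Subtype.val (LinearMap.congr_fun hp ⟨x, hx⟩)
  have hΨc : Tendsto Ψ (𝓝 0) (𝓝 1) := by simpa [h0] using h1.continuousAt.tendsto
  have hLΨ : ∀ᶠ e in 𝓝 (0 : E), L (Ψ e) ∈ lie K := by
    have := eventually_val (eventually_exists_lie hK hL3)
    rw [Units.val_one] at this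
    filter_upwards [hΨc.eventually this] with e he
    obtain ⟨g, hg, hge⟩ := h3 e
    obtain ⟨x, hx, hxU, hxg⟩ := he g hge (hS hg)
    have : L (NormedSpace.exp x) = x := hxU
    rwa [← hge, ← hxg, coe_expU, this]
  have hgood := hLΨ.and (hΨc.eventually hL2)
  let p' : R →L[ℂ] lie K := p.toContinuousLinearMap
  have hpp : ∀ x, p' x = p x := fun _ => rfl
  have hf : HasStrictFDerivAt (fun e => p' (L (Ψ e))) (p' ∘L A) 0 := by
    have hL' : HasStrictFDerivAt L (1 : R →L[ℂ] R) (Ψ 0) := by rw [h0]; exact hL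
    exact p'.hasStrictFDerivAt.comp (0 : E) (hL'.comp (0 : E) h1)
  have hmap := hf.map_nhds_eq_of_surj (by
    rw [LinearMap.range_eq_top]
    intro y
    obtain ⟨e, he⟩ := h2 y (hW y.2)
    refine ⟨e, Subtype.ext ?_⟩
    have := hp' y y.2
    simpa [he, hpp] using this)
  simp only [h0, hL1, map_zero] at hmap
  have him := image_mem_map (m := fun e => p' (L (Ψ e))) hgood
  rw [hmap, nhds_subtype_eq_comap, mem_comap] at him
  obtain ⟨U, hU, hUs⟩ := him
  filter_upwards [eventually_exists_lie hK (U := U) (by simpa using hU)] with g hg hgK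
  obtain ⟨x, hx, hxU, rfl⟩ := hg hgK
  obtain ⟨e, ⟨he1, he2⟩, he3⟩ := hUs (show (⟨x, hx⟩ : lie K) ∈ _ from hxU)
  have : L (Ψ e) = x := by
    rw [← hp' _ he1]
    exact congrArg Subtype.val he3
  rw [this] at he2
  obtain ⟨g, hg, hge⟩ := h3 e
  have : expU x = g := Units.ext (by rw [hge, ← he2]; rfl)
  rwa [this]

end NormedAlg
end RealReductive

namespace RealReductive
open Matrix Filter Topology

/-- Square complex matrices. -/
abbrev Mat (n : ℕ) := Matrix (Fin n) (Fin n) ℂ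

variable {n : ℕ}

/-! ### Polynomial functions on matrices -/

/-- A polynomial function of the matrix entries. -/
def IsPoly (F : Mat n → ℂ) : Prop :=
  ∃ p : MvPolynomial (Fin n × Fin n) ℂ, ∀ m, F m = MvPolynomial.eval (fun ij => m ij.1 ij.2) p

theorem IsPoly.const (c : ℂ) : IsPoly (fun _ : Mat n => c) := ⟨MvPolynomial.C c, by simp⟩

theorem IsPoly.coord (i j : Fin n) : IsPoly (fun m : Mat n => m i j) :=
  ⟨MvPolynomial.X (i, j), by simp⟩

theorem IsPoly.add {F F' : Mat n → ℂ} (h : IsPoly F) (h' : IsPoly F') :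
    IsPoly (fun m => F m + F' m) := by
  obtain ⟨p, hp⟩ := h
  obtain ⟨q, hq⟩ := h'
  exact ⟨p + q, fun m => by simp [hp, hq]⟩

theorem IsPoly.mul {F F' : Mat n → ℂ} (h : IsPoly F) (h' : IsPoly F') :
    IsPoly (fun m => F m * F' m) := by
  obtain ⟨p, hp⟩ := h
  obtain ⟨q, hq⟩ := h'
  exact ⟨p * q, fun m => by simp [hp, hq]⟩

theorem IsPoly.sub {F F' : Mat n → ℂ} (h : IsPoly F) (h' : IsPoly F') :
    IsPoly (fun m => F m - F' m) := by
  obtain ⟨p, hp⟩ := h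
  obtain ⟨q, hq⟩ := h'
  exact ⟨p - q, fun m => by simp [hp, hq]⟩

theorem IsPoly.sum {ι : Type*} (s : Finset ι) {F : ι → Mat n → ℂ} (h : ∀ i ∈ s, IsPoly (F i)) :
    IsPoly (fun m => ∑ i ∈ s, F i m) := by
  classical
  induction s using Finset.induction_on with
  | empty => simpa using IsPoly.const 0
  | insert a s ha ih =>
    simp only [Finset.sum_insert ha]
    exact (h a (by simp)).add (ih fun i hi => h i (by simp [hi]))

theorem IsPoly.prod {ι : Type*} (s : Finset ι) {F : ι → Mat n → ℂ} (h : ∀ i ∈ s, IsPoly (F i)) :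
    IsPoly (fun m => ∏ i ∈ s, F i m) := by
  classical
  induction s using Finset.induction_on with
  | empty => simpa using IsPoly.const 1
  | insert a s ha ih =>
    simp only [Finset.prod_insert ha]
    exact (h a (by simp)).mul (ih fun i hi => h i (by simp [hi]))

theorem IsPoly.pow {F : Mat n → ℂ} (h : IsPoly F) (k : ℕ) : IsPoly (fun m => F m ^ k) := by
  obtain ⟨p, hp⟩ := h
  exact ⟨p ^ k, fun m => by simp [hp]⟩

theorem IsPoly.det {ι : Type*} [Fintype ι] [DecidableEq ι] {Φ : Mat n → Matrix ι ι ℂ}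
    (h : ∀ i j, IsPoly (fun m => Φ m i j)) : IsPoly (fun m => (Φ m).det) := by
  simp only [Matrix.det_apply']
  exact IsPoly.sum _ fun σ _ => (IsPoly.const _).mul (IsPoly.prod _ fun i _ => h _ _)

theorem IsPoly.mul_mat {Φ Φ' : Mat n → Mat n} (h : ∀ i j, IsPoly (fun m => Φ m i j))
    (h' : ∀ i j, IsPoly (fun m => Φ' m i j)) (i j : Fin n) :
    IsPoly (fun m => (Φ m * Φ' m) i j) := by
  simp only [Matrix.mul_apply]
  exact IsPoly.sum _ fun k _ => (h _ _).mul (h' _ _)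

theorem IsPoly.comp {F : Mat n → ℂ} (hF : IsPoly F) {Φ : Mat n → Mat n}
    (h : ∀ i j, IsPoly (fun m => Φ m i j)) : IsPoly (fun m => F (Φ m)) := by
  obtain ⟨p, hp⟩ := hF
  choose q hq using h
  refine ⟨MvPolynomial.bind₁ (fun ij : Fin n × Fin n => q ij.1 ij.2) p, fun m => ?_⟩
  change F (Φ m) = _
  rw [hp, ← MvPolynomial.coe_aeval_eq_eval, ← MvPolynomial.coe_aeval_eq_eval]
  simp only [RingHom.coe_coe, MvPolynomial.aeval_bind₁]
  congr 2
  ext ij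
  exact (hq ij.1 ij.2 m).trans (RingHom.congr_fun (MvPolynomial.coe_aeval_eq_eval _) _).symm

theorem IsPoly.conj {F : Mat n → ℂ} (hF : IsPoly F) (A B : Mat n) :
    IsPoly (fun m => F (A * m * B)) :=
  hF.comp (IsPoly.mul_mat (IsPoly.mul_mat (fun _ _ => IsPoly.const _) IsPoly.coord)
    (fun _ _ => IsPoly.const _))

theorem IsPoly.linear (f : Mat n →ₗ[ℂ] ℂ) : IsPoly f := by
  have : (f : Mat n → ℂ) = fun m => ∑ i, ∑ j, m i j * f (Matrix.single i j 1) := by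
    ext m
    conv_lhs => rw [Matrix.matrix_eq_sum_single m]
    simp only [map_sum]
    refine Finset.sum_congr rfl fun i _ => Finset.sum_congr rfl fun j _ => ?_
    rw [← smul_eq_mul, ← map_smul, Matrix.smul_single, smul_eq_mul, mul_one]
  rw [this]
  exact IsPoly.sum _ fun i _ => IsPoly.sum _ fun j _ => (IsPoly.coord i j).mul (IsPoly.const _)

section
open scoped Matrix.Norms.Operator

theorem IsPoly.analyticOnNhd {F : Mat n → ℂ} (hF : IsPoly F) : AnalyticOnNhd ℂ F Set.univ := by
  obtain ⟨p, hp⟩ := hF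
  have hF : F = fun m => MvPolynomial.aeval (fun ij : Fin n × Fin n => m ij.1 ij.2) p :=
    funext fun m =>
      (hp m).trans (RingHom.congr_fun (MvPolynomial.coe_aeval_eq_eval _) _).symm
  rw [hF]
  intro e _
  refine AnalyticAt.aeval_mvPolynomial (fun ij => ?_) p
  let L : Mat n →ₗ[ℂ] ℂ := Matrix.entryLinearMap ℂ ℂ ij.1 ij.2
  exact L.toContinuousLinearMap.analyticAt e

theorem IsPoly.continuous {F : Mat n → ℂ} (hF : IsPoly F) : Continuous F :=
  continuousOn_univ.1 hF.analyticOnNhd.continuousOn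

end

theorem isAlgebraicSubgroup_iff {K : Subgroup (GL (Fin n) ℂ)} :
    IsAlgebraicSubgroup K ↔ ∃ S : Set (Mat n → ℂ), (∀ F ∈ S, IsPoly F) ∧
      ∀ g : GL (Fin n) ℂ, g ∈ K ↔ ∀ F ∈ S, F (g : Mat n) = 0 := by
  constructor
  · rintro ⟨S, hS⟩
    refine ⟨(fun p m => MvPolynomial.eval (fun ij : Fin n × Fin n => m ij.1 ij.2) p) '' S, ?_, ?_⟩
    · rintro _ ⟨p, -, rfl⟩
      exact ⟨p, fun _ => rfl⟩
    · intro g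
      rw [hS, Set.forall_mem_image]
      rfl
  · rintro ⟨S, hS, h⟩
    refine ⟨{p | ∃ F ∈ S, ∀ m, F m = MvPolynomial.eval (fun ij => m ij.1 ij.2) p}, fun g => ?_⟩
    rw [h]
    constructor
    · rintro hg p ⟨F, hF, hp⟩
      rw [← hg F hF, hp]
      rfl
    · intro hg F hF
      obtain ⟨p, hp⟩ := hS F hF
      rw [hp]
      exact hg p ⟨F, hF, hp⟩

theorem IsAlgebraicSubgroup.inf {K K' : Subgroup (GL (Fin n) ℂ)} (h : IsAlgebraicSubgroup K)
    (h' : IsAlgebraicSubgroup K') : IsAlgebraicSubgroup (K ⊓ K') := by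
  obtain ⟨S, hS⟩ := h
  obtain ⟨S', hS'⟩ := h'
  refine ⟨S ∪ S', fun g => ?_⟩
  rw [Subgroup.mem_inf, hS, hS']
  constructor
  · rintro ⟨h1, h2⟩ p (hp | hp)
    exacts [h1 p hp, h2 p hp]
  · exact fun h => ⟨fun p hp => h p (Or.inl hp), fun p hp => h p (Or.inr hp)⟩

/-! ### The exponential and the Lie algebra of a matrix group -/

/-- The matrix exponential, as an invertible matrix. -/
noncomputable def expU (x : Mat n) : GL (Fin n) ℂ where
  val := NormedSpace.exp x
  inv := NormedSpace.exp (-x)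
  val_inv := by rw [← Matrix.exp_add_of_commute _ _ (Commute.refl x).neg_right]; simp
  inv_val := by rw [← Matrix.exp_add_of_commute _ _ (Commute.refl x).neg_left]; simp

@[simp] theorem coe_expU (x : Mat n) : (expU x : Mat n) = NormedSpace.exp x := rfl

theorem expU_add {x y : Mat n} (h : Commute x y) : expU (x + y) = expU x * expU y :=
  Units.ext (Matrix.exp_add_of_commute x y h)

@[simp] theorem expU_zero : expU (0 : Mat n) = 1 := Units.ext (by simp)

theorem expU_neg (x : Mat n) : expU (-x) = (expU x)⁻¹ := Units.ext rfl

theorem expU_nsmul (k : ℕ) (x : Mat n) : expU (k • x) = expU x ^ k :=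
  Units.ext (by simpa using Matrix.exp_nsmul k x)

/-- The Lie algebra of an algebraic subgroup of `GL_n(ℂ)`. -/
noncomputable def lie (K : Subgroup (GL (Fin n) ℂ)) : Submodule ℂ (Mat n) :=
  Submodule.span ℂ {x | ∀ t : ℂ, expU (t • x) ∈ K}

theorem lie_mono {K K' : Subgroup (GL (Fin n) ℂ)} (h : K ≤ K') : lie K ≤ lie K' :=
  Submodule.span_mono fun _ hx t => h (hx t)

/-! ### Transfer from normed algebras to matrices with the operator norm. -/

section
open scoped Matrix.Norms.Operator

/-- The rational normed algebra structure on matrices. -/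
noncomputable abbrev ratNormedAlgebra (n : ℕ) : NormedAlgebra ℚ (Mat n) :=
  NormedAlgebra.restrictScalars ℚ ℂ (Mat n)

attribute [local instance] ratNormedAlgebra

theorem IsAlgebraicSubgroup.isAnalytic {K : Subgroup (GL (Fin n) ℂ)} (h : IsAlgebraicSubgroup K) :
    NormedAlg.IsAnalytic (R := Mat n) K := by
  obtain ⟨S, hS, h⟩ := isAlgebraicSubgroup_iff.1 h
  exact ⟨S, fun F hF => (hS F hF).analyticOnNhd, h⟩

theorem isEmbedding_val : Topology.IsOpenEmbedding (fun g : GL (Fin n) ℂ => (g : Mat n)) :=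
  Units.isOpenEmbedding_val (R := Mat n)

theorem expU_conj (g : GL (Fin n) ℂ) (x : Mat n) :
    expU ((g : Mat n) * x * ((g⁻¹ : GL (Fin n) ℂ) : Mat n)) = g * expU x * g⁻¹ :=
  NormedAlg.expU_conj (R := Mat n) g x

theorem continuous_expU : Continuous (expU : Mat n → GL (Fin n) ℂ) :=
  NormedAlg.continuous_expU (R := Mat n)

theorem mem_lie {K : Subgroup (GL (Fin n) ℂ)} (hK : IsAlgebraicSubgroup K) {x : Mat n} :
    x ∈ lie K ↔ ∀ t : ℂ, expU (t • x) ∈ K :=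
  NormedAlg.mem_lie (R := Mat n) hK.isAnalytic

theorem conj_mem_lie {K : Subgroup (GL (Fin n) ℂ)} (hK : IsAlgebraicSubgroup K) {x : Mat n}
    (hx : x ∈ lie K) {g : GL (Fin n) ℂ} (hg : g ∈ K) :
    (g : Mat n) * x * (g⁻¹ : GL (Fin n) ℂ) ∈ lie K :=
  NormedAlg.conj_mem_lie (R := Mat n) hK.isAnalytic hx hg

theorem bracket_mem {K : Subgroup (GL (Fin n) ℂ)} (hK : IsAlgebraicSubgroup K) {x : Mat n}
    (hx : x ∈ lie K) {W : Submodule ℂ (Mat n)}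
    (hW : ∀ g ∈ K, ∀ y ∈ W, (g : Mat n) * y * (g⁻¹ : GL (Fin n) ℂ) ∈ W) {y : Mat n} (hy : y ∈ W) :
    x * y - y * x ∈ W :=
  NormedAlg.bracket_mem (R := Mat n) hK.isAnalytic hx hW hy

theorem mem_of_exp_mem {W : Submodule ℂ (Mat n)} {x m : Mat n}
    (h : ∀ t : ℝ, m * NormedSpace.exp ((t : ℂ) • x) - m ∈ W) : m * x ∈ W :=
  NormedAlg.mem_of_exp_mem (R := Mat n) h

/-- The closed subgroup theorem: near the identity, an algebraic group is the exponential
of its Lie algebra. -/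
theorem eventually_exists_lie {K : Subgroup (GL (Fin n) ℂ)} (hK : IsAlgebraicSubgroup K) :
    ∀ᶠ g in 𝓝 (1 : GL (Fin n) ℂ), g ∈ K → ∃ x ∈ lie K, expU x = g := by
  filter_upwards [NormedAlg.eventually_exists_lie (R := Mat n) hK.isAnalytic univ_mem] with g hg hgK
  obtain ⟨x, hx, -, hxg⟩ := hg hgK
  exact ⟨x, hx, hxg⟩

/-- A polynomial function vanishing on an algebraic group near the identity vanishes on every
connected subset through the identity. -/
theorem IsPoly.eq_zero_of_eventually {K : Subgroup (GL (Fin n) ℂ)} (hK : IsAlgebraicSubgroup K)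
    {F : Mat n → ℂ} (hF : IsPoly F)
    (h : ∀ᶠ g in 𝓝 (1 : GL (Fin n) ℂ), g ∈ K → F (g : Mat n) = 0)
    {C : Set (GL (Fin n) ℂ)} (hCK : C ⊆ K) (hC : IsPreconnected C) (h1 : 1 ∈ C)
    {g : GL (Fin n) ℂ} (hg : g ∈ C) : F (g : Mat n) = 0 :=
  NormedAlg.eq_zero_of_eventually (R := Mat n) hK.isAnalytic hF.analyticOnNhd h hCK hC h1 hg

/-- The set `S` contains a smooth family of matrices through `1` whose tangent space at `1`
contains `W`. -/
def Reaches (S : Set (GL (Fin n) ℂ)) (W : Submodule ℂ (Mat n)) : Prop :=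
  NormedAlg.Reaches (R := Mat n) S W

theorem Reaches.mono {S S' : Set (GL (Fin n) ℂ)} {W : Submodule ℂ (Mat n)} (h : Reaches S W)
    (hS : S ⊆ S') : Reaches S' W :=
  NormedAlg.Reaches.mono h hS

theorem Reaches.mul {S S' : Set (GL (Fin n) ℂ)} {W W' : Submodule ℂ (Mat n)} (h : Reaches S W)
    (h' : Reaches S' W') : Reaches (S * S') (W ⊔ W') :=
  NormedAlg.Reaches.mul h h'

theorem reaches_exp (W : Submodule ℂ (Mat n)) : Reaches (expU '' (W : Set (Mat n))) W :=
  NormedAlg.reaches_exp (R := Mat n) W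

theorem reaches_commutator (k : GL (Fin n) ℂ) (y : Mat n) :
    Reaches {g | ∃ t : ℂ, g = k * expU (t • y) * k⁻¹ * (expU (t • y))⁻¹}
      (Submodule.span ℂ {(k : Mat n) * y * (k⁻¹ : GL (Fin n) ℂ) - y}) :=
  NormedAlg.reaches_commutator (R := Mat n) k y

theorem Reaches.eventually_mem {K : Subgroup (GL (Fin n) ℂ)} (hK : IsAlgebraicSubgroup K)
    {S : Set (GL (Fin n) ℂ)} (hS : S ⊆ K) {W : Submodule ℂ (Mat n)} (h : Reaches S W)
    (hW : lie K ≤ W) : ∀ᶠ g in 𝓝 (1 : GL (Fin n) ℂ), g ∈ K → g ∈ S :=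
  NormedAlg.Reaches.eventually_mem (R := Mat n) hK.isAnalytic hS h hW

end

theorem expU_mem {K : Subgroup (GL (Fin n) ℂ)} (hK : IsAlgebraicSubgroup K) {x : Mat n}
    (hx : x ∈ lie K) : expU x ∈ K := by
  simpa using (mem_lie hK).1 hx 1

theorem lie_inf {K K' : Subgroup (GL (Fin n) ℂ)} (h : IsAlgebraicSubgroup K)
    (h' : IsAlgebraicSubgroup K') : lie (K ⊓ K') = lie K ⊓ lie K' := by
  ext x
  rw [Submodule.mem_inf, mem_lie (h.inf h'), mem_lie h, mem_lie h', ← forall_and]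
  exact Iff.rfl

theorem Reaches.sup {Q : Subgroup (GL (Fin n) ℂ)} {W W' : Submodule ℂ (Mat n)}
    (h : Reaches (Q : Set (GL (Fin n) ℂ)) W) (h' : Reaches (Q : Set (GL (Fin n) ℂ)) W') :
    Reaches (Q : Set (GL (Fin n) ℂ)) (W ⊔ W') :=
  (h.mul h').mono (by rintro _ ⟨a, ha, b, hb, rfl⟩; exact Q.mul_mem ha hb)

/-- A subgroup containing a neighbourhood of the identity in `K` contains every connected
subset of `K` through the identity. -/
theorem subset_of_eventually_mem {K Q : Subgroup (GL (Fin n) ℂ)}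
    (h : ∀ᶠ g in 𝓝 (1 : GL (Fin n) ℂ), g ∈ K → g ∈ Q) {C : Set (GL (Fin n) ℂ)} (hCK : C ⊆ K)
    (hC : IsPreconnected C) (h1 : 1 ∈ C) : C ⊆ Q := by
  -- Translation by `x` makes membership in `Q` locally constant on `K`.
  have key : ∀ x ∈ K, ∀ᶠ g in 𝓝 x, g ∈ K → (g ∈ Q ↔ x ∈ Q) := by
    intro x hx
    have hc : Tendsto (fun g => x⁻¹ * g) (𝓝 x) (𝓝 1) := by
      have : Continuous (fun g : GL (Fin n) ℂ => x⁻¹ * g) := by fun_prop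
      simpa using this.tendsto x
    filter_upwards [hc.eventually h] with g hg hgK
    have hq := hg (K.mul_mem (K.inv_mem hx) hgK)
    constructor
    · intro hgQ
      have := Q.mul_mem hgQ (Q.inv_mem hq)
      simpa using this
    · intro hxQ
      have := Q.mul_mem hxQ hq
      simpa using this
  intro g hg
  by_contra hgQ
  let u : Set (GL (Fin n) ℂ) := {x | ∀ᶠ g in 𝓝 x, g ∈ K → g ∈ Q}
  let v : Set (GL (Fin n) ℂ) := {x | ∀ᶠ g in 𝓝 x, g ∈ K → g ∉ Q}
  have hu : IsOpen u := isOpen_setOfPred_eventually_nhds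
  have hv : IsOpen v := isOpen_setOfPred_eventually_nhds
  have hxu : ∀ x ∈ K, x ∈ Q → x ∈ u := fun x hx hxQ => by
    change ∀ᶠ g in 𝓝 x, g ∈ K → g ∈ Q
    filter_upwards [key x hx] with g hg hgK using (hg hgK).2 hxQ
  have hxv : ∀ x ∈ K, x ∉ Q → x ∈ v := fun x hx hxQ => by
    change ∀ᶠ g in 𝓝 x, g ∈ K → g ∉ Q
    filter_upwards [key x hx] with g hg hgK h using hxQ ((hg hgK).1 h)
  obtain ⟨y, hyC, hyu, hyv⟩ := hC u v hu hv
    (fun y hy => by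
      by_cases hyQ : y ∈ Q
      exacts [Or.inl (hxu y (hCK hy) hyQ), Or.inr (hxv y (hCK hy) hyQ)])
    ⟨1, h1, h⟩ ⟨g, hg, hxv g (hCK hg) hgQ⟩
  exact (mem_of_mem_nhds (show ∀ᶠ g in 𝓝 y, g ∈ K → g ∉ Q from hyv)) (hCK hyC)
    ((mem_of_mem_nhds (show ∀ᶠ g in 𝓝 y, g ∈ K → g ∈ Q from hyu)) (hCK hyC))

/-! ### Diagonalizable matrices -/

/-- The matrix that `P` conjugates to the diagonal matrix `d`. -/
def dg (P : GL (Fin n) ℂ) : (Fin n → ℂ) →ₐ[ℂ] Mat n where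
  toFun d := ((P⁻¹ : GL (Fin n) ℂ) : Mat n) * diagonal d * (P : Mat n)
  map_one' := by
    rw [show (1 : Fin n → ℂ) = fun _ => 1 from rfl, diagonal_one, mul_one, Units.inv_mul]
  map_zero' := by
    rw [show (0 : Fin n → ℂ) = fun _ => 0 from rfl, diagonal_zero, mul_zero, zero_mul]
  map_add' d e := by
    rw [← add_mul, ← mul_add, diagonal_add]
    rfl
  map_mul' d e := by
    rw [show diagonal (d * e) = diagonal d * diagonal e from (diagonal_mul_diagonal d e).symm]
    simp only [mul_assoc, Units.mul_inv_cancel_left]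
  commutes' c := by
    rw [← Matrix.algebraMap_eq_diagonal, mul_assoc, Algebra.commutes, ← mul_assoc, Units.inv_mul,
      one_mul]

theorem dg_apply (P : GL (Fin n) ℂ) (d : Fin n → ℂ) :
    dg P d = ((P⁻¹ : GL (Fin n) ℂ) : Mat n) * diagonal d * (P : Mat n) := rfl

theorem conj_dg (P : GL (Fin n) ℂ) (d : Fin n → ℂ) :
    (P : Mat n) * dg P d * ((P⁻¹ : GL (Fin n) ℂ) : Mat n) = diagonal d := by
  rw [dg_apply]
  simp only [mul_assoc, Units.mul_inv_cancel_left, Units.mul_inv, mul_one]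

theorem exists_dg_of_isDiag {P : GL (Fin n) ℂ} {m : Mat n}
    (h : ((P : Mat n) * m * ((P⁻¹ : GL (Fin n) ℂ) : Mat n)).IsDiag) : ∃ d, m = dg P d := by
  refine ⟨((P : Mat n) * m * ((P⁻¹ : GL (Fin n) ℂ) : Mat n)).diag, ?_⟩
  rw [dg_apply, h.diagonal_diag]
  simp only [mul_assoc, Units.inv_mul_cancel_left, Units.inv_mul, mul_one]

theorem isDiagonalizable_iff {K : Subgroup (GL (Fin n) ℂ)} :
    IsDiagonalizable K ↔ ∃ P : GL (Fin n) ℂ, ∀ g ∈ K, ∃ d, (g : Mat n) = dg P d := by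
  refine exists_congr fun P => forall₂_congr fun g _ => ?_
  constructor
  · intro h
    exact exists_dg_of_isDiag (by simpa using h)
  · rintro ⟨d, hd⟩
    rw [Units.val_mul, Units.val_mul, hd, conj_dg]
    exact isDiag_diagonal d

theorem trace_dg (P : GL (Fin n) ℂ) (d : Fin n → ℂ) : (dg P d).trace = ∑ i, d i := by
  rw [dg_apply, Matrix.trace_mul_cycle, Units.mul_inv, one_mul, trace_diagonal]

theorem det_dg (P : GL (Fin n) ℂ) (d : Fin n → ℂ) : (dg P d).det = ∏ i, d i := by
  rw [dg_apply, det_mul_comm, ← mul_assoc, Units.mul_inv, one_mul, det_diagonal]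

theorem exp_dg (P : GL (Fin n) ℂ) (d : Fin n → ℂ) :
    NormedSpace.exp (dg P d) = dg P (fun i => Complex.exp (d i)) := by
  have h := Matrix.exp_conj' (P : Mat n) (diagonal d) P.isUnit
  rw [← Matrix.coe_units_inv] at h
  rw [dg_apply, h, Matrix.exp_diagonal, dg_apply]
  congr 3
  rw [Pi.exp_def]
  ext i
  rw [Complex.exp_eq_exp_ℂ]

theorem commute_dg (P : GL (Fin n) ℂ) (d e : Fin n → ℂ) : Commute (dg P d) (dg P e) := by
  rw [Commute, SemiconjBy, ← map_mul, ← map_mul, mul_comm]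

theorem commute_dg_iff (P : GL (Fin n) ℂ) (d : Fin n → ℂ) (y : Mat n) :
    Commute y (dg P d) ↔
      ∀ i j, d i ≠ d j → ((P : Mat n) * y * ((P⁻¹ : GL (Fin n) ℂ) : Mat n)) i j = 0 := by
  have h1 : Commute y (dg P d) ↔
      ((P : Mat n) * y * ((P⁻¹ : GL (Fin n) ℂ) : Mat n)) * diagonal d =
        diagonal d * ((P : Mat n) * y * ((P⁻¹ : GL (Fin n) ℂ) : Mat n)) := by
    rw [Commute, SemiconjBy, dg_apply]
    constructor
    · intro h
      have := congrArg (fun m : Mat n => (P : Mat n) * m * ((P⁻¹ : GL (Fin n) ℂ) : Mat n)) h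
      simpa [mul_assoc] using this
    · intro h
      have := congrArg (fun m : Mat n => ((P⁻¹ : GL (Fin n) ℂ) : Mat n) * m * (P : Mat n)) h
      simpa [mul_assoc] using this
  rw [h1, ← Matrix.ext_iff]
  refine forall₂_congr fun i j => ?_
  rw [mul_diagonal, diagonal_mul, mul_comm]
  constructor
  · intro h hd
    by_contra h0
    exact hd (mul_right_cancel₀ h0 h).symm
  · intro h
    by_cases hd : d i = d j
    · rw [hd]
    · rw [h hd, mul_zero, mul_zero]

/-- Commuting with a diagonal matrix depends only on which eigenvalues coincide, and `f` can only
merge eigenvalues. -/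
theorem commute_dg_comp {P : GL (Fin n) ℂ} {d : Fin n → ℂ} {y : Mat n} (h : Commute y (dg P d))
    (f : ℂ → ℂ) : Commute y (dg P (f ∘ d)) := by
  rw [commute_dg_iff] at h ⊢
  exact fun i j hij => h i j fun h' => hij (congrArg f h')

/-- A basis extracted from the spanning set of common eigenvectors supplies the columns of `P⁻¹`. -/
theorem exists_dg_of_span {S : Set (Mat n)}
    (h : Submodule.span ℂ {v : Fin n → ℂ | ∀ x ∈ S, ∃ c : ℂ, x *ᵥ v = c • v} = ⊤) :
    ∃ P : GL (Fin n) ℂ, ∀ x ∈ S, ∃ d, x = dg P d := by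
  let b₀ := Module.Basis.ofSpan h.ge
  let e := Pi.basisFun ℂ (Fin n)
  let b := b₀.reindex (b₀.indexEquiv e)
  have hb : ∀ j, ∀ x ∈ S, ∃ c : ℂ, x *ᵥ b j = c • b j := by
    intro j
    have : b j ∈ Set.range b₀ := by
      rw [← b₀.range_reindex (b₀.indexEquiv e)]
      exact Set.mem_range_self j
    exact Module.Basis.ofSpan_subset h.ge this
  let Q : GL (Fin n) ℂ := ⟨e.toMatrix b, b.toMatrix e, e.toMatrix_mul_toMatrix_flip b,
    b.toMatrix_mul_toMatrix_flip e⟩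
  refine ⟨Q⁻¹, fun x hx => ?_⟩
  choose d hd using fun j => hb j x hx
  refine ⟨d, ?_⟩
  have hQ : x * (Q : Mat n) = (Q : Mat n) * diagonal d := by
    ext i j
    have h1 : ∀ k, (Q : Mat n) k j = b j k := fun k => by simp [Q, e, Module.Basis.toMatrix_apply]
    rw [mul_diagonal, h1, mul_comm]
    refine Eq.trans ?_ (congrFun (hd j) i)
    rw [Matrix.mul_apply]
    simp only [h1]
    rfl
  rw [dg_apply, inv_inv, ← hQ, mul_assoc, Units.mul_inv, mul_one]

theorem dg_mulVec_eq_zero_iff (P : GL (Fin n) ℂ) (e v : Fin n → ℂ) :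
    dg P e *ᵥ v = 0 ↔ ∀ i, e i * ((P : Mat n) *ᵥ v) i = 0 := by
  have h1 : (P : Mat n) *ᵥ (dg P e *ᵥ v) = diagonal e *ᵥ ((P : Mat n) *ᵥ v) := by
    rw [Matrix.mulVec_mulVec, dg_apply]
    simp only [mul_assoc, Units.mul_inv_cancel_left, Matrix.mulVec_mulVec]
  constructor
  · intro h i
    rw [h, Matrix.mulVec_zero] at h1
    rw [← Matrix.mulVec_diagonal, ← h1]
    rfl
  · intro h
    have h2 : (P : Mat n) *ᵥ (dg P e *ᵥ v) = 0 := by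
      rw [h1]
      ext i
      rw [Matrix.mulVec_diagonal, h i]
      rfl
    have h3 := congrArg (fun w => ((P⁻¹ : GL (Fin n) ℂ) : Mat n) *ᵥ w) h2
    simpa [Matrix.mulVec_mulVec] using h3

/-- Simultaneous diagonalization. -/
theorem exists_dg_of_commute {S : Set (Mat n)} (hc : ∀ x ∈ S, ∀ y ∈ S, Commute x y)
    (hd : ∀ x ∈ S, ∃ (P : GL (Fin n) ℂ) (d : Fin n → ℂ), x = dg P d) :
    ∃ P : GL (Fin n) ℂ, ∀ x ∈ S, ∃ d, x = dg P d := by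
  apply exists_dg_of_span
  let f : S → Module.End ℂ (Fin n → ℂ) := fun x => Matrix.toLinAlgEquiv' (x : Mat n)
  have htop := Module.End.iSup_iInf_maxGenEigenspace_eq_top_of_iSup_maxGenEigenspace_eq_top_of_commute
    f (fun x y _ => (hc x x.2 y y.2).map (Matrix.toLinAlgEquiv' : Mat n ≃ₐ[ℂ] _))
    (fun x => Module.End.iSup_maxGenEigenspace_eq_top (f x))
  rw [eq_top_iff, ← htop]
  refine iSup_le fun χ v hv => Submodule.subset_span fun x hx => ⟨χ ⟨x, hx⟩, ?_⟩
  have hv' := (Submodule.mem_iInf _).1 hv ⟨x, hx⟩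
  rw [Module.End.mem_maxGenEigenspace] at hv'
  obtain ⟨k, hk⟩ := hv'
  obtain ⟨P, d, rfl⟩ := hd x hx
  set μ := χ ⟨dg P d, hx⟩ with hμ
  have h1 : (f ⟨dg P d, hx⟩ - μ • (1 : Module.End ℂ (Fin n → ℂ))) ^ k =
      Matrix.toLinAlgEquiv' (dg P ((d - fun _ => μ) ^ k)) := by
    rw [map_pow, map_pow, map_sub, map_sub]
    congr 2
    have : (fun _ => μ : Fin n → ℂ) = μ • 1 := by ext; simp
    rw [this, map_smul, map_smul, map_one, map_one]
  rw [h1, Matrix.toLinAlgEquiv'_apply, dg_mulVec_eq_zero_iff] at hk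
  -- For a diagonalizable matrix a generalized eigenvector is an eigenvector: in coordinates, `(d i
  -- - μ) ^ k * z = 0` already forces `(d i - μ) * z = 0`.
  have h2 : dg P (d - fun _ => μ) *ᵥ v = 0 := by
    rw [dg_mulVec_eq_zero_iff]
    intro i
    rcases mul_eq_zero.1 (hk i) with h | h
    · have : (d - (fun _ => μ : Fin n → ℂ)) i = 0 := eq_zero_of_pow_eq_zero (n := k) (by simpa using h)
      rw [this, zero_mul]
    · rw [h, mul_zero]
  have : (fun _ => μ : Fin n → ℂ) = μ • 1 := by ext; simp
  rw [this, map_sub, map_smul, map_one, Matrix.sub_mulVec, sub_eq_zero] at h2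
  rw [h2, Matrix.smul_mulVec, Matrix.one_mulVec]

/-- The Jordan decomposition. -/
theorem exists_jordan (x : Mat n) : ∃ (P : GL (Fin n) ℂ) (d : Fin n → ℂ) (ν : Mat n),
    x = dg P d + ν ∧ IsNilpotent ν ∧ ∀ y, Commute y x → Commute y (dg P d) := by
  let T : Mat n ≃ₐ[ℂ] Module.End ℂ (Fin n → ℂ) := Matrix.toLinAlgEquiv'
  obtain ⟨ν, hν, s, hs, hν', hs', hx⟩ := (T x).exists_isNilpotent_isSemisimple
  obtain ⟨P, hP⟩ := exists_dg_of_span (S := {T.symm s}) (by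
    rw [eq_top_iff, ← hs'.iSup_eigenspace_eq_top]
    refine iSup_le fun μ v hv => Submodule.subset_span ?_
    rintro _ rfl
    refine ⟨μ, ?_⟩
    rw [Module.End.mem_eigenspace_iff] at hv
    rw [← hv, ← Matrix.toLinAlgEquiv'_apply]
    exact congrArg (fun f : Module.End ℂ (Fin n → ℂ) => f v) (T.apply_symm_apply s))
  obtain ⟨d, hd⟩ := hP _ rfl
  refine ⟨P, d, T.symm ν, ?_, hν'.map T.symm, fun y hy => ?_⟩
  · rw [← hd, ← map_add, add_comm s, ← hx, T.symm_apply_apply]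
  · rw [← hd]
    have h1 : Commute (T y) (T x) := hy.map T
    -- The semisimple part lies in the algebra generated by `T x`, hence in every centralizer that
    -- contains `T x`.
    have h2 : Commute (T y) s := by
      have : s ∈ Subalgebra.centralizer ℂ {T y} := by
        refine Algebra.adjoin_le (S := Subalgebra.centralizer ℂ {T y}) ?_ hs
        rintro _ rfl
        rw [SetLike.mem_coe, Subalgebra.mem_centralizer_iff]
        rintro _ rfl
        exact h1
      exact (Subalgebra.mem_centralizer_iff ℂ).1 this _ rfl
    have h3 := h2.map T.symm
    rwa [T.symm_apply_apply] at h3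

/-! ### Exponential polynomials -/

/-- The function `t ↦ q(t) exp(μ t)`. -/
noncomputable def expPoly (q : Polynomial ℂ) (μ : ℂ) : ℂ → ℂ :=
  fun t => q.eval t * Complex.exp (μ * t)

/-- Translation of functions on `ℂ`. -/
noncomputable def translate (h : ℂ) : Module.End ℂ (ℂ → ℂ) := LinearMap.funLeft ℂ ℂ (· + h)

/-- The difference `q(t + h) - q(t)` has smaller degree than a nonzero `q`, so exponential
polynomials are generalized eigenvectors of all translations. Their linear independence is that of
joint generalized eigenspaces. -/
theorem translate_sub_apply_expPoly (h μ : ℂ) (q : Polynomial ℂ) :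
    (translate h - Complex.exp (μ * h) • (1 : Module.End ℂ (ℂ → ℂ))) (expPoly q μ) =
      expPoly (Complex.exp (μ * h) • (Polynomial.taylor h q - q)) μ := by
  ext t
  simp only [translate, expPoly, LinearMap.sub_apply, LinearMap.funLeft_apply, LinearMap.smul_apply,
    Module.End.one_apply, Pi.sub_apply, Pi.smul_apply, smul_eq_mul, Polynomial.eval_smul,
    Polynomial.eval_sub, Polynomial.taylor_eval, mul_add, Complex.exp_add]
  ring

theorem expPoly_mem (h μ : ℂ) (N : ℕ) : ∀ q : Polynomial ℂ, q.degree < N →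
    ((translate h - Complex.exp (μ * h) • (1 : Module.End ℂ (ℂ → ℂ))) ^ N) (expPoly q μ) = 0 := by
  induction N with
  | zero =>
    intro q hq
    have : q = 0 := Polynomial.degree_eq_bot.1 (by simpa [Nat.WithBot.lt_zero_iff] using hq)
    ext t
    simp [this, expPoly]
  | succ N ih =>
    intro q hq
    rw [pow_succ, Module.End.mul_apply, translate_sub_apply_expPoly]
    apply ih
    refine (Polynomial.degree_smul_le _ _).trans_lt ?_
    by_cases hq0 : q = 0
    · simp [hq0]
    have hlt := Polynomial.degree_sub_lt_left (Polynomial.degree_taylor q h)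
      ((Polynomial.taylor_eq_zero h q).not.2 hq0) (Polynomial.leadingCoeff_taylor h q)
    rw [Polynomial.degree_taylor] at hlt
    refine hlt.trans_le ?_
    rw [Polynomial.degree_eq_natDegree hq0] at hq ⊢
    exact_mod_cast Nat.lt_succ_iff.1 (by exact_mod_cast hq)

/-- Linear independence of exponential polynomials. -/
theorem eq_zero_of_sum_expPoly {s : Finset ℂ} {q : ℂ → Polynomial ℂ}
    (h : ∑ μ ∈ s, expPoly (q μ) μ = 0) : ∀ μ ∈ s, q μ = 0 := by
  have hcomm : ∀ i j : ℂ, Commute (translate i) (translate j) := by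
    intro i j
    ext f t
    simp only [translate, Module.End.mul_apply, LinearMap.funLeft_apply, add_right_comm]
  have hind := Module.End.independent_iInf_maxGenEigenspace_of_forall_mapsTo translate
    (fun i j φ => Module.End.mapsTo_maxGenEigenspace_of_comm (hcomm j i) φ)
  -- If `μ ≠ ν` gave the same character, evaluating at `(μ - ν)⁻¹` would give `exp 1 = 1`.
  have hinj : Function.Injective (fun μ h : ℂ => Complex.exp (μ * h)) := by
    intro μ ν hμν
    by_contra hne
    have h1 := congrFun hμν (μ - ν)⁻¹
    simp only at h1
    have h2 : Complex.exp ((μ - ν) * (μ - ν)⁻¹) = 1 := by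
      rw [sub_mul, Complex.exp_sub, h1, div_self (Complex.exp_ne_zero _)]
    rw [mul_inv_cancel₀ (sub_ne_zero.2 hne)] at h2
    have h3 := congrArg (fun z => ‖z‖) h2
    simp only [Complex.norm_exp, Complex.one_re, norm_one] at h3
    exact one_ne_zero (Real.exp_eq_one_iff 1 |>.1 h3)
  have hind' := (iSupIndep_iff_finsetSum_eq_zero_imp_eq_zero _).1 (hind.comp hinj) s
    (fun μ => expPoly (q μ) μ) (fun μ _ => ?_) h
  · intro μ hμ
    refine Polynomial.funext fun t => ?_
    have := congrFun (hind' μ hμ) t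
    simpa [expPoly] using this
  · simp only [Function.comp_apply, Submodule.mem_iInf, Module.End.mem_maxGenEigenspace]
    intro h
    exact ⟨(q μ).natDegree + 1, expPoly_mem h μ _ _
      (Polynomial.degree_le_natDegree.trans_lt (by exact_mod_cast Nat.lt_succ_self _))⟩

/-- Evaluation of formal exponential polynomials `∑ q_μ [μ]`: the coefficients are evaluated
at `t`, and `[μ]` is sent to `exp(a φ(μ))`. -/
noncomputable def evalExpPoly (φ : ℂ →+ ℂ) (t a : ℂ) :
    AddMonoidAlgebra (Polynomial ℂ) ℂ →+* ℂ :=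
  AddMonoidAlgebra.liftNCRingHom (Polynomial.evalRingHom t)
    { toFun := fun μ => Complex.exp (a * φ μ.toAdd)
      map_one' := by simp
      map_mul' := fun μ ν => by simp [mul_add, Complex.exp_add] }
    (fun _ _ => Commute.all _ _)

theorem evalExpPoly_single (φ : ℂ →+ ℂ) (t a μ : ℂ) (q : Polynomial ℂ) :
    evalExpPoly φ t a (AddMonoidAlgebra.single μ q) = q.eval t * Complex.exp (a * φ μ) := by
  simp [evalExpPoly]

theorem eq_zero_of_evalExpPoly {f : AddMonoidAlgebra (Polynomial ℂ) ℂ}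
    (h : ∀ t, evalExpPoly (AddMonoidHom.id ℂ) t t f = 0) : f = 0 := by
  have h1 : ∑ μ ∈ f.coeff.support, expPoly (f.coeff μ) μ = 0 := by
    ext t
    have h2 := h t
    rw [← AddMonoidAlgebra.sum_coeff_single f, Finsupp.sum, map_sum] at h2
    simp only [evalExpPoly_single, AddMonoidHom.id_apply] at h2
    simpa [expPoly, mul_comm t] using h2
  ext μ : 2
  by_contra hμ
  exact hμ (eq_zero_of_sum_expPoly h1 μ (Finsupp.mem_support_iff.2 hμ))

theorem exp_smul_of_pow_eq_zero {ν : Mat n} {N : ℕ} (hν : ν ^ (N + 1) = 0) (t : ℂ) :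
    NormedSpace.exp (t • ν) = ∑ k ∈ Finset.range (N + 1), (t ^ k * (k.factorial : ℂ)⁻¹) • ν ^ k := by
  rw [NormedSpace.exp_eq_tsum ℂ]
  simp only
  rw [tsum_eq_sum (s := Finset.range (N + 1))]
  · refine Finset.sum_congr rfl fun k _ => ?_
    rw [smul_pow, smul_smul, mul_comm]
  · intro k hk
    have : ν ^ k = 0 := pow_eq_zero_of_le (by simpa using hk) hν
    rw [smul_pow, this, smul_zero, smul_zero]

/-- The constants, as formal exponential polynomials. -/
noncomputable def constExpPoly : ℂ →+* AddMonoidAlgebra (Polynomial ℂ) ℂ :=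
  AddMonoidAlgebra.singleZeroRingHom.comp Polynomial.C

theorem evalExpPoly_const (φ : ℂ →+ ℂ) (t a c : ℂ) : evalExpPoly φ t a (constExpPoly c) = c := by
  simp [constExpPoly, evalExpPoly_single]

/-- The matrix `exp(t(s + ν))` with `s = dg P d` and `ν` nilpotent, as a matrix of formal
exponential polynomials. -/
noncomputable def expPolyMatrix (P : GL (Fin n) ℂ) (d : Fin n → ℂ) (ν : Mat n) (N : ℕ) :
    Matrix (Fin n) (Fin n) (AddMonoidAlgebra (Polynomial ℂ) ℂ) :=
  constExpPoly.mapMatrix ((P⁻¹ : GL (Fin n) ℂ) : Mat n) *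
    diagonal (fun i => AddMonoidAlgebra.single (d i) 1) * constExpPoly.mapMatrix (P : Mat n) *
    ∑ k ∈ Finset.range (N + 1), diagonal (fun _ => AddMonoidAlgebra.single 0
      (Polynomial.X ^ k * Polynomial.C ((k.factorial : ℂ)⁻¹))) * constExpPoly.mapMatrix (ν ^ k)

theorem mapMatrix_expPolyMatrix (P : GL (Fin n) ℂ) (d : Fin n → ℂ) (ν : Mat n) (N : ℕ)
    (φ : ℂ →+ ℂ) (t a : ℂ) : (evalExpPoly φ t a).mapMatrix (expPolyMatrix P d ν N) =
      dg P (fun i => Complex.exp (a * φ (d i))) *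
        ∑ k ∈ Finset.range (N + 1), (t ^ k * (k.factorial : ℂ)⁻¹) • ν ^ k := by
  have hc : ∀ m : Mat n, (evalExpPoly φ t a).mapMatrix (constExpPoly.mapMatrix m) = m := fun m => by
    ext i j
    simp [evalExpPoly_const]
  have hd : ∀ f : Fin n → AddMonoidAlgebra (Polynomial ℂ) ℂ,
      (evalExpPoly φ t a).mapMatrix (diagonal f) = diagonal fun i => evalExpPoly φ t a (f i) :=
    fun f => by
      ext i j
      simp [diagonal_apply, apply_ite (evalExpPoly φ t a)]
  rw [expPolyMatrix, map_mul, map_mul, map_mul, hc, hc, hd, map_sum, dg_apply]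
  congr 1
  · simp [evalExpPoly_single]
  · refine Finset.sum_congr rfl fun k _ => ?_
    rw [map_mul, hc, hd, ← Matrix.smul_eq_diagonal_mul]
    rw [mul_comm (t ^ k)]
    simp [evalExpPoly_single]

/-- If `s + ν` is the Jordan decomposition of an element of the Lie algebra of an algebraic group,
then the Lie algebra contains every replica of the semisimple part `s`. -/
theorem replica_mem_lie {K : Subgroup (GL (Fin n) ℂ)} (hK : IsAlgebraicSubgroup K)
    {P : GL (Fin n) ℂ} {d : Fin n → ℂ} {ν : Mat n} (hx : dg P d + ν ∈ lie K) (hν : IsNilpotent ν)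
    (hc : Commute ν (dg P d)) (φ : ℂ →+ ℂ) : dg P (φ ∘ d) ∈ lie K := by
  obtain ⟨N, hN⟩ := hν
  replace hN : ν ^ (N + 1) = 0 := by rw [pow_succ, hN, zero_mul]
  rw [mem_lie hK] at hx ⊢
  obtain ⟨S, hS, hSK⟩ := isAlgebraicSubgroup_iff.1 hK
  intro a
  rw [hSK]
  intro F hF
  obtain ⟨p, hp⟩ := hS F hF
  set M := expPolyMatrix P d ν N with hM
  have hev : ∀ φ t a, F ((evalExpPoly φ t a).mapMatrix M) = evalExpPoly φ t a
      (MvPolynomial.eval₂ constExpPoly (fun ij : Fin n × Fin n => M ij.1 ij.2) p) := by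
    intro φ t a
    have hid : (evalExpPoly φ t a).comp constExpPoly = RingHom.id ℂ :=
      RingHom.ext fun c => evalExpPoly_const φ t a c
    rw [hp, MvPolynomial.hom_eval₂, hid]
    rfl
  -- At `φ = id` and `a = t` the formal matrix becomes `exp(t(s + ν))`, which lies in `K`. Linear
  -- independence of exponential polynomials turns the vanishing for all `t` into a formal identity.
  have hzero : MvPolynomial.eval₂ constExpPoly (fun ij : Fin n × Fin n => M ij.1 ij.2) p = 0 := by
    refine eq_zero_of_evalExpPoly fun t => ?_
    rw [← hev, hM, mapMatrix_expPolyMatrix, ← exp_smul_of_pow_eq_zero hN]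
    have h1 : dg P (fun i => Complex.exp (t * AddMonoidHom.id ℂ (d i))) =
        NormedSpace.exp (t • dg P d) := by
      rw [← map_smul, exp_dg]
      rfl
    rw [h1, ← Matrix.exp_add_of_commute _ _ ((hc.symm.smul_left t).smul_right t), ← smul_add]
    exact (hSK _).1 (hx t) F hF
  -- The formal identity may be specialized with any additive `φ` on the exponents. Setting `t = 0`
  -- removes the nilpotent factor, while `a` stays free.
  have h0 := hev φ 0 a
  rw [hzero, map_zero, hM, mapMatrix_expPolyMatrix, ← exp_smul_of_pow_eq_zero hN, zero_smul,
    NormedSpace.exp_zero, mul_one] at h0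
  rw [coe_expU, ← map_smul, exp_dg]
  exact h0

theorem replica_mem_lie_of_dg {K : Subgroup (GL (Fin n) ℂ)} (hK : IsAlgebraicSubgroup K)
    {P : GL (Fin n) ℂ} {d : Fin n → ℂ} (hx : dg P d ∈ lie K) (φ : ℂ →+ ℂ) :
    dg P (φ ∘ d) ∈ lie K :=
  replica_mem_lie hK (ν := 0) (by simpa using hx) IsNilpotent.zero (Commute.zero_left _) φ

/-- A complex vector all of whose additive images have vanishing pairing with it is zero. -/
theorem eq_zero_of_forall_sum_mul {ι : Type*} [Fintype ι] {d : ι → ℂ}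
    (h : ∀ φ : ℂ →+ ℂ, ∑ i, d i * φ (d i) = 0) : d = 0 := by
  have hQ : ∀ f : ℂ →ₗ[ℚ] ℚ, ∀ i, f (d i) = 0 := by
    intro f
    let g : ℂ →+ ℂ := (algebraMap ℚ ℂ : ℚ →+ ℂ).comp f.toAddMonoidHom
    -- For rational-valued `φ = f`, applying `f` once more turns the pairing into a sum of rational
    -- squares.
    have h1 := congrArg f (h g)
    have h2 : ∀ i, d i * g (d i) = f (d i) • d i := fun i => by
      rw [Algebra.smul_def, mul_comm]
      rfl
    simp only [h2, map_sum, map_smul, map_zero, smul_eq_mul] at h1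
    intro i
    have h3 := (Finset.sum_eq_zero_iff_of_nonneg fun i _ => mul_self_nonneg (f (d i))).1 h1 i
      (Finset.mem_univ i)
    exact mul_self_eq_zero.1 h3
  funext i
  exact (Module.forall_dual_apply_eq_zero_iff ℚ (d i)).1 fun f => hQ f i

/-! ### Diagonalizable groups -/

/-! ### Rational subspaces and integral functionals. -/

section Lattice

variable {ι : Type*} [Fintype ι]

/-- Expanding the coordinates of `y` in a `ℚ`-basis of `ℂ` exhibits `y` as a complex combination of
the rational vectors `f ∘ y`. -/
theorem mem_of_forall_dual_comp_mem {W : Submodule ℂ (ι → ℂ)} {y : ι → ℂ}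
    (h : ∀ f : ℂ →ₗ[ℚ] ℚ, (fun i => (f (y i) : ℂ)) ∈ W) : y ∈ W := by
  classical
  let b := Module.Basis.ofVectorSpace ℚ ℂ
  let s := Finset.univ.biUnion fun i => (b.repr (y i)).support
  have hy : y = ∑ j ∈ s, b j • fun i => ((b.coord j (y i) : ℚ) : ℂ) := by
    ext i
    rw [Finset.sum_apply]
    conv_lhs => rw [← b.linearCombination_repr (y i), Finsupp.linearCombination_apply, Finsupp.sum]
    rw [Finset.sum_subset (Finset.subset_biUnion_of_mem (fun i => (b.repr (y i)).support)
      (Finset.mem_univ i)) (fun j _ hj => by rw [Finsupp.notMem_support_iff.1 hj, zero_smul])]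
    refine Finset.sum_congr rfl fun j _ => ?_
    rw [Pi.smul_apply, smul_eq_mul, Algebra.smul_def, mul_comm]
    rfl
  rw [hy]
  exact W.sum_mem fun j _ => W.smul_mem _ (h (b.coord j))

/-- Stability under additive maps means that `W` is defined over `ℚ`. A rational vector outside `W`
is separated from the rational points of `W` by a rational functional, and clearing denominators
makes it integral. -/
theorem mem_of_forall_int_functional {W : Submodule ℂ (ι → ℂ)}
    (hW : ∀ d ∈ W, ∀ φ : ℂ →+ ℂ, φ ∘ d ∈ W) {y : ι → ℂ}
    (hy : ∀ χ : ι → ℤ, (∀ d ∈ W, ∑ i, χ i * d i = 0) → ∑ i, χ i * y i = 0) : y ∈ W := by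
  classical
  refine mem_of_forall_dual_comp_mem fun f => ?_
  let WQ : Submodule ℚ (ι → ℚ) :=
    { carrier := {q | (fun i => (q i : ℂ)) ∈ W}
      add_mem' := fun {a b} ha hb => by
        have := W.add_mem ha hb
        simp only [Set.mem_ofPred_eq, Pi.add_apply, Rat.cast_add]
        exact this
      zero_mem' := by
        have := W.zero_mem
        simp only [Set.mem_ofPred_eq, Pi.zero_apply, Rat.cast_zero]
        exact this
      smul_mem' := fun c a ha => by
        have := W.smul_mem (c : ℂ) ha
        simp only [Set.mem_ofPred_eq, Pi.smul_apply, smul_eq_mul, Rat.cast_mul]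
        exact this }
  change (fun i => f (y i)) ∈ WQ
  by_contra hcon
  obtain ⟨g, hg, hgW⟩ := Submodule.exists_le_ker_of_notMem hcon
  let c : ι → ℚ := fun i => g (Pi.single i 1)
  have hgc : ∀ q : ι → ℚ, g q = ∑ i, c i * q i := by
    intro q
    conv_lhs => rw [pi_eq_sum_univ' q]
    simp only [map_sum, map_smul, smul_eq_mul, c]
    refine Finset.sum_congr rfl fun i _ => ?_
    rw [mul_comm]
  let N : ℕ := ∏ i, (c i).den
  have hN : N ≠ 0 := Finset.prod_ne_zero_iff.2 fun i _ => (c i).den_nz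
  have hχ : ∀ i, ∃ k : ℤ, (k : ℚ) = N * c i := by
    intro i
    obtain ⟨M, hM⟩ := Finset.dvd_prod_of_mem (fun i => (c i).den) (Finset.mem_univ i)
    refine ⟨(c i).num * M, ?_⟩
    change _ = ((∏ i, (c i).den : ℕ) : ℚ) * _
    rw [hM]
    push_cast
    rw [← Rat.den_mul_eq_num]
    ring
  choose χ hχ using hχ
  have hχg : ∀ (f : ℂ →ₗ[ℚ] ℚ) (d : ι → ℂ), f (∑ i, χ i * d i) = N * g (fun i => f (d i)) := by
    intro f d
    rw [hgc, map_sum, Finset.mul_sum]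
    refine Finset.sum_congr rfl fun i _ => ?_
    have : (χ i : ℂ) * d i = (χ i : ℚ) • d i := by
      rw [Algebra.smul_def]
      simp
    rw [this, map_smul, hχ, smul_eq_mul, mul_assoc]
  refine hg ?_
  have h1 := hχg f y
  rw [hy χ, map_zero] at h1
  · have := h1.symm
    simpa [hN] using this
  · intro d hd
    refine (Module.forall_dual_apply_eq_zero_iff ℚ _).1 fun f' => ?_
    rw [hχg f' d]
    have h2 : (fun i => f' (d i)) ∈ WQ :=
      hW d hd ((algebraMap ℚ ℂ : ℚ →+ ℂ).comp f'.toAddMonoidHom)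
    rw [LinearMap.mem_ker.1 (hgW h2), mul_zero]

/-- A linear functional on a saturated sublattice extends. -/
theorem exists_extend_int_functional (L : Submodule ℤ (ι → ℤ))
    (hL : ∀ (k : ℤ) (χ : ι → ℤ), k ≠ 0 → k • χ ∈ L → χ ∈ L) (f : L →ₗ[ℤ] ℤ) :
    ∃ m : ι → ℤ, ∀ χ : L, f χ = ∑ i, (χ : ι → ℤ) i * m i := by
  classical
  -- Saturation makes the finitely generated quotient torsion-free, hence free; the quotient map
  -- then splits and `f` extends along the retraction onto `L`.
  have : Module.IsTorsionFree ℤ ((ι → ℤ) ⧸ L) := by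
    refine Module.IsTorsionFree.of_smul_eq_zero fun k q hq => ?_
    obtain ⟨χ, rfl⟩ := L.mkQ_surjective q
    by_cases hk : k = 0
    · exact Or.inl hk
    right
    rw [← map_smul, ← LinearMap.mem_ker, L.ker_mkQ] at hq
    rw [← LinearMap.mem_ker, L.ker_mkQ]
    exact hL k χ hk hq
  have : Module.Free ℤ ((ι → ℤ) ⧸ L) := inferInstance
  obtain ⟨s, hs⟩ := Module.projective_lifting_property L.mkQ LinearMap.id L.mkQ_surjective
  have hs' : ∀ v, v - s (L.mkQ v) ∈ L := fun v => by
    refine L.ker_mkQ.le (LinearMap.mem_ker.2 ?_)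
    rw [map_sub, sub_eq_zero]
    exact (LinearMap.congr_fun hs (L.mkQ v)).symm
  let F : (ι → ℤ) →ₗ[ℤ] ℤ := f ∘ₗ LinearMap.codRestrict L (LinearMap.id - s ∘ₗ L.mkQ) hs'
  have hF : ∀ χ : L, F χ = f χ := fun χ => by
    refine congrArg f (Subtype.ext ?_)
    have : L.mkQ (χ : ι → ℤ) = 0 := by
      rw [← LinearMap.mem_ker, L.ker_mkQ]
      exact χ.2
    simp [this]
  refine ⟨fun i => F (Pi.single i 1), fun χ => ?_⟩
  rw [← hF χ, LinearMap.pi_apply_eq_sum_univ F]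
  refine Finset.sum_congr rfl fun i _ => ?_
  rw [smul_eq_mul]
  congr 2
  ext j
  simp [Pi.single_apply, eq_comm]

/-- On the saturated lattice of integral functionals vanishing on `W`, the rule `χ ↦ χ(y) / c` is
integer-valued. An extension `m` to the whole lattice corrects `y` so that all these functionals
vanish. The case `c = 2πi` adjusts branches of logarithms. -/
theorem exists_int_sub_mem {W : Submodule ℂ (ι → ℂ)} (hW : ∀ d ∈ W, ∀ φ : ℂ →+ ℂ, φ ∘ d ∈ W)
    {y : ι → ℂ} {c : ℂ} (hc : c ≠ 0)
    (hy : ∀ χ : ι → ℤ, (∀ d ∈ W, ∑ i, χ i * d i = 0) → ∃ k : ℤ, ∑ i, χ i * y i = k * c) :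
    ∃ m : ι → ℤ, (fun i => y i - m i * c) ∈ W := by
  let L : Submodule ℤ (ι → ℤ) :=
    { carrier := {χ | ∀ d ∈ W, ∑ i, (χ i : ℂ) * d i = 0}
      add_mem' := fun {a b} ha hb d hd => by
        have h1 := ha d hd
        have h2 := hb d hd
        simp only [Pi.add_apply, Int.cast_add, add_mul, Finset.sum_add_distrib, h1, h2, add_zero]
      zero_mem' := fun d _ => by simp
      smul_mem' := fun k a ha d hd => by
        have h1 := ha d hd
        simp only [Pi.smul_apply, smul_eq_mul, Int.cast_mul, mul_assoc, ← Finset.mul_sum, h1,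
          mul_zero] }
  choose k hk using fun χ : L => hy χ χ.2
  let f : L →ₗ[ℤ] ℤ := AddMonoidHom.toIntLinearMap
    { toFun := k
      map_zero' := by
        have := hk 0
        simpa [hc] using this.symm
      map_add' := fun a b => by
        have h1 := hk (a + b)
        simp only [Submodule.coe_add, Pi.add_apply, Int.cast_add, add_mul, Finset.sum_add_distrib,
          hk a, hk b] at h1
        rw [← add_mul] at h1
        exact_mod_cast (mul_right_cancel₀ hc h1).symm }
  obtain ⟨m, hm⟩ := exists_extend_int_functional L (fun k χ hk h d hd => by
    have h1 := h d hd
    simp only [Pi.smul_apply, smul_eq_mul, Int.cast_mul, mul_assoc, ← Finset.mul_sum] at h1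
    exact (mul_eq_zero.1 h1).resolve_left (by exact_mod_cast hk)) f
  refine ⟨m, mem_of_forall_int_functional hW fun χ hχ => ?_⟩
  have h1 := hk ⟨χ, hχ⟩
  have h2 : k ⟨χ, hχ⟩ = ∑ i, χ i * m i := hm ⟨χ, hχ⟩
  simp only [mul_sub, Finset.sum_sub_distrib, h1, h2]
  push_cast
  rw [Finset.sum_mul, sub_eq_zero]
  exact Finset.sum_congr rfl fun i _ => by ring

end Lattice

theorem exists_dg_of_mem_lie {K : Subgroup (GL (Fin n) ℂ)} (hK : IsAlgebraicSubgroup K)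
    {P : GL (Fin n) ℂ} (hP : ∀ g ∈ K, ∃ d, (g : Mat n) = dg P d) {x : Mat n} (hx : x ∈ lie K) :
    ∃ d, x = dg P d := by
  have h := mem_of_exp_mem (W := LinearMap.range (dg P).toLinearMap) (x := x) (m := 1)
    (fun t => by
      obtain ⟨d, hd⟩ := hP _ ((mem_lie hK).1 hx t)
      exact ⟨d - 1, by rw [one_mul, ← coe_expU, hd]; exact (map_sub _ _ _).trans (by simp)⟩)
  obtain ⟨d, hd⟩ := h
  exact ⟨d, by rw [one_mul] at hd; exact hd.symm⟩

/-- The group of exponentials of a commutative space of matrices. -/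
noncomputable def expSubgroup (W : Submodule ℂ (Mat n)) (hW : ∀ x ∈ W, ∀ y ∈ W, Commute x y) :
    Subgroup (GL (Fin n) ℂ) where
  carrier := expU '' (W : Set (Mat n))
  mul_mem' := by
    rintro _ _ ⟨x, hx, rfl⟩ ⟨y, hy, rfl⟩
    exact ⟨x + y, W.add_mem hx hy, expU_add (hW x hx y hy)⟩
  one_mem' := ⟨0, W.zero_mem, expU_zero⟩
  inv_mem' := by
    rintro _ ⟨x, hx, rfl⟩
    exact ⟨-x, W.neg_mem hx, expU_neg x⟩

theorem isConnected_exp (W : Submodule ℂ (Mat n)) : IsConnected (expU '' (W : Set (Mat n))) := by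
  refine IsConnected.image ⟨⟨0, W.zero_mem⟩, ?_⟩ _ continuous_expU.continuousOn
  exact (W.restrictScalars ℝ).convex.isPreconnected

/-- The exponential of the Lie algebra of a diagonalizable algebraic group is a torus. -/
theorem exists_isTorus_exp_lie {K : Subgroup (GL (Fin n) ℂ)} (hK : IsAlgebraicSubgroup K)
    (hd : IsDiagonalizable K) : ∃ T : Subgroup (GL (Fin n) ℂ), IsTorus T ∧
      (T : Set (GL (Fin n) ℂ)) = expU '' (lie K : Set (Mat n)) := by
  obtain ⟨P, hP⟩ := isDiagonalizable_iff.1 hd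
  have hlie : ∀ x ∈ lie K, ∃ d, x = dg P d := fun x hx => exists_dg_of_mem_lie hK hP hx
  have hcomm : ∀ x ∈ lie K, ∀ y ∈ lie K, Commute x y := by
    intro x hx y hy
    obtain ⟨d, rfl⟩ := hlie x hx
    obtain ⟨e, rfl⟩ := hlie y hy
    exact commute_dg P d e
  refine ⟨expSubgroup (lie K) hcomm, ⟨?_, isConnected_exp _, ?_⟩, rfl⟩
  · let W : Submodule ℂ (Fin n → ℂ) := (lie K).comap (dg P).toLinearMap
    let pd : Mat n → Mat n := fun m => (P : Mat n) * m * ((P⁻¹ : GL (Fin n) ℂ) : Mat n)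
    have hpd : ∀ i j, IsPoly fun m => pd m i j := fun i j => (IsPoly.coord i j).conj _ _
    -- The equations say that the matrix is diagonal and that every character trivial on `lie K`
    -- takes the value `1`. Positive and negative exponents go on opposite sides so that the
    -- equations are polynomial.
    refine isAlgebraicSubgroup_iff.2 ⟨{F | (∃ i j, i ≠ j ∧ F = fun m => pd m i j) ∨
      ∃ χ : Fin n → ℤ, (∀ d ∈ W, ∑ i, χ i * d i = 0) ∧ F = fun m =>
        ∏ i, pd m i i ^ (χ i).toNat - ∏ i, pd m i i ^ (-χ i).toNat}, ?_, fun g => ?_⟩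
    · rintro F (⟨i, j, -, rfl⟩ | ⟨χ, -, rfl⟩)
      · exact hpd i j
      · exact (IsPoly.prod _ fun i _ => (hpd i i).pow _).sub
          (IsPoly.prod _ fun i _ => (hpd i i).pow _)
    · have hexp : ∀ (χ : Fin n → ℤ) (y : Fin n → ℂ),
          ∏ i, Complex.exp (y i) ^ (χ i).toNat = ∏ i, Complex.exp (y i) ^ (-χ i).toNat ↔
            ∃ k : ℤ, ∑ i, χ i * y i = k * (2 * Real.pi * Complex.I) := by
        intro χ y
        simp only [← Complex.exp_nat_mul, ← Complex.exp_sum]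
        rw [Complex.exp_eq_exp_iff_exists_int]
        refine exists_congr fun k => ?_
        rw [← sub_eq_iff_eq_add', ← Finset.sum_sub_distrib]
        have : ∀ i, ((χ i).toNat : ℂ) * y i - ((-χ i).toNat : ℂ) * y i = χ i * y i := fun i => by
          rw [← sub_mul]
          congr 1
          have := Int.toNat_sub_toNat_neg (χ i)
          exact_mod_cast this
        simp only [this]
      constructor
      · rintro ⟨x, hx, rfl⟩ F hF
        obtain ⟨d, rfl⟩ := hlie x hx
        have hpe : pd (expU (dg P d)) = diagonal fun i => Complex.exp (d i) := by
          rw [coe_expU, exp_dg]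
          exact conj_dg _ _
        rcases hF with ⟨i, j, hij, rfl⟩ | ⟨χ, hχ, rfl⟩
        · simp only [hpe, diagonal_apply_ne _ hij]
        · simp only [hpe, diagonal_apply_eq]
          rw [sub_eq_zero, hexp]
          exact ⟨0, by rw [hχ d hx]; simp⟩
      · intro hg
        have hdiag : (pd g).IsDiag := fun i j hij => hg _ (Or.inl ⟨i, j, hij, rfl⟩)
        obtain ⟨t, ht⟩ := exists_dg_of_isDiag hdiag
        have hpt : pd g = diagonal t := by
          have := conj_dg P t
          rwa [← ht] at this
        have ht0 : ∀ i, t i ≠ 0 := by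
          have h1 : (g : Mat n).det ≠ 0 := ((Matrix.isUnit_iff_isUnit_det _).1 g.isUnit).ne_zero
          rw [ht, det_dg, Finset.prod_ne_zero_iff] at h1
          exact fun i => h1 i (Finset.mem_univ i)
        have hte : t = fun i => Complex.exp (Complex.log (t i)) := by
          ext i
          rw [Complex.exp_log (ht0 i)]
        -- The character equations only place `χ(log t)` in `2πiℤ`. Changing branches by `m` moves
        -- the logarithm into the Lie algebra without changing its exponential.
        obtain ⟨m, hm⟩ := exists_int_sub_mem (W := W) (y := fun i => Complex.log (t i))
          (fun d hd φ => replica_mem_lie_of_dg hK hd φ) Complex.two_pi_I_ne_zero (fun χ hχ => by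
            have h1 := hg _ (Or.inr ⟨χ, hχ, rfl⟩)
            simp only [hpt, diagonal_apply_eq] at h1
            rw [sub_eq_zero, hte, hexp] at h1
            exact h1)
        refine ⟨_, hm, Units.ext ?_⟩
        change NormedSpace.exp (dg P _) = _
        rw [exp_dg, ht]
        congr 1
        ext i
        rw [Complex.exp_sub, Complex.exp_int_mul_two_pi_mul_I, div_one, Complex.exp_log (ht0 i)]
  · refine isDiagonalizable_iff.2 ⟨P, ?_⟩
    rintro _ ⟨x, hx, rfl⟩
    obtain ⟨d, rfl⟩ := hlie x hx
    exact ⟨_, exp_dg P d⟩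

theorem IsTorus.exists_dg {T : Subgroup (GL (Fin n) ℂ)} (hT : IsTorus T) :
    ∃ P : GL (Fin n) ℂ, (∀ g ∈ T, ∃ d, (g : Mat n) = dg P d) ∧ ∀ x ∈ lie T, ∃ d, x = dg P d := by
  obtain ⟨P, hP⟩ := isDiagonalizable_iff.1 hT.diagonalizable
  exact ⟨P, hP, fun x hx => exists_dg_of_mem_lie hT.algebraic hP hx⟩

/-- The exponentials form a subgroup containing a neighbourhood of `1` in the connected group `T`.
-/
theorem IsTorus.eq_exp {T : Subgroup (GL (Fin n) ℂ)} (hT : IsTorus T) :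
    (T : Set (GL (Fin n) ℂ)) = expU '' (lie T : Set (Mat n)) := by
  obtain ⟨T', -, hT'⟩ := exists_isTorus_exp_lie hT.algebraic hT.diagonalizable
  apply Set.Subset.antisymm
  · rw [← hT']
    refine subset_of_eventually_mem (K := T) ?_ subset_rfl hT.connected.isPreconnected T.one_mem
    filter_upwards [eventually_exists_lie hT.algebraic] with g hg hgT
    obtain ⟨x, hx, rfl⟩ := hg hgT
    rw [← SetLike.mem_coe, hT']
    exact ⟨x, hx, rfl⟩
  · rintro _ ⟨x, hx, rfl⟩
    exact expU_mem hT.algebraic hx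

/-! ### Nondegeneracy of the trace form -/

section
attribute [local instance] LieRing.ofAssociativeRing

/-- Engel's theorem for spaces of matrices. -/
theorem exists_pow_eq_bot {W : Submodule ℂ (Mat n)} (hW : ∀ x ∈ W, ∀ y ∈ W, x * y - y * x ∈ W)
    (hnil : ∀ x ∈ W, IsNilpotent x) : ∃ k : ℕ, W ^ k = ⊥ := by
  let T : Mat n ≃ₐ[ℂ] Module.End ℂ (Fin n → ℂ) := Matrix.toLinAlgEquiv'
  let L : LieSubalgebra ℂ (Module.End ℂ (Fin n → ℂ)) :=
    { W.map T.toLinearMap with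
      lie_mem' := by
        rintro _ _ ⟨x, hx, rfl⟩ ⟨y, hy, rfl⟩
        refine ⟨x * y - y * x, hW x hx y hy, ?_⟩
        change T (x * y - y * x) = ⁅T x, T y⁆
        rw [map_sub, map_mul, map_mul]
        rfl }
  have hnilL : LieModule.IsNilpotent L (Fin n → ℂ) := by
    rw [LieModule.isNilpotent_iff_forall' (R := ℂ)]
    rintro ⟨_, x, hx, rfl⟩
    exact (hnil x hx).map T
  obtain ⟨k, hk⟩ := (LieModule.isNilpotent_iff ℂ L (Fin n → ℂ)).1 hnilL
  -- A product of `j` elements of `W` maps every vector into step `j` of the lower central series of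
  -- the module, which is eventually zero by Engel's theorem.
  have key : ∀ j, ∀ m ∈ W ^ j, ∀ v, T m v ∈ LieModule.lowerCentralSeries ℂ L (Fin n → ℂ) j := by
    intro j
    induction j with
    | zero => intro m _ v; simp
    | succ j ih =>
      intro m hm v
      rw [pow_succ'] at hm
      induction hm using Submodule.mul_induction_on' with
      | mem_mul_mem a ha b hb =>
        rw [LieModule.lowerCentralSeries_succ, map_mul]
        exact LieSubmodule.lie_mem_lie (x := (⟨T a, a, ha, rfl⟩ : L)) trivial (ih b hb v)
      | add a _ b _ h h' =>
        rw [map_add]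
        exact Submodule.add_mem _ h h'
  refine ⟨k, (Submodule.eq_bot_iff _).2 fun m hm => ?_⟩
  apply T.injective
  rw [map_zero]
  refine LinearMap.ext fun v => ?_
  have h := key k m hm v
  rwa [hk, LieSubmodule.mem_bot] at h

end

theorem trace_eq_zero_of_isNilpotent {x : Mat n} (hx : IsNilpotent x) : x.trace = 0 :=
  (Matrix.isNilpotent_trace_of_isNilpotent hx).eq_zero

theorem trace_mul_dg {P : GL (Fin n) ℂ} {d e : Fin n → ℂ} {ν : Mat n} (hν : IsNilpotent ν)
    (hc : Commute ν (dg P e)) : ((dg P d + ν) * dg P e).trace = ∑ i, d i * e i := by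
  rw [add_mul, trace_add, ← map_mul, trace_dg,
    trace_eq_zero_of_isNilpotent (hc.isNilpotent_mul_right hν), add_zero]
  rfl

/-- The nilpotent part does not contribute to the trace against a replica of the semisimple part, so
the pairing is `∑ d i * φ (d i)`; vanishing for all `φ` forces `d = 0`. -/
theorem jordan_eq_zero_of_trace {P : GL (Fin n) ℂ} {d : Fin n → ℂ} {ν : Mat n} (hν : IsNilpotent ν)
    (hc : Commute ν (dg P d))
    (h : ∀ φ : ℂ →+ ℂ, ((dg P d + ν) * dg P (φ ∘ d)).trace = 0) : d = 0 := by
  refine eq_zero_of_forall_sum_mul fun φ => ?_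
  rw [← h φ, trace_mul_dg hν (commute_dg_comp hc φ)]
  rfl

/-- Real and complex powers of a unipotent matrix `1 + u`, where `u ^ (N + 1) = 0`. -/
noncomputable def unipotentPow (u : Mat n) (N : ℕ) (t : ℂ) : Mat n :=
  ∑ j ∈ Finset.range (N + 1), ((descPochhammer ℂ j).eval t * (j.factorial : ℂ)⁻¹) • u ^ j

/-- At a natural number the coefficients are binomial coefficients, and the binomial expansion
truncates because `u` is nilpotent. -/
theorem unipotentPow_natCast {u : Mat n} {N : ℕ} (hu : u ^ (N + 1) = 0) (k : ℕ) :
    unipotentPow u N k = (1 + u) ^ k := by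
  have hc : ∀ j : ℕ, (descPochhammer ℂ j).eval (k : ℂ) * (j.factorial : ℂ)⁻¹ = (k.choose j : ℂ) := by
    intro j
    rw [descPochhammer_eval_eq_descFactorial, Nat.descFactorial_eq_factorial_mul_choose]
    have : (j.factorial : ℂ) ≠ 0 := by exact_mod_cast j.factorial_ne_zero
    push_cast
    field_simp
  have h1 : ∀ M, N + 1 ≤ M → k + 1 ≤ M → unipotentPow u N k = (1 + u) ^ k := by
    intro M hM hkM
    rw [add_comm, (Commute.one_right u).add_pow, unipotentPow]
    simp only [hc, one_pow, mul_one]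
    have e1 : ∑ j ∈ Finset.range (N + 1), (k.choose j : ℂ) • u ^ j =
        ∑ j ∈ Finset.range M, (k.choose j : ℂ) • u ^ j := by
      refine Finset.sum_subset (Finset.range_mono hM) fun j _ hj => ?_
      rw [pow_eq_zero_of_le (by simpa using hj) hu, smul_zero]
    have e2 : ∑ j ∈ Finset.range (k + 1), u ^ j * (k.choose j : Mat n) =
        ∑ j ∈ Finset.range M, u ^ j * (k.choose j : Mat n) := by
      refine Finset.sum_subset (Finset.range_mono hkM) fun j _ hj => ?_
      rw [Nat.choose_eq_zero_of_lt (by simpa using hj), Nat.cast_zero, mul_zero]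
    rw [e1, e2]
    refine Finset.sum_congr rfl fun j _ => ?_
    rw [Nat.cast_smul_eq_nsmul, nsmul_eq_mul, (Nat.cast_commute _ _).eq]
  exact h1 (N + 1 + (k + 1)) (by omega) (by omega)

/-- Along `t ↦ unipotentPow u N t` the function `F` is a polynomial in `t` with every natural number
as a root. -/
theorem IsPoly.unipotentPow_eq_zero {F : Mat n → ℂ} (hF : IsPoly F) {u : Mat n} {N : ℕ}
    (h : ∀ k : ℕ, F (unipotentPow u N k) = 0) (t : ℂ) : F (unipotentPow u N t) = 0 := by
  obtain ⟨p, hp⟩ := hF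
  let q : Fin n × Fin n → Polynomial ℂ := fun ij => ∑ j ∈ Finset.range (N + 1),
    descPochhammer ℂ j * Polynomial.C ((j.factorial : ℂ)⁻¹ * (u ^ j) ij.1 ij.2)
  have hq : ∀ s : ℂ, F (unipotentPow u N s) = (MvPolynomial.eval₂ Polynomial.C q p).eval s := by
    intro s
    rw [hp, ← Polynomial.coe_evalRingHom, MvPolynomial.hom_eval₂]
    have h1 : (Polynomial.evalRingHom s).comp Polynomial.C = RingHom.id ℂ :=
      RingHom.ext fun c => by simp
    rw [h1]
    change _ = MvPolynomial.eval _ p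
    congr 2
    ext ij
    simp [q, unipotentPow, Matrix.sum_apply, mul_assoc]
  have h0 : MvPolynomial.eval₂ Polynomial.C q p = 0 := by
    refine Polynomial.eq_zero_of_infinite_isRoot _ ?_
    refine Set.Infinite.mono (s := Set.range (Nat.cast : ℕ → ℂ)) ?_
      (Set.infinite_range_of_injective Nat.cast_injective)
    rintro _ ⟨k, rfl⟩
    change Polynomial.eval _ _ = 0
    rw [← hq, h]
  rw [hq, h0, Polynomial.eval_zero]

theorem continuous_unipotentPow (u : Mat n) (N : ℕ) : Continuous (unipotentPow u N) := by
  unfold unipotentPow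
  refine continuous_finsetSum _ fun j _ => ?_
  exact ((Polynomial.continuous _).mul continuous_const).smul continuous_const

theorem exists_isPoly_of_submodule (J : Submodule ℂ (Mat n)) :
    ∃ S : Set (Mat n → ℂ), (∀ F ∈ S, IsPoly F) ∧ ∀ m, m - 1 ∈ J ↔ ∀ F ∈ S, F m = 0 := by
  refine ⟨{F | ∃ f : Mat n →ₗ[ℂ] ℂ, J ≤ LinearMap.ker f ∧ F = fun m => f m - f 1}, ?_, fun m => ?_⟩
  · rintro _ ⟨f, -, rfl⟩
    exact (IsPoly.linear f).sub (IsPoly.const _)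
  · constructor
    · rintro hm _ ⟨f, hf, rfl⟩
      simp only
      rw [← map_sub]
      exact hf hm
    · intro h
      by_contra hm
      obtain ⟨f, hf, hfJ⟩ := Submodule.exists_le_ker_of_notMem hm
      exact hf (by rw [map_sub]; exact h _ ⟨f, hfJ, rfl⟩)

/-- The unipotent group `{g ∈ G | g - 1 ∈ J}` attached to a nilpotent ideal `J` is connected. -/
theorem isConnected_of_sub_one_mem {G N : Subgroup (GL (Fin n) ℂ)} (hG : IsAlgebraicSubgroup G)
    {J : Submodule ℂ (Mat n)} (hJ : J * J ≤ J) {k : ℕ} (hk : J ^ k = ⊥)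
    (hN : ∀ g, g ∈ N ↔ g ∈ G ∧ (g : Mat n) - 1 ∈ J) : IsConnected (N : Set (GL (Fin n) ℂ)) := by
  have hnil : ∀ m ∈ J, m ^ k = 0 := fun m hm => by
    have := Submodule.pow_mem_pow J hm k
    rwa [hk, Submodule.mem_bot] at this
  refine IsPathConnected.isConnected ⟨1, N.one_mem, fun {g} hg => ?_⟩
  obtain ⟨hgG, hgJ⟩ := (hN g).1 hg
  set u := (g : Mat n) - 1 with hu
  have hgu : (g : Mat n) = 1 + u := by rw [hu]; abel
  have huk : u ^ (k + 1) = 0 := by rw [pow_succ, hnil u hgJ, zero_mul]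
  have hpow : ∀ j, u ^ (j + 1) ∈ J := by
    intro j
    induction j with
    | zero => simpa using hgJ
    | succ j ih =>
      rw [pow_succ]
      exact hJ (Submodule.mul_mem_mul ih hgJ)
  have hsub : ∀ t, unipotentPow u k t - 1 ∈ J := by
    intro t
    rw [unipotentPow, Finset.sum_range_succ']
    simp only [descPochhammer_zero, Polynomial.eval_one, Nat.factorial_zero, Nat.cast_one, inv_one,
      mul_one, pow_zero, one_smul, add_sub_cancel_right]
    exact J.sum_mem fun j _ => J.smul_mem _ (hpow j)
  have hunit : ∀ t, IsUnit (unipotentPow u k t) := fun t => by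
    have h1 : IsNilpotent (unipotentPow u k t - 1) := ⟨k, hnil _ (hsub t)⟩
    have := h1.isUnit_one_add
    rwa [add_sub_cancel] at this
  -- The real powers of `g` join `1` to `g`. They satisfy the equations of `G` because the natural
  -- powers do.
  let γ : ℝ → GL (Fin n) ℂ := fun t => (hunit t).unit
  have hγc : Continuous γ := by
    rw [isEmbedding_val.isInducing.continuous_iff]
    exact (continuous_unipotentPow u k).comp Complex.continuous_ofReal
  have hγ1 : γ 1 = g := Units.ext (by
    change unipotentPow u k ((1 : ℝ) : ℂ) = _
    have := unipotentPow_natCast huk 1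
    rw [hgu, ← pow_one (1 + u), ← this]
    simp)
  have hγ0 : γ 0 = 1 := Units.ext (by
    change unipotentPow u k ((0 : ℝ) : ℂ) = _
    have := unipotentPow_natCast huk 0
    rw [pow_zero] at this
    rw [Units.val_one, ← this]
    simp)
  have hγN : ∀ t, γ t ∈ N := by
    intro t
    refine (hN _).2 ⟨?_, hsub t⟩
    obtain ⟨S, hS, hSG⟩ := isAlgebraicSubgroup_iff.1 hG
    rw [hSG]
    intro F hF
    refine (hS F hF).unipotentPow_eq_zero (fun m => ?_) t
    rw [unipotentPow_natCast huk, ← hgu, ← Units.val_pow_eq_pow_val]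
    exact (hSG _).1 (G.pow_mem hgG m) F hF
  rw [← hγ0, ← hγ1]
  exact JoinedIn.ofLine (f := γ) hγc.continuousOn rfl rfl
    (by rintro _ ⟨t, -, rfl⟩; exact hγN t)

/-- The trace form on the Lie algebra of a reductive group is nondegenerate. -/
theorem IsConnectedReductive.eq_zero_of_trace {G : Subgroup (GL (Fin n) ℂ)}
    (hG : IsConnectedReductive G) {x : Mat n} (hx : x ∈ lie G)
    (h : ∀ y ∈ lie G, (x * y).trace = 0) : x = 0 := by
  let r : Submodule ℂ (Mat n) :=
    { carrier := {x | x ∈ lie G ∧ ∀ y ∈ lie G, (x * y).trace = 0}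
      add_mem' := fun {a b} ha hb => ⟨(lie G).add_mem ha.1 hb.1, fun y hy => by
        rw [add_mul, trace_add, ha.2 y hy, hb.2 y hy, add_zero]⟩
      zero_mem' := ⟨(lie G).zero_mem, fun y _ => by simp⟩
      smul_mem' := fun c a ha => ⟨(lie G).smul_mem c ha.1, fun y hy => by
        rw [smul_mul_assoc, trace_smul, ha.2 y hy, smul_zero]⟩ }
  have hrG : ∀ a ∈ r, a ∈ lie G := fun a ha => ha.1
  have had : ∀ g ∈ G, ∀ a ∈ r, (g : Mat n) * a * ((g⁻¹ : GL (Fin n) ℂ) : Mat n) ∈ r := by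
    intro g hg a ha
    refine ⟨conj_mem_lie hG.algebraic ha.1 hg, fun y hy => ?_⟩
    have h1 := ha.2 _ (conj_mem_lie hG.algebraic hy (G.inv_mem hg))
    rw [inv_inv] at h1
    rw [← h1, ← mul_assoc a, Matrix.trace_mul_comm _ (g : Mat n)]
    simp only [mul_assoc]
  -- Replicas of the semisimple part of `a` lie in `lie G`, so `a` is orthogonal to all of them and
  -- its semisimple part is zero.
  have hnil : ∀ a ∈ r, IsNilpotent a := by
    intro a ha
    obtain ⟨P, d, ν, rfl, hν, hc⟩ := exists_jordan a
    have hc' : Commute ν (dg P d) := by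
      have h1 := hc _ (Commute.refl _)
      have h2 := h1.sub_left (Commute.refl (dg P d))
      rwa [add_sub_cancel_left] at h2
    have hd : d = 0 := jordan_eq_zero_of_trace hν hc' fun φ =>
      ha.2 _ (replica_mem_lie hG.algebraic ha.1 hν hc' φ)
    rw [hd, map_zero, zero_add]
    exact hν
  obtain ⟨k, hk⟩ := exists_pow_eq_bot
    (fun a ha b hb => bracket_mem hG.algebraic (hrG a ha) had hb) hnil
  -- In the algebra `A` spanned by `G`, the product `J = A * r` is a two-sided ideal, nilpotent
  -- because `r` is. Then `G ∩ (1 + J)` is a connected normal unipotent subgroup, hence trivial.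
  let A : Submodule ℂ (Mat n) := Submodule.span ℂ {m | ∃ g ∈ G, (g : Mat n) = m}
  have hGA : ∀ g ∈ G, (g : Mat n) ∈ A := fun g hg => Submodule.subset_span ⟨g, hg, rfl⟩
  have h1A : (1 : Mat n) ∈ A := by simpa using hGA 1 G.one_mem
  have hAA : A * A ≤ A := by
    rw [Submodule.span_mul_span]
    refine Submodule.span_mono ?_
    rintro _ ⟨_, ⟨g, hg, rfl⟩, _, ⟨h, hh, rfl⟩, rfl⟩
    exact ⟨g * h, G.mul_mem hg hh, rfl⟩
  have hrA : r * A ≤ A * r := by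
    rw [Submodule.mul_le]
    intro a ha m hm
    induction hm using Submodule.span_induction with
    | mem m hm =>
      obtain ⟨g, hg, rfl⟩ := hm
      have h1 := had g⁻¹ (G.inv_mem hg) a ha
      rw [inv_inv] at h1
      have h2 := Submodule.mul_mem_mul (hGA g hg) h1
      simpa only [mul_assoc, Units.mul_inv_cancel_left] using h2
    | zero => simp
    | add m m' _ _ h h' => rw [mul_add]; exact Submodule.add_mem _ h h'
    | smul c m _ h => rw [mul_smul_comm]; exact Submodule.smul_mem _ _ h
  have hrleA : r ≤ A := fun a ha => by
    have := mem_of_exp_mem (W := A) (x := a) (m := 1) fun t => by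
      rw [one_mul]
      exact A.sub_mem (hGA _ ((mem_lie hG.algebraic).1 ha.1 t)) h1A
    rwa [one_mul] at this
  let J := A * r
  have hAJ : A * J ≤ J := by
    rw [← mul_assoc]
    exact mul_le_mul_left hAA r
  have hJA : J * A ≤ J := by
    rw [mul_assoc]
    refine (mul_le_mul_right hrA A).trans ?_
    exact hAJ
  have hJleA : J ≤ A := (mul_le_mul_right hrleA A).trans hAA
  have hJJ : J * J ≤ J := (mul_le_mul_left hJleA J).trans hAJ
  have hJk : ∀ j, J ^ j ≤ A * r ^ j := by
    intro j
    induction j with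
    | zero =>
      rw [pow_zero, pow_zero, mul_one]
      exact Submodule.one_le.2 h1A
    | succ j ih =>
      rw [pow_succ']
      calc J * J ^ j ≤ J * (A * r ^ j) := mul_le_mul_right ih J
        _ = J * A * r ^ j := (mul_assoc _ _ _).symm
        _ ≤ J * r ^ j := mul_le_mul_left hJA _
        _ = A * r ^ (j + 1) := by rw [pow_succ', mul_assoc]
  have hJbot : J ^ k = ⊥ := by
    rw [eq_bot_iff]
    refine (hJk k).trans ?_
    rw [hk, Submodule.mul_bot]
  let N : Subgroup (GL (Fin n) ℂ) :=
    { carrier := {g | g ∈ G ∧ (g : Mat n) - 1 ∈ J}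
      mul_mem' := fun {g g'} hg hg' => ⟨G.mul_mem hg.1 hg'.1, by
        have : ((g * g' : GL (Fin n) ℂ) : Mat n) - 1 = ((g : Mat n) - 1) * g' + ((g' : Mat n) - 1) := by
          rw [Units.val_mul, sub_mul, one_mul]
          abel
        rw [this]
        exact J.add_mem (hJA (Submodule.mul_mem_mul hg.2 (hGA _ hg'.1))) hg'.2⟩
      one_mem' := ⟨G.one_mem, by simp⟩
      inv_mem' := fun {g} hg => ⟨G.inv_mem hg.1, by
        have : ((g⁻¹ : GL (Fin n) ℂ) : Mat n) - 1 =
            -(((g : Mat n) - 1) * ((g⁻¹ : GL (Fin n) ℂ) : Mat n)) := by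
          rw [sub_mul, one_mul, Units.mul_inv]
          abel
        rw [this]
        exact J.neg_mem (hJA (Submodule.mul_mem_mul hg.2 (hGA _ (G.inv_mem hg.1))))⟩ }
  have hNmem : ∀ g, g ∈ N ↔ g ∈ G ∧ (g : Mat n) - 1 ∈ J := fun g => Iff.rfl
  have hNbot : N = ⊥ := by
    refine hG.unipotentRadical_trivial N (fun g hg => hg.1) ⟨fun g hg h => ?_⟩ ?_
      (isConnected_of_sub_one_mem hG.algebraic hJJ hJbot hNmem) (fun g hg => ⟨k, ?_⟩)
    · rw [Subgroup.mem_subgroupOf] at hg ⊢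
      refine ⟨(h * g * h⁻¹).2, ?_⟩
      have h1 : (((h * g * h⁻¹ : G) : GL (Fin n) ℂ) : Mat n) - 1 =
          ((h : GL (Fin n) ℂ) : Mat n) * (((g : GL (Fin n) ℂ) : Mat n) - 1) *
            (((h⁻¹ : G) : GL (Fin n) ℂ) : Mat n) := by
        simp [mul_sub, sub_mul]
      rw [h1]
      exact hJA (Submodule.mul_mem_mul (hAJ (Submodule.mul_mem_mul (hGA _ h.2) hg.2))
        (hGA _ (h⁻¹).2))
    · obtain ⟨S, hS, hSG⟩ := isAlgebraicSubgroup_iff.1 hG.algebraic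
      obtain ⟨S', hS', hSJ⟩ := exists_isPoly_of_submodule J
      refine isAlgebraicSubgroup_iff.2 ⟨S ∪ S', ?_, fun g => ?_⟩
      · rintro F (hF | hF)
        exacts [hS F hF, hS' F hF]
      · rw [hNmem, hSG, hSJ]
        constructor
        · rintro ⟨h1, h2⟩ F (hF | hF)
          exacts [h1 F hF, h2 F hF]
        · exact fun h => ⟨fun F hF => h F (Or.inl hF), fun F hF => h F (Or.inr hF)⟩
    · have := Submodule.pow_mem_pow J hg.2 k
      rwa [hJbot, Submodule.mem_bot] at this
  have hxr : x ∈ r := ⟨hx, h⟩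
  obtain ⟨l, hl⟩ := hnil x hxr
  have hl' : x ^ (l + 1) = 0 := by rw [pow_succ, hl, zero_mul]
  have hxA : ∀ j, x ^ j ∈ A := by
    intro j
    induction j with
    | zero => simpa using h1A
    | succ j ih => rw [pow_succ]; exact hAA (Submodule.mul_mem_mul ih (hrleA hxr))
  -- Every positive power of `x ∈ r` lies in `A * r`, so `exp(tx)` belongs to the trivial group `N`.
  have hexp : ∀ t : ℂ, expU (t • x) = 1 := by
    intro t
    rw [← Subgroup.mem_bot, ← hNbot]
    refine ⟨(mem_lie hG.algebraic).1 hx t, ?_⟩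
    rw [coe_expU, exp_smul_of_pow_eq_zero hl', Finset.sum_range_succ']
    simp only [pow_zero, Nat.factorial_zero, Nat.cast_one, inv_one, mul_one, one_smul,
      add_sub_cancel_right]
    refine J.sum_mem fun j _ => J.smul_mem _ ?_
    rw [pow_succ]
    exact Submodule.mul_mem_mul (hxA j) hxr
  have := mem_of_exp_mem (W := ⊥) (x := x) (m := 1) fun t => by
    rw [← coe_expU, hexp]
    simp
  simpa using this

/-! ### Weight decompositions -/

/-- Entrywise multiplication by `c`, in the coordinates given by `P`. -/
def schur (P : GL (Fin n) ℂ) (c : Mat n) (y : Mat n) : Mat n :=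
  ((P⁻¹ : GL (Fin n) ℂ) : Mat n) * (c ⊙ ((P : Mat n) * y * ((P⁻¹ : GL (Fin n) ℂ) : Mat n))) *
    (P : Mat n)

theorem conj_schur (P : GL (Fin n) ℂ) (c y : Mat n) :
    (P : Mat n) * schur P c y * ((P⁻¹ : GL (Fin n) ℂ) : Mat n) =
      c ⊙ ((P : Mat n) * y * ((P⁻¹ : GL (Fin n) ℂ) : Mat n)) := by
  rw [schur]
  simp only [mul_assoc, Units.mul_inv_cancel_left, Units.mul_inv, mul_one]

theorem conj_injective {P : GL (Fin n) ℂ} {x y : Mat n}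
    (h : (P : Mat n) * x * ((P⁻¹ : GL (Fin n) ℂ) : Mat n) =
      (P : Mat n) * y * ((P⁻¹ : GL (Fin n) ℂ) : Mat n)) : x = y := by
  have := congrArg (fun m : Mat n => ((P⁻¹ : GL (Fin n) ℂ) : Mat n) * m * (P : Mat n)) h
  simpa only [mul_assoc, Units.inv_mul_cancel_left, Units.inv_mul, mul_one] using this

theorem conj_bracket_dg (P : GL (Fin n) ℂ) (b : Fin n → ℂ) (y : Mat n) (i j : Fin n) :
    ((P : Mat n) * (dg P b * y - y * dg P b) * ((P⁻¹ : GL (Fin n) ℂ) : Mat n)) i j =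
      (b i - b j) * ((P : Mat n) * y * ((P⁻¹ : GL (Fin n) ℂ) : Mat n)) i j := by
  have h1 : (P : Mat n) * (dg P b * y - y * dg P b) * ((P⁻¹ : GL (Fin n) ℂ) : Mat n) =
      diagonal b * ((P : Mat n) * y * ((P⁻¹ : GL (Fin n) ℂ) : Mat n)) -
        ((P : Mat n) * y * ((P⁻¹ : GL (Fin n) ℂ) : Mat n)) * diagonal b := by
    rw [mul_sub, sub_mul, dg_apply]
    simp only [mul_assoc, Units.mul_inv_cancel_left, Units.mul_inv, mul_one]
  rw [h1, Matrix.sub_apply, diagonal_mul, mul_diagonal]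
  ring

/-- Polynomials in the bracket with `dg P b` multiply entries by `q (b i - b j)` and preserve `W`.
Lagrange interpolation at the finitely many differences replaces `f` by a polynomial. -/
theorem schur_mem {P : GL (Fin n) ℂ} {b : Fin n → ℂ} {W : Submodule ℂ (Mat n)}
    (hW : ∀ y ∈ W, dg P b * y - y * dg P b ∈ W) (f : ℂ → ℂ) {y : Mat n} (hy : y ∈ W) :
    schur P (of fun i j => f (b i - b j)) y ∈ W := by
  have hpoly : ∀ q : Polynomial ℂ, schur P (of fun i j => q.eval (b i - b j)) y ∈ W := by
    intro q
    induction q using Polynomial.induction_on with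
    | C c =>
      have : schur P (of fun i j => (Polynomial.C c).eval (b i - b j)) y = c • y := by
        apply conj_injective (P := P)
        rw [conj_schur]
        ext i j
        simp [Matrix.hadamard]
      rw [this]
      exact W.smul_mem c hy
    | add p q hp hq =>
      have : schur P (of fun i j => (p + q).eval (b i - b j)) y =
          schur P (of fun i j => p.eval (b i - b j)) y +
            schur P (of fun i j => q.eval (b i - b j)) y := by
        apply conj_injective (P := P)
        rw [mul_add, add_mul, conj_schur, conj_schur, conj_schur]
        ext i j
        simp [Matrix.hadamard, add_mul]
      rw [this]
      exact W.add_mem hp hq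
    | monomial k c ih =>
      convert hW _ ih using 1
      apply conj_injective (P := P)
      ext i j
      rw [conj_bracket_dg, conj_schur, conj_schur]
      simp only [Matrix.hadamard, of_apply, Polynomial.eval_mul, Polynomial.eval_C,
        Polynomial.eval_pow, Polynomial.eval_X, pow_succ]
      ring
  let s : Finset ℂ := Finset.univ.image fun ij : Fin n × Fin n => b ij.1 - b ij.2
  have hq := hpoly (Lagrange.interpolate s id f)
  have h : (of fun i j => f (b i - b j) : Mat n) =
      of fun i j => (Lagrange.interpolate s id f).eval (b i - b j) := by
    ext i j
    have hm : b i - b j ∈ s := Finset.mem_image.2 ⟨(i, j), Finset.mem_univ _, rfl⟩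
    exact (Lagrange.eval_interpolate_at_node (v := id) f Function.injective_id.injOn hm).symm
  rwa [h]

/-- A space of simultaneously diagonal matrices contains an element on which all the weights
not vanishing identically have nonzero real part. -/
theorem exists_generic {P : GL (Fin n) ℂ} (W : Submodule ℂ (Mat n)) :
    ∃ b : Fin n → ℂ, dg P b ∈ W ∧
      ∀ i j, (b i).re = (b j).re → ∀ e, dg P e ∈ W → e i = e j := by
  classical
  let W' : Submodule ℝ (Fin n → ℂ) := (W.comap (dg P).toLinearMap).restrictScalars ℝ
  have hW' : ∀ e, e ∈ W' ↔ dg P e ∈ W := fun e => Iff.rfl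
  let ℓ : Fin n × Fin n → W' →ₗ[ℝ] ℝ := fun ij =>
    (Complex.reLm ∘ₗ (LinearMap.proj (R := ℝ) (φ := fun _ : Fin n => ℂ) ij.1 -
      LinearMap.proj (R := ℝ) (φ := fun _ : Fin n => ℂ) ij.2)) ∘ₗ W'.subtype
  have hℓ : ∀ ij e, ℓ ij e = ((e : Fin n → ℂ) ij.1).re - ((e : Fin n → ℂ) ij.2).re :=
    fun ij e => by simp [ℓ]
  let I : Finset (Fin n × Fin n) := Finset.univ.filter fun ij => ℓ ij ≠ 0
  let s : Finset (Subspace ℝ W') := I.image fun ij => LinearMap.ker (ℓ ij)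
  have hs : ⊤ ∉ s := by
    intro h
    obtain ⟨ij, hij, h⟩ := Finset.mem_image.1 h
    exact (Finset.mem_filter.1 hij).2 (LinearMap.ker_eq_top.1 h)
  -- A real vector space is not a finite union of proper subspaces, so some `b` avoids the kernels
  -- of all nonzero `ℓ ij`.
  have hne := Subspace.biUnion_ne_univ_of_top_notMem hs
  obtain ⟨b, hb⟩ := (Set.ne_univ_iff_exists_notMem _).1 hne
  simp only [Set.mem_iUnion, not_exists] at hb
  refine ⟨b, b.2, fun i j hij e he => ?_⟩
  have h0 : ℓ (i, j) = 0 := by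
    by_contra h
    refine hb _ (Finset.mem_image.2 ⟨(i, j), Finset.mem_filter.2 ⟨Finset.mem_univ _, h⟩, rfl⟩) ?_
    rw [SetLike.mem_coe, LinearMap.mem_ker, hℓ, sub_eq_zero]
    exact hij
  have h1 : (e i).re = (e j).re := by
    have := LinearMap.congr_fun h0 ⟨e, he⟩
    rw [hℓ] at this
    exact sub_eq_zero.1 this
  have h2 : (e i).im = (e j).im := by
    -- Imaginary parts are, up to sign, the real parts of `I • e`, which is available because `W` is
    -- complex.
    have hIe : Complex.I • e ∈ W' := by
      rw [hW', map_smul]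
      exact W.smul_mem _ he
    have := LinearMap.congr_fun h0 ⟨_, hIe⟩
    rw [hℓ] at this
    have := sub_eq_zero.1 this
    simpa using this
  exact Complex.ext h1 h2

/-! ### Maximal tori are their own infinitesimal centralizers -/

/-- The diagonal elements of `K`, in the coordinates given by `P`. -/
def diagSubgroup (P : GL (Fin n) ℂ) (K : Subgroup (GL (Fin n) ℂ)) : Subgroup (GL (Fin n) ℂ) :=
  K ⊓ { carrier := {g | ∃ d, (g : Mat n) = dg P d}
        mul_mem' := by
          rintro a b ⟨d, hd⟩ ⟨e, he⟩
          exact ⟨d * e, by rw [Units.val_mul, hd, he, map_mul]⟩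
        one_mem' := ⟨1, by simp⟩
        inv_mem' := by
          rintro a ⟨d, hd⟩
          have h0 : ∀ i, d i ≠ 0 := by
            have h1 : (a : Mat n).det ≠ 0 := ((Matrix.isUnit_iff_isUnit_det _).1 a.isUnit).ne_zero
            rw [hd, det_dg, Finset.prod_ne_zero_iff] at h1
            exact fun i => h1 i (Finset.mem_univ i)
          refine ⟨d⁻¹, ?_⟩
          have h1 : (a : Mat n) * dg P d⁻¹ = 1 := by
            rw [hd, ← map_mul]
            have : d * d⁻¹ = 1 := by
              ext i
              simp [h0 i]
            rw [this, map_one]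
          exact Units.inv_eq_of_mul_eq_one_right h1 }

theorem isDiagonalizable_diagSubgroup (P : GL (Fin n) ℂ) (K : Subgroup (GL (Fin n) ℂ)) :
    IsDiagonalizable (diagSubgroup P K) :=
  isDiagonalizable_iff.2 ⟨P, fun _ hg => hg.2⟩

theorem IsAlgebraicSubgroup.diagSubgroup {K : Subgroup (GL (Fin n) ℂ)}
    (hK : IsAlgebraicSubgroup K) (P : GL (Fin n) ℂ) :
    IsAlgebraicSubgroup (diagSubgroup P K) := by
  refine hK.inf (isAlgebraicSubgroup_iff.2 ⟨{F | ∃ i j, i ≠ j ∧ F = fun m : Mat n =>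
    ((P : Mat n) * m * ((P⁻¹ : GL (Fin n) ℂ) : Mat n)) i j}, ?_, fun g => ⟨?_, fun h => ?_⟩⟩)
  · rintro _ ⟨i, j, -, rfl⟩
    exact (IsPoly.coord i j).conj _ _
  · rintro ⟨d, hd⟩ _ ⟨i, j, hij, rfl⟩
    simp only
    rw [hd, conj_dg, diagonal_apply_ne _ hij]
  · exact exists_dg_of_isDiag fun i j hij => h _ ⟨i, j, hij, rfl⟩

theorem IsTorus.commute {T : Subgroup (GL (Fin n) ℂ)} (hT : IsTorus T) {x y : Mat n}
    (hx : x ∈ lie T) (hy : y ∈ lie T) : Commute x y := by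
  obtain ⟨P, -, hP⟩ := hT.exists_dg
  obtain ⟨d, rfl⟩ := hP x hx
  obtain ⟨e, rfl⟩ := hP y hy
  exact commute_dg P d e

/-- The element and `lie H` are simultaneously diagonalizable. The exponentials of the Lie algebra
of the diagonal subgroup of `G` in these coordinates form a torus containing `H`, which equals `H`
by maximality. -/
theorem IsCartanSubgroup.mem_lie_of_commute {G H : Subgroup (GL (Fin n) ℂ)}
    (hG : IsAlgebraicSubgroup G) (hH : IsCartanSubgroup G H) {P : GL (Fin n) ℂ} {d : Fin n → ℂ}
    (hs : dg P d ∈ lie G) (hc : ∀ y ∈ lie H, Commute (dg P d) y) : dg P d ∈ lie H := by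
  have hHT : IsTorus H := hH.prop.1
  have hHG : H ≤ G := hH.prop.2
  obtain ⟨P', -, hP'⟩ := hHT.exists_dg
  obtain ⟨Q, hQ⟩ := exists_dg_of_commute (S := insert (dg P d) (lie H : Set (Mat n))) (by
      rintro x (rfl | hx) y (rfl | hy)
      · exact Commute.refl _
      · exact hc y hy
      · exact (hc x hx).symm
      · exact hHT.commute hx hy) (by
      rintro x (rfl | hx)
      · exact ⟨P, d, rfl⟩
      · obtain ⟨e, he⟩ := hP' x hx
        exact ⟨P', e, he⟩)
  have hK := hG.diagSubgroup Q
  have hmem : ∀ x ∈ lie G, (∃ e, x = dg Q e) → x ∈ lie (diagSubgroup Q G) := by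
    rintro x hx ⟨e, rfl⟩
    rw [mem_lie hK]
    exact fun t => ⟨(mem_lie hG).1 hx t, _, by rw [coe_expU, ← map_smul, exp_dg]⟩
  obtain ⟨T, hT, hTexp⟩ := exists_isTorus_exp_lie hK (isDiagonalizable_diagSubgroup Q G)
  have hTG : T ≤ G := by
    intro g hg
    rw [← SetLike.mem_coe, hTexp] at hg
    obtain ⟨x, hx, rfl⟩ := hg
    exact (expU_mem hK hx).1
  have hHleT : H ≤ T := by
    intro g hg
    rw [← SetLike.mem_coe, hHT.eq_exp] at hg
    obtain ⟨x, hx, rfl⟩ := hg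
    rw [← SetLike.mem_coe, hTexp]
    exact ⟨x, hmem x (lie_mono hHG hx) (hQ x (Or.inr hx)), rfl⟩
  have hTH : T ≤ H := hH.2 ⟨hT, hTG⟩ hHleT
  rw [mem_lie hHT.algebraic]
  intro t
  apply hTH
  rw [← SetLike.mem_coe, hTexp]
  exact ⟨_, (lie _).smul_mem t (hmem _ hs (hQ _ (Or.inl rfl))), rfl⟩

theorem jordan_commute {P : GL (Fin n) ℂ} {d : Fin n → ℂ} {ν : Mat n}
    (hc : ∀ y, Commute y (dg P d + ν) → Commute y (dg P d)) : Commute ν (dg P d) := by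
  have h2 := (hc _ (Commute.refl _)).sub_left (Commute.refl (dg P d))
  rwa [add_sub_cancel_left] at h2

/-- The Lie algebra of a maximal torus of a reductive group is its own centralizer. -/
theorem IsCartanSubgroup.mem_lie_of_forall_commute {G H : Subgroup (GL (Fin n) ℂ)}
    (hG : IsConnectedReductive G) (hH : IsCartanSubgroup G H) {x : Mat n} (hx : x ∈ lie G)
    (hc : ∀ y ∈ lie H, Commute x y) : x ∈ lie H := by
  have hHT : IsTorus H := hH.prop.1
  have hlie := lie_mono hH.prop.2
  have hjordan : ∀ y ∈ lie G, (∀ t ∈ lie H, Commute y t) → ∃ s ∈ lie H, ∃ ν ∈ lie G,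
      y = s + ν ∧ IsNilpotent ν ∧ Commute ν s ∧ (∀ t ∈ lie H, Commute ν t) ∧
      ((∀ t ∈ lie H, (y * t).trace = 0) → s = 0) := by
    intro y hy hyc
    obtain ⟨P, d, ν, rfl, hν, hcom⟩ := exists_jordan y
    have hνs := jordan_commute hcom
    have hs : dg P d ∈ lie H := hH.mem_lie_of_commute hG.algebraic
      (replica_mem_lie hG.algebraic hy hν hνs (AddMonoidHom.id ℂ))
      fun t ht => (hcom t (hyc t ht).symm).symm
    refine ⟨_, hs, ν, ?_, rfl, hν, hνs, fun t ht => ?_, fun h => ?_⟩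
    · have := (lie G).sub_mem hy (hlie hs)
      rwa [add_sub_cancel_left] at this
    · have := (hyc t ht).sub_left (hHT.commute hs ht)
      rwa [add_sub_cancel_left] at this
    · have : d = 0 := jordan_eq_zero_of_trace hν hνs fun φ =>
        h _ (replica_mem_lie_of_dg hHT.algebraic hs φ)
      rw [this, map_zero]
  -- The part of the centralizer of `lie H` orthogonal to `lie H`. Its elements have zero semisimple
  -- part, so Engel's theorem makes products of enough of them vanish.
  let c : Submodule ℂ (Mat n) :=
    { carrier := {y | y ∈ lie G ∧ (∀ t ∈ lie H, Commute y t) ∧ ∀ t ∈ lie H, (y * t).trace = 0}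
      add_mem' := fun {a b} ha hb => ⟨(lie G).add_mem ha.1 hb.1,
        fun t ht => (ha.2.1 t ht).add_left (hb.2.1 t ht),
        fun t ht => by rw [add_mul, trace_add, ha.2.2 t ht, hb.2.2 t ht, add_zero]⟩
      zero_mem' := ⟨(lie G).zero_mem, fun t _ => Commute.zero_left t, fun t _ => by simp⟩
      smul_mem' := fun k a ha => ⟨(lie G).smul_mem k ha.1, fun t ht => (ha.2.1 t ht).smul_left k,
        fun t ht => by rw [smul_mul_assoc, trace_smul, ha.2.2 t ht, smul_zero]⟩ }
  have hcmem : ∀ ν ∈ lie G, IsNilpotent ν → (∀ t ∈ lie H, Commute ν t) → ν ∈ c := fun ν h1 h2 h3 =>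
    ⟨h1, h3, fun t ht => trace_eq_zero_of_isNilpotent ((h3 t ht).isNilpotent_mul_right h2)⟩
  obtain ⟨k, hk⟩ := exists_pow_eq_bot (W := c) (by
      intro a ha b hb
      refine ⟨bracket_mem hG.algebraic ha.1 (fun g hg y hy => conj_mem_lie hG.algebraic hy hg) hb.1,
        fun t ht => ((ha.2.1 t ht).mul_left (hb.2.1 t ht)).sub_left
          ((hb.2.1 t ht).mul_left (ha.2.1 t ht)), fun t ht => ?_⟩
      rw [sub_mul, trace_sub, sub_eq_zero, mul_assoc, (hb.2.1 t ht).eq, ← mul_assoc,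
        Matrix.trace_mul_comm, mul_assoc]) (by
      intro a ha
      obtain ⟨s, hs, ν, hν, rfl, hnil, -, -, h0⟩ := hjordan a ha.1 ha.2.1
      rw [h0 ha.2.2, zero_add]
      exact hnil)
  obtain ⟨s, hs, ν, hν, rfl, hnil, hνs, hνH, -⟩ := hjordan x hx hc
  have hνc := hcmem ν hν hnil hνH
  have hcent : ∀ y ∈ lie G, (∀ t ∈ lie H, Commute y t) → (ν * y).trace = 0 := by
    intro y hy hyc
    obtain ⟨s', hs', ν', hν', rfl, hnil', -, hνH', -⟩ := hjordan y hy hyc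
    have hνc' := hcmem ν' hν' hnil' hνH'
    rw [mul_add, trace_add, hνc.2.2 s' hs', zero_add]
    refine trace_eq_zero_of_isNilpotent ⟨k, ?_⟩
    have h1 := Submodule.pow_mem_pow _ (Submodule.mul_mem_mul hνc hνc') k
    rw [← pow_two, ← pow_mul, mul_comm, pow_mul, hk] at h1
    have h2 : (⊥ : Submodule ℂ (Mat n)) ^ 2 = ⊥ := by rw [pow_two, Submodule.bot_mul]
    rwa [h2, Submodule.mem_bot] at h1
  -- Any `y ∈ lie G` is a centralizing part plus a bracket with a generic element of `lie H`. The
  -- nilpotent `ν` is orthogonal to the first by `hcent`, and to the second because it commutes with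
  -- `lie H`; nondegeneracy concludes.
  have hν0 : ν = 0 := by
    refine hG.eq_zero_of_trace hν fun y hy => ?_
    obtain ⟨P, -, hP⟩ := hHT.exists_dg
    obtain ⟨b, hb, hgen⟩ := exists_generic (P := P) (lie H)
    have hW : ∀ y ∈ lie G, dg P b * y - y * dg P b ∈ lie G := fun y hy =>
      bracket_mem hG.algebraic (hlie hb) (fun g hg y hy => conj_mem_lie hG.algebraic hy hg) hy
    have hy0 := schur_mem hW (fun z => if z = 0 then 1 else 0) hy
    set y₀ := schur P (of fun i j => (fun z : ℂ => if z = 0 then (1 : ℂ) else 0) (b i - b j)) y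
    -- The bracket with `dg P b` is inverted on nonzero weights; the convention `0⁻¹ = 0` discards
    -- the zero weight, which `y₀` carries.
    set y₁ := schur P (of fun i j => (fun z : ℂ => z⁻¹) (b i - b j)) y
    have hdec : y = y₀ + (dg P b * y₁ - y₁ * dg P b) := by
      apply conj_injective (P := P)
      ext i j
      rw [mul_add, add_mul, Matrix.add_apply, conj_bracket_dg, conj_schur, conj_schur]
      simp only [Matrix.hadamard, of_apply]
      by_cases h : b i - b j = 0
      · simp [h]
      · simp [h]
    have h0 : (ν * y₀).trace = 0 := by
      refine hcent y₀ hy0 fun t ht => ?_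
      obtain ⟨e, rfl⟩ := hP t ht
      rw [commute_dg_iff]
      intro i j hij
      rw [conj_schur]
      simp only [Matrix.hadamard, of_apply]
      have : b i - b j ≠ 0 := fun h0 => hij (hgen i j (by rw [sub_eq_zero.1 h0]) e ht)
      rw [if_neg this, zero_mul]
    rw [hdec, mul_add, trace_add, h0, zero_add, mul_sub, trace_sub, sub_eq_zero, ← mul_assoc,
      (hνH _ hb).eq, mul_assoc, Matrix.trace_mul_comm, mul_assoc]
  rw [hν0, add_zero]
  exact hs

/-! ### Block `LDU` decompositions and minors -/

section Minors

variable {ι κ : Type*} [Fintype ι] [DecidableEq ι] [Fintype κ] [DecidableEq κ]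
  {R : Type*} [CommRing R]

set_option linter.unusedSectionVars false

theorem submatrix_mul_of_injective {f : ι → κ} (hf : Function.Injective f) {A B : Matrix κ κ R}
    (h : ι → κ) (hA : ∀ r k, k ∉ Set.range f → A (f r) k = 0) :
    (A * B).submatrix f h = A.submatrix f f * B.submatrix f h := by
  ext r c
  rw [submatrix_apply, mul_apply, mul_apply]
  symm
  refine Fintype.sum_of_injective f hf _ _ (fun k hk => ?_) fun k => rfl
  rw [hA r k hk, zero_mul]

theorem det_submatrix_eq_one {β : κ → ℝ} {A : Matrix κ κ R}
    (hA : ∀ i j, ¬ β i < β j → A i j = (1 : Matrix κ κ R) i j) {f : ι → κ}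
    (hf : Function.Injective f) : (A.submatrix f f).det = 1 := by
  have hb : (A.submatrix f f).BlockTriangular (β ∘ f) := fun i j hij => by
    rw [submatrix_apply, hA _ _ (not_lt.2 (le_of_lt hij)), one_apply_ne]
    exact fun h => (ne_of_lt hij) (by simp [h])
  rw [hb.det]
  refine Finset.prod_eq_one fun a _ => ?_
  rw [← det_one (R := R) (n := {i // (β ∘ f) i = a})]
  congr 1
  ext i j
  have hij : ¬ β (f i) < β (f j) := by
    have hi : β (f i) = a := i.2
    have hj : β (f j) = a := j.2
    rw [hi, hj]
    exact lt_irrefl _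
  change A (f i) (f j) = _
  rw [hA _ _ hij]
  simp only [one_apply, hf.eq_iff, Subtype.ext_iff]

/-- The minors of `L * D * U` with upward closed sets of rows and columns are those of `D`. -/
theorem det_submatrix_ldu {β : κ → ℝ} {L D U : Matrix κ κ R}
    (hL : ∀ i j, ¬ β i < β j → L i j = (1 : Matrix κ κ R) i j)
    (hU : ∀ i j, ¬ β j < β i → U i j = (1 : Matrix κ κ R) i j) {f h : ι → κ}
    (hf : Function.Injective f) (hh : Function.Injective h)
    (hfc : ∀ r k, β (f r) < β k → k ∈ Set.range f) (hhc : ∀ r k, β (h r) < β k → k ∈ Set.range h) :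
    ((L * D * U).submatrix f h).det = (D.submatrix f h).det := by
  have h1 : (D * U).submatrix f h = D.submatrix f h * U.submatrix h h := by
    have := submatrix_mul_of_injective (A := Uᵀ) (B := Dᵀ) hh f fun r k hk => by
      rw [transpose_apply, hU _ _ fun hlt => hk (hhc r k hlt), one_apply_ne]
      rintro rfl
      exact hk ⟨r, rfl⟩
    have := congrArg transpose this
    rwa [← transpose_mul, transpose_submatrix, transpose_transpose, transpose_mul,
      transpose_submatrix, transpose_submatrix, transpose_transpose, transpose_transpose] at this
  rw [mul_assoc, submatrix_mul_of_injective hf h fun r k hk => ?_, det_mul, h1, det_mul,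
    det_submatrix_eq_one hL hf, one_mul]
  · have : (Uᵀ.submatrix h h).det = 1 := det_submatrix_eq_one (β := β) (fun i j hij => by
      rw [transpose_apply, hU _ _ hij, one_apply, one_apply]
      simp only [eq_comm]) hh
    rw [← transpose_submatrix, det_transpose] at this
    rw [this, mul_one]
  · rw [hL _ _ fun hlt => hk (hfc r k hlt), one_apply_ne]
    rintro rfl
    exact hk ⟨r, rfl⟩

/-- The rows with weight greater than that of `i`, followed by `k`. -/
def aboveCons (β : κ → ℝ) (i k : κ) : {l // β i < β l} ⊕ Unit → κ :=
  Sum.elim Subtype.val fun _ => k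

theorem aboveCons_injective {β : κ → ℝ} {i k : κ} (h : β i = β k) :
    Function.Injective (aboveCons β i k) := by
  rintro (⟨a, ha⟩ | a) (⟨b, hb⟩ | b) hab
  · simpa [aboveCons] using hab
  · simp only [aboveCons, Sum.elim_inl, Sum.elim_inr] at hab
    rw [hab, h] at ha
    exact absurd ha (lt_irrefl _)
  · simp only [aboveCons, Sum.elim_inl, Sum.elim_inr] at hab
    rw [← hab, h] at hb
    exact absurd hb (lt_irrefl _)
  · rfl

theorem mem_range_aboveCons {β : κ → ℝ} {i k : κ} (h : β i = β k) (r) (l : κ)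
    (hl : β (aboveCons β i k r) < β l) : l ∈ Set.range (aboveCons β i k) := by
  refine ⟨Sum.inl ⟨l, ?_⟩, rfl⟩
  rcases r with ⟨a, ha⟩ | a
  · exact ha.trans hl
  · rw [h]
    exact hl

theorem det_submatrix_aboveCons {β : κ → ℝ} {i j : κ} {D : Matrix κ κ R} (hij : β i = β j)
    (hD : ∀ i j, β i ≠ β j → D i j = 0) :
    (D.submatrix (aboveCons β i i) (aboveCons β i j)).det =
      D i j * (D.submatrix (Subtype.val : {l // β i < β l} → κ) Subtype.val).det := by
  have : D.submatrix (aboveCons β i i) (aboveCons β i j) =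
      fromBlocks (D.submatrix (Subtype.val : {l // β i < β l} → κ) Subtype.val) 0 0
        (of fun _ _ : Unit => D i j) := by
    ext (⟨a, ha⟩ | a) (⟨b, hb⟩ | b)
    · rfl
    · exact hD _ _ fun h : β a = β j => (hij ▸ h ▸ ha).ne rfl
    · exact hD _ _ (ne_of_lt hb)
    · rfl
  rw [this, det_fromBlocks_zero₂₁, det_unique (of fun _ _ : Unit => D i j), mul_comm]
  rfl

/-- The minor of the entries with weights greater than that of `i`. -/
noncomputable def minorAbove (β : κ → ℝ) (m : Matrix κ κ R) (i : κ) : R :=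
  (m.submatrix (Subtype.val : {l // β i < β l} → κ) Subtype.val).det

/-- The numerators of the entries of `D` in terms of those of `L * D * U`. -/
noncomputable def lduNumerator (β : κ → ℝ) (m : Matrix κ κ R) (i j : κ) : R :=
  open Classical in if β i = β j then
    (m.submatrix (aboveCons β i i) (aboveCons β i j)).det *
      ∏ k ∈ Finset.univ.erase i, minorAbove β m k
  else 0

/-- Both minors can be read off from `D`, which is block diagonal: bordering the block above `i` by
row `i` and column `j` multiplies its minor by `D i j`. The remaining minors provide a denominator
common to all entries. -/
theorem mul_prod_minorAbove {β : κ → ℝ} {L D U : Matrix κ κ R}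
    (hL : ∀ i j, ¬ β i < β j → L i j = (1 : Matrix κ κ R) i j)
    (hU : ∀ i j, ¬ β j < β i → U i j = (1 : Matrix κ κ R) i j)
    (hD : ∀ i j, β i ≠ β j → D i j = 0) (i j : κ) :
    D i j * ∏ k, minorAbove β (L * D * U) k = lduNumerator β (L * D * U) i j := by
  classical
  by_cases hij : β i = β j
  · have hm : minorAbove β (L * D * U) i =
        (D.submatrix (Subtype.val : {l // β i < β l} → κ) Subtype.val).det :=
      det_submatrix_ldu hL hU Subtype.val_injective Subtype.val_injective
        (fun r k hk => ⟨⟨k, r.2.trans hk⟩, rfl⟩) fun r k hk => ⟨⟨k, r.2.trans hk⟩, rfl⟩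
    rw [lduNumerator, if_pos hij, det_submatrix_ldu hL hU (aboveCons_injective rfl)
      (aboveCons_injective hij) (mem_range_aboveCons rfl) (mem_range_aboveCons hij),
      det_submatrix_aboveCons hij hD, ← Finset.mul_prod_erase _ _ (Finset.mem_univ i), hm,
      mul_assoc (D i j)]
  · rw [lduNumerator, if_neg hij, hD _ _ hij, zero_mul]

theorem minorAbove_ne_zero {F : Type*} [Field F] {β : κ → ℝ} {D D' : Matrix κ κ F}
    (hD : ∀ i j, β i ≠ β j → D i j = 0) (h : D * D' = 1) (i : κ) : minorAbove β D i ≠ 0 := by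
  have h1 := submatrix_mul_of_injective (A := D) (B := D')
    (f := (Subtype.val : {l // β i < β l} → κ)) Subtype.val_injective Subtype.val
    fun r k hk => hD _ _ fun h => by
      refine hk ⟨⟨k, ?_⟩, rfl⟩
      rw [← h]
      exact r.2
  have h2 := congrArg det h1
  rw [h, submatrix_one _ Subtype.val_injective, det_one, det_mul] at h2
  exact left_ne_zero_of_mul (h2 ▸ one_ne_zero)

end Minors

theorem IsPoly.minorAbove (β : Fin n → ℝ) (i : Fin n) :
    IsPoly fun m : Mat n => minorAbove β m i :=
  IsPoly.det fun _ _ => IsPoly.coord _ _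

theorem IsPoly.lduNumerator (β : Fin n → ℝ) (i j : Fin n) :
    IsPoly fun m : Mat n => lduNumerator β m i j := by
  unfold RealReductive.lduNumerator
  split_ifs
  · exact (IsPoly.det fun _ _ => IsPoly.coord _ _).mul
      (IsPoly.prod _ fun k _ => IsPoly.minorAbove β k)
  · exact IsPoly.const 0

/-- A polynomial evaluated at fractions becomes polynomial after clearing denominators. -/
theorem IsPoly.exists_clear_denominators {δ : Mat n → ℂ} (hδ : IsPoly δ) {M : Mat n → Mat n}
    (hM : ∀ i j, IsPoly fun m => M m i j) {F : Mat n → ℂ} (hF : IsPoly F) :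
    ∃ (N : ℕ) (Q : Mat n → ℂ), IsPoly Q ∧
      ∀ m D : Mat n, (∀ i j, D i j * δ m = M m i j) → Q m = δ m ^ N * F D := by
  obtain ⟨p, hp⟩ := hF
  simp only [hp]
  clear hp
  induction p using MvPolynomial.induction_on with
  | C a => exact ⟨0, fun _ => a, IsPoly.const a, fun m D _ => by simp⟩
  | add p q hp hq =>
    obtain ⟨N, Q, hQ, h⟩ := hp
    obtain ⟨N', Q', hQ', h'⟩ := hq
    refine ⟨N + N', fun m => δ m ^ N' * Q m + δ m ^ N * Q' m,
      ((hδ.pow _).mul hQ).add ((hδ.pow _).mul hQ'), fun m D hD => ?_⟩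
    change δ m ^ N' * Q m + δ m ^ N * Q' m = _
    rw [h m D hD, h' m D hD, map_add]
    ring
  | mul_X p ij hp =>
    obtain ⟨N, Q, hQ, h⟩ := hp
    refine ⟨N + 1, fun m => Q m * M m ij.1 ij.2, hQ.mul (hM _ _), fun m D hD => ?_⟩
    change Q m * M m ij.1 ij.2 = _
    rw [h m D hD, ← hD, map_mul, MvPolynomial.eval_X]
    ring

/-- The matrices whose entries, in the coordinates given by `P`, vanish outside `r`. -/
def supported (P : GL (Fin n) ℂ) (r : Fin n → Fin n → Prop) : Submodule ℂ (Mat n) where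
  carrier := {y | ∀ i j, ¬ r i j → ((P : Mat n) * y * ((P⁻¹ : GL (Fin n) ℂ) : Mat n)) i j = 0}
  add_mem' {a b} ha hb i j hij := by
    rw [mul_add, add_mul, Matrix.add_apply, ha i j hij, hb i j hij, add_zero]
  zero_mem' i j _ := by simp
  smul_mem' c a ha i j hij := by
    rw [mul_smul_comm, smul_mul_assoc, Matrix.smul_apply, ha i j hij, smul_zero]

theorem mem_supported {P : GL (Fin n) ℂ} {r : Fin n → Fin n → Prop} {y : Mat n} :
    y ∈ supported P r ↔
      ∀ i j, ¬ r i j → ((P : Mat n) * y * ((P⁻¹ : GL (Fin n) ℂ) : Mat n)) i j = 0 := Iff.rfl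

theorem mul_mem_supported {P : GL (Fin n) ℂ} {r : Fin n → Fin n → Prop}
    (hr : ∀ i j k, r i j → r j k → r i k) {x y : Mat n} (hx : x ∈ supported P r)
    (hy : y ∈ supported P r) : x * y ∈ supported P r := by
  intro i k hik
  have : (P : Mat n) * (x * y) * ((P⁻¹ : GL (Fin n) ℂ) : Mat n) =
      ((P : Mat n) * x * ((P⁻¹ : GL (Fin n) ℂ) : Mat n)) *
        ((P : Mat n) * y * ((P⁻¹ : GL (Fin n) ℂ) : Mat n)) := by
    simp only [mul_assoc, Units.inv_mul_cancel_left]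
  rw [this, mul_apply]
  refine Finset.sum_eq_zero fun j _ => ?_
  by_cases hij : r i j
  · rw [hy j k fun hjk => hik (hr i j k hij hjk), mul_zero]
  · rw [hx i j hij, zero_mul]

section
open scoped Matrix.Norms.Operator
attribute [local instance] ratNormedAlgebra

theorem exp_sub_one_mem {W : Submodule ℂ (Mat n)} (hW : ∀ x ∈ W, ∀ y ∈ W, x * y ∈ W) {x : Mat n}
    (hx : x ∈ W) : NormedSpace.exp x - 1 ∈ W := by
  have h1 := NormedSpace.exp_series_hasSum_exp' (𝕂 := ℂ) x
  rw [← hasSum_nat_add_iff' 1] at h1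
  simp only [Finset.range_one, Finset.sum_singleton, Nat.factorial_zero, Nat.cast_one, inv_one,
    pow_zero, one_smul] at h1
  have hpow : ∀ k : ℕ, x ^ (k + 1) ∈ W := fun k => by
    induction k with
    | zero => simpa using hx
    | succ k ih => rw [pow_succ]; exact hW _ ih _ hx
  have hc : IsClosed (W : Set (Mat n)) := W.closed_of_finiteDimensional
  exact hc.mem_of_tendsto h1 (Eventually.of_forall fun s =>
    W.sum_mem fun k _ => W.smul_mem _ (hpow k))

end

/-- Transitivity of `r` makes the supported matrices closed under products, so they contain `exp x -
1`. For a strict order this says that the exponential is unitriangular. -/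
theorem conj_exp_apply {P : GL (Fin n) ℂ} {r : Fin n → Fin n → Prop}
    (hr : ∀ i j k, r i j → r j k → r i k) {x : Mat n} (hx : x ∈ supported P r) (i j : Fin n)
    (hij : ¬ r i j) : ((P : Mat n) * (expU x : Mat n) * ((P⁻¹ : GL (Fin n) ℂ) : Mat n)) i j =
      (1 : Mat n) i j := by
  have := exp_sub_one_mem (fun x hx y hy => mul_mem_supported hr hx hy) hx i j hij
  rw [mul_sub, sub_mul, mul_one, Units.mul_inv, Matrix.sub_apply, sub_eq_zero] at this
  exact this

theorem commute_dg_ofReal_iff {P : GL (Fin n) ℂ} {β : Fin n → ℝ} {y : Mat n} :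
    Commute y (dg P fun i => (β i : ℂ)) ↔ y ∈ supported P fun i j => β i = β j := by
  rw [commute_dg_iff, mem_supported]
  simp only [ne_eq, Complex.ofReal_inj]

open Classical in
theorem schur_ite_mem_supported (P : GL (Fin n) ℂ) (r : Fin n → Fin n → Prop) (y : Mat n) :
    schur P (of fun i j => if r i j then (1 : ℂ) else 0) y ∈ supported P r := by
  intro i j hij
  rw [conj_schur, Matrix.hadamard_apply, of_apply, if_neg hij, zero_mul]

open Classical in
theorem schur_ite_mem {P : GL (Fin n) ℂ} {β : Fin n → ℝ} {W : Submodule ℂ (Mat n)}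
    (hW : ∀ y ∈ W, dg P (fun i => (β i : ℂ)) * y - y * dg P (fun i => (β i : ℂ)) ∈ W)
    {r : ℝ → ℝ → Prop} (p : ℝ → Prop) (hr : ∀ a b, p (a - b) ↔ r a b) {y : Mat n} (hy : y ∈ W) :
    schur P (of fun i j => if r (β i) (β j) then (1 : ℂ) else 0) y ∈ W := by
  have := schur_mem hW (fun z => if p z.re then 1 else 0) hy
  simpa only [Complex.sub_re, Complex.ofReal_re, hr] using this

open Classical in
theorem eq_add_schur (P : GL (Fin n) ℂ) (β : Fin n → ℝ) (y : Mat n) :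
    y = schur P (of fun i j => if β i < β j then (1 : ℂ) else 0) y +
        schur P (of fun i j => if β i = β j then (1 : ℂ) else 0) y +
        schur P (of fun i j => if β j < β i then (1 : ℂ) else 0) y := by
  apply conj_injective (P := P)
  rw [mul_add, add_mul, mul_add, add_mul, conj_schur, conj_schur, conj_schur]
  ext i j
  simp only [Matrix.hadamard_apply, of_apply, Matrix.add_apply]
  rcases lt_trichotomy (β i) (β j) with h | h | h
  · simp [h, h.ne, h.not_gt]
  · simp [h]
  · simp [h, h.ne', h.not_gt]

/-- Elements of a connected subset of `K` centralizing `λ` lie in every algebraic group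
containing the exponential of the centralizer of `λ` in the Lie algebra of `K`. -/
theorem mem_of_commute_dg {K E : Subgroup (GL (Fin n) ℂ)} (hK : IsAlgebraicSubgroup K)
    (hE : IsAlgebraicSubgroup E) {P : GL (Fin n) ℂ} {β : Fin n → ℝ}
    (hW : ∀ y ∈ lie K, dg P (fun i => (β i : ℂ)) * y - y * dg P (fun i => (β i : ℂ)) ∈ lie K)
    (hKE : ∀ x ∈ lie K, Commute x (dg P fun i => (β i : ℂ)) → expU x ∈ E)
    {C : Set (GL (Fin n) ℂ)} (hCK : C ⊆ K) (hC : IsPreconnected C) (h1 : 1 ∈ C)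
    {w : GL (Fin n) ℂ} (hw : w ∈ C) (hwc : Commute (w : Mat n) (dg P fun i => (β i : ℂ))) :
    w ∈ E := by
  classical
  set A := lie K ⊓ supported P fun i j => β i < β j
  set B := lie K ⊓ supported P fun i j => β i = β j
  set A' := lie K ⊓ supported P fun i j => β j < β i
  have hsup : lie K ≤ A ⊔ B ⊔ A' := by
    intro y hy
    rw [eq_add_schur P β y]
    exact Submodule.add_mem_sup (Submodule.add_mem_sup
      (Submodule.mem_inf.2 ⟨schur_ite_mem hW (fun t => t < 0) (fun _ _ => sub_neg) hy,
        schur_ite_mem_supported _ _ _⟩)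
      (Submodule.mem_inf.2 ⟨schur_ite_mem hW (fun t => t = 0) (fun _ _ => sub_eq_zero) hy,
        schur_ite_mem_supported _ _ _⟩))
      (Submodule.mem_inf.2 ⟨schur_ite_mem hW (fun t => 0 < t) (fun _ _ => sub_pos) hy,
        schur_ite_mem_supported _ _ _⟩)
  -- Near `1` every element of `K` is a product `exp a * exp b * exp c` from the negative, zero and
  -- positive weight parts: a block `LDU` factorization in the coordinates of `P`.
  have hreach := (((reaches_exp A).mul (reaches_exp B)).mul (reaches_exp A')).eventually_mem hK (by
    rintro _ ⟨_, ⟨_, ⟨a, ha, rfl⟩, _, ⟨b, hb, rfl⟩, rfl⟩, _, ⟨c, hc, rfl⟩, rfl⟩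
    exact K.mul_mem (K.mul_mem (expU_mem hK ha.1) (expU_mem hK hb.1)) (expU_mem hK hc.1)) hsup
  obtain ⟨S, hS, hES⟩ := isAlgebraicSubgroup_iff.1 hE
  rw [hES]
  intro F hF
  have hF' : IsPoly fun m : Mat n => F (((P⁻¹ : GL (Fin n) ℂ) : Mat n) * m * (P : Mat n)) :=
    (hS F hF).conj _ _
  obtain ⟨N, Q, hQ, hQF⟩ := IsPoly.exists_clear_denominators
    (IsPoly.prod Finset.univ fun k _ => IsPoly.minorAbove β k) (IsPoly.lduNumerator β) hF'
  have hback : ∀ m : Mat n, ((P⁻¹ : GL (Fin n) ℂ) : Mat n) *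
      ((P : Mat n) * m * ((P⁻¹ : GL (Fin n) ℂ) : Mat n)) * (P : Mat n) = m := fun m => by
    simp only [mul_assoc, Units.inv_mul_cancel_left, Units.inv_mul, mul_one]
  have hcomm : ∀ D : Mat n, Commute D (dg P fun i => (β i : ℂ)) → ∀ i j, β i ≠ β j →
      ((P : Mat n) * D * ((P⁻¹ : GL (Fin n) ℂ) : Mat n)) i j = 0 := fun D hD =>
    commute_dg_ofReal_iff.1 hD
  -- The equation `F` of `E`, evaluated at the factor `D` and cleared of denominators, is a
  -- polynomial in `g`. It vanishes near `1` because `exp b ∈ E`, hence on all of `C`.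
  have hzero := IsPoly.eq_zero_of_eventually hK
    (hQ.conj (P : Mat n) ((P⁻¹ : GL (Fin n) ℂ) : Mat n)) (by
      filter_upwards [hreach] with g hg hgK
      obtain ⟨_, ⟨_, ⟨a, ha, rfl⟩, _, ⟨b, hb, rfl⟩, rfl⟩, _, ⟨c, hc, rfl⟩, rfl⟩ := hg hgK
      have hbc := commute_dg_ofReal_iff.2 hb.2
      have hD := hcomm _ (Commute.exp_left hbc)
      have hldu := mul_prod_minorAbove (β := β)
        (conj_exp_apply (r := fun i j => β i < β j) (fun _ _ _ => lt_trans) ha.2)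
        (conj_exp_apply (r := fun i j => β j < β i) (fun _ _ _ h h' => lt_trans h' h) hc.2) hD
      have hprod : (P : Mat n) * ((expU a * expU b * expU c : GL (Fin n) ℂ) : Mat n) *
          ((P⁻¹ : GL (Fin n) ℂ) : Mat n) =
          (P : Mat n) * (expU a : Mat n) * ((P⁻¹ : GL (Fin n) ℂ) : Mat n) *
          ((P : Mat n) * NormedSpace.exp b * ((P⁻¹ : GL (Fin n) ℂ) : Mat n)) *
          ((P : Mat n) * (expU c : Mat n) * ((P⁻¹ : GL (Fin n) ℂ) : Mat n)) := by
        simp only [Units.val_mul, coe_expU, mul_assoc, Units.inv_mul_cancel_left]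
      simp only
      rw [hprod, hQF _ _ hldu, hback, ← coe_expU, (hES _).1 (hKE b hb.1 hbc) F hF, mul_zero])
    hCK hC h1 hw
  have hwD := hcomm _ hwc
  -- As `w` centralizes the weights, it is its own factor `D`; its minors are nonzero because it is
  -- invertible, so the cleared equation gives `F w = 0`.
  have hldu := mul_prod_minorAbove (L := 1) (U := 1) (fun _ _ _ => rfl) (fun _ _ _ => rfl) hwD
  rw [one_mul, mul_one] at hldu
  rw [hQF _ _ hldu] at hzero
  rw [hback] at hzero
  refine (mul_eq_zero.1 hzero).resolve_left (pow_ne_zero _ (Finset.prod_ne_zero_iff.2 fun k _ =>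
    minorAbove_ne_zero hwD (D' := (P : Mat n) * ((w⁻¹ : GL (Fin n) ℂ) : Mat n) *
      ((P⁻¹ : GL (Fin n) ℂ) : Mat n)) ?_ k))
  simp only [mul_assoc, Units.inv_mul_cancel_left, Units.mul_inv_cancel_left, Units.mul_inv]

/-! ### Consequences for maximal tori -/

/-- The real part of a generic element is a replica, hence still in `lie H`, and it still separates
the weights. Real weights are ordered, as the `LDU` argument requires. -/
theorem IsTorus.exists_real_generic {H : Subgroup (GL (Fin n) ℂ)} (hH : IsTorus H) :
    ∃ (P : GL (Fin n) ℂ) (β : Fin n → ℝ), dg P (fun i => (β i : ℂ)) ∈ lie H ∧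
      ∀ y, Commute y (dg P fun i => (β i : ℂ)) → ∀ t ∈ lie H, Commute y t := by
  obtain ⟨P, -, hP⟩ := hH.exists_dg
  obtain ⟨b, hb, hgen⟩ := exists_generic (P := P) (lie H)
  refine ⟨P, fun i => (b i).re, replica_mem_lie_of_dg hH.algebraic hb
    (Complex.ofRealHom.toAddMonoidHom.comp Complex.reAddGroupHom), fun y hy t ht => ?_⟩
  obtain ⟨e, rfl⟩ := hP t ht
  rw [commute_dg_iff]
  intro i j hij
  exact (commute_dg_ofReal_iff.1 hy) i j fun h => hij (hgen i j h e ht)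

/-- A maximal torus of a connected reductive group is its own centralizer. -/
theorem IsCartanSubgroup.mem_of_commute {G H : Subgroup (GL (Fin n) ℂ)}
    (hG : IsConnectedReductive G) (hH : IsCartanSubgroup G H) {g : GL (Fin n) ℂ} (hg : g ∈ G)
    (hc : ∀ t ∈ lie H, Commute (g : Mat n) t) : g ∈ H := by
  obtain ⟨P, β, hβ, hgen⟩ := hH.prop.1.exists_real_generic
  refine mem_of_commute_dg hG.algebraic hH.prop.1.algebraic (P := P) (β := β) (fun y hy =>
    bracket_mem hG.algebraic (lie_mono hH.prop.2 hβ)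
      (fun g hg y hy => conj_mem_lie hG.algebraic hy hg) hy) (fun x hx hxc => ?_)
    subset_rfl hG.connected.isPreconnected G.one_mem hg (hc _ hβ)
  exact expU_mem hH.prop.1.algebraic (hH.mem_lie_of_forall_commute hG hx (hgen x hxc))

/-! ### The derived group -/

/-- The elements joined to `1` by a connected subset of the derived group are closed under products
and inverses, and they contain each commutator `[g, h]`, which lies on the image of `G` under `k ↦
[k, h]`. -/
theorem isPreconnected_commutator {G : Subgroup (GL (Fin n) ℂ)}
    (hG : IsPreconnected (G : Set (GL (Fin n) ℂ))) :
    IsPreconnected ((⁅G, G⁆ : Subgroup (GL (Fin n) ℂ)) : Set (GL (Fin n) ℂ)) := by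
  refine isPreconnected_of_forall 1 fun x hx => ?_
  rw [SetLike.mem_coe, Subgroup.commutator_def] at hx
  induction hx using Subgroup.closure_induction with
  | mem x hx =>
    obtain ⟨g, hg, h, hh, rfl⟩ := hx
    refine ⟨(fun g => g * h * g⁻¹ * h⁻¹) '' (G : Set (GL (Fin n) ℂ)), ?_, ⟨1, G.one_mem, by simp⟩,
      ⟨g, hg, rfl⟩, hG.image _ ?_⟩
    · rintro _ ⟨k, hk, rfl⟩
      exact Subgroup.commutator_mem_commutator hk hh
    · fun_prop
  | one => exact ⟨{1}, by simp, rfl, rfl, isPreconnected_singleton⟩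
  | mul x y _ _ hx hy =>
    obtain ⟨s, hs, h1s, hxs, hsc⟩ := hx
    obtain ⟨t, ht, h1t, hyt, htc⟩ := hy
    refine ⟨s * t, ?_, ⟨1, h1s, 1, h1t, mul_one 1⟩, ⟨x, hxs, y, hyt, rfl⟩, ?_⟩
    · rintro _ ⟨a, ha, b, hb, rfl⟩
      exact Subgroup.mul_mem _ (hs ha) (ht hb)
    · rw [← Set.image_mul_prod]
      exact (hsc.prod htc).image _ continuous_mul.continuousOn
  | inv x _ hx =>
    obtain ⟨s, hs, h1s, hxs, hsc⟩ := hx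
    refine ⟨s⁻¹, fun y hy => ?_, by simpa using h1s, by simpa using hxs, ?_⟩
    · simpa using Subgroup.inv_mem _ (hs hy)
    · rw [← Set.image_inv_eq_inv]
      exact hsc.image _ continuous_inv.continuousOn

/-! ### An algebraic substitute for the derived group. -/

theorem det_mul_add_one_sub {g h π : Mat n} (hπ : π * π = π) (hh : Commute h π) :
    (g * h * π + (1 - π)).det = (g * π + (1 - π)).det * (h * π + (1 - π)).det := by
  rw [← det_mul]
  congr 1
  have h1 : g * π * (h * π) = g * h * π := by
    rw [mul_assoc g, ← mul_assoc π, ← hh.eq, mul_assoc h, hπ, mul_assoc]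
  have h2 : (1 - π) * (h * π) = 0 := by
    rw [sub_mul, one_mul, ← mul_assoc, ← hh.eq, mul_assoc, hπ, sub_self]
  have h3 : (1 - π) * (1 - π) = 1 - π := by
    rw [sub_mul, one_mul, mul_sub, hπ, mul_one, sub_self, sub_zero]
  have h4 : g * π * (1 - π) = 0 := by
    rw [mul_sub, mul_one, mul_assoc, hπ, sub_self]
  rw [add_mul, mul_add, mul_add, h1, h2, h3, h4]
  abel

/-- The elements of `G` acting with determinant one on the image of every idempotent that
commutes with `G`. -/
def isotypicSL (G : Subgroup (GL (Fin n) ℂ)) : Subgroup (GL (Fin n) ℂ) where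
  carrier := {g | g ∈ G ∧ ∀ π : Mat n, π * π = π → (∀ k ∈ G, Commute (k : Mat n) π) →
    ((g : Mat n) * π + (1 - π)).det = 1}
  mul_mem' {a b} ha hb := ⟨G.mul_mem ha.1 hb.1, fun π h1 h2 => by
    rw [Units.val_mul, det_mul_add_one_sub h1 (h2 b hb.1), ha.2 π h1 h2, hb.2 π h1 h2, one_mul]⟩
  one_mem' := ⟨G.one_mem, fun π _ _ => by simp⟩
  inv_mem' {a} ha := ⟨G.inv_mem ha.1, fun π h1 h2 => by
    have := det_mul_add_one_sub (g := ((a⁻¹ : GL (Fin n) ℂ) : Mat n)) h1 (h2 a ha.1)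
    rw [ha.2 π h1 h2, mul_one, Units.inv_mul, one_mul, add_sub_cancel, det_one] at this
    exact this.symm⟩

theorem mem_isotypicSL {G : Subgroup (GL (Fin n) ℂ)} {g : GL (Fin n) ℂ} :
    g ∈ isotypicSL G ↔ g ∈ G ∧ ∀ π : Mat n, π * π = π → (∀ k ∈ G, Commute (k : Mat n) π) →
      ((g : Mat n) * π + (1 - π)).det = 1 := Iff.rfl

theorem isotypicSL_le (G : Subgroup (GL (Fin n) ℂ)) : isotypicSL G ≤ G := fun _ hg => hg.1

theorem IsAlgebraicSubgroup.isotypicSL {G : Subgroup (GL (Fin n) ℂ)} (hG : IsAlgebraicSubgroup G) :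
    IsAlgebraicSubgroup (isotypicSL G) := by
  obtain ⟨S, hS, hGS⟩ := isAlgebraicSubgroup_iff.1 hG
  refine isAlgebraicSubgroup_iff.2 ⟨S ∪ {F | ∃ π : Mat n, π * π = π ∧
    (∀ k ∈ G, Commute (k : Mat n) π) ∧ F = fun m => (m * π + (1 - π)).det - 1}, ?_, fun g => ?_⟩
  · rintro F (hF | ⟨π, -, -, rfl⟩)
    · exact hS F hF
    · refine (IsPoly.det fun i j => ?_).sub (IsPoly.const 1)
      exact (IsPoly.mul_mat IsPoly.coord (fun i j => IsPoly.const (π i j)) i j).add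
        (IsPoly.const ((1 - π) i j))
  · rw [mem_isotypicSL, hGS]
    constructor
    · rintro ⟨h1, h2⟩ F (hF | ⟨π, hπ, hc, rfl⟩)
      · exact h1 F hF
      · exact sub_eq_zero.2 (h2 π hπ hc)
    · exact fun h => ⟨fun F hF => h F (Or.inl hF), fun π h1 h2 =>
        sub_eq_zero.1 (h _ (Or.inr ⟨π, h1, h2, rfl⟩))⟩

theorem det_conj_mul_add_one_sub {G : Subgroup (GL (Fin n) ℂ)} {g h : GL (Fin n) ℂ} (hg : g ∈ G)
    (hh : h ∈ G) {π : Mat n} (hπ : π * π = π) (hc : ∀ k ∈ G, Commute (k : Mat n) π) :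
    (((g * h * g⁻¹ : GL (Fin n) ℂ) : Mat n) * π + (1 - π)).det =
      ((h : Mat n) * π + (1 - π)).det := by
  have h1 := det_mul_add_one_sub (g := (g : Mat n)) hπ (hc _ (G.inv_mem hg))
  rw [Units.mul_inv, one_mul, add_sub_cancel, det_one] at h1
  rw [Units.val_mul, det_mul_add_one_sub hπ (hc _ (G.inv_mem hg)), Units.val_mul,
    det_mul_add_one_sub hπ (hc _ hh), mul_comm (det _) (((h : Mat n) * π + (1 - π)).det),
    mul_assoc, ← h1, mul_one]

theorem conj_mem_isotypicSL {G : Subgroup (GL (Fin n) ℂ)} {g h : GL (Fin n) ℂ} (hg : g ∈ G)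
    (hh : h ∈ isotypicSL G) : g * h * g⁻¹ ∈ isotypicSL G :=
  ⟨G.mul_mem (G.mul_mem hg hh.1) (G.inv_mem hg), fun π hπ hc => by
    rw [det_conj_mul_add_one_sub hg hh.1 hπ hc, hh.2 π hπ hc]⟩

/-- The determinant on the image of an idempotent commuting with `G` is a character of `G`, so it is
trivial on commutators. -/
theorem commutator_le_isotypicSL (G : Subgroup (GL (Fin n) ℂ)) : ⁅G, G⁆ ≤ isotypicSL G := by
  refine Subgroup.commutator_le.2 fun g hg h hh => ?_
  rw [commutatorElement_def]
  refine ⟨G.mul_mem (G.mul_mem (G.mul_mem hg hh) (G.inv_mem hg)) (G.inv_mem hh),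
    fun π hπ hc => ?_⟩
  rw [Units.val_mul, det_mul_add_one_sub hπ (hc _ (G.inv_mem hh)),
    det_conj_mul_add_one_sub hg hh hπ hc, ← det_mul_add_one_sub hπ (hc _ (G.inv_mem hh)),
    Units.mul_inv, one_mul, add_sub_cancel, det_one]

theorem commutator_self_le (G : Subgroup (GL (Fin n) ℂ)) : ⁅G, G⁆ ≤ G :=
  (commutator_le_isotypicSL G).trans (isotypicSL_le G)

theorem conj_mem_lie_isotypicSL {G : Subgroup (GL (Fin n) ℂ)} (hG : IsAlgebraicSubgroup G)
    {g : GL (Fin n) ℂ} (hg : g ∈ G) {x : Mat n} (hx : x ∈ lie (isotypicSL G)) :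
    (g : Mat n) * x * (g⁻¹ : GL (Fin n) ℂ) ∈ lie (isotypicSL G) := by
  rw [mem_lie hG.isotypicSL] at hx ⊢
  intro t
  rw [← smul_mul_assoc, ← mul_smul_comm, expU_conj]
  exact conj_mem_isotypicSL hg (hx t)

theorem IsTorus.isDiagonalizable_inf {H K : Subgroup (GL (Fin n) ℂ)} (hH : IsTorus H) :
    IsDiagonalizable (H ⊓ K) := by
  obtain ⟨P, hP⟩ := hH.diagonalizable
  exact ⟨P, fun g hg => hP g hg.1⟩

/-- Elements of the derived group in a maximal torus are exponentials. -/
theorem IsCartanSubgroup.exists_exp_of_mem_commutator {G H : Subgroup (GL (Fin n) ℂ)}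
    (hG : IsConnectedReductive G) (hH : IsCartanSubgroup G H) {g : GL (Fin n) ℂ} (hg : g ∈ H)
    (hgd : g ∈ ⁅G, G⁆) : ∃ x ∈ lie (H ⊓ isotypicSL G), expU x = g := by
  have hHT := hH.prop.1
  have hK := hG.algebraic.isotypicSL
  obtain ⟨T, hT, hTexp⟩ := exists_isTorus_exp_lie (hHT.algebraic.inf hK)
    (hHT.isDiagonalizable_inf (K := isotypicSL G))
  obtain ⟨P, β, hβ, hgen⟩ := hHT.exists_real_generic
  have hbr : ∀ x ∈ lie H, ∀ y ∈ lie (isotypicSL G), x * y - y * x ∈ lie (isotypicSL G) :=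
    fun x hx y hy => bracket_mem hG.algebraic (lie_mono hH.prop.2 hx)
      (fun g hg y hy => conj_mem_lie_isotypicSL hG.algebraic hg hy) hy
  -- The derived group serves as the connected subset of the algebraic group `isotypicSL G`; an
  -- element of `H` commutes with the chosen regular element of `lie H`.
  have := mem_of_commute_dg hK hT.algebraic (hbr _ hβ) (fun x hx hxc => ?_)
    (commutator_le_isotypicSL G) (isPreconnected_commutator hG.connected.isPreconnected)
    (Subgroup.one_mem _) hgd ?_
  · rwa [← SetLike.mem_coe, hTexp] at this
  · rw [← SetLike.mem_coe, hTexp]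
    refine ⟨x, ?_, rfl⟩
    rw [lie_inf hHT.algebraic hK]
    exact ⟨hH.mem_lie_of_forall_commute hG (lie_mono (isotypicSL_le G) hx) (hgen x hxc), hx⟩
  · obtain ⟨Q, hQ, hQl⟩ := hHT.exists_dg
    obtain ⟨d, hd⟩ := hQ g hg
    obtain ⟨e, he⟩ := hQl _ hβ
    rw [hd, he]
    exact commute_dg Q d e

/-! ### The center -/

theorem mem_centerOf {K : Subgroup (GL (Fin n) ℂ)} {g : GL (Fin n) ℂ} :
    g ∈ centerOf K ↔ g ∈ K ∧ ∀ k ∈ K, k * g = g * k := by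
  rw [centerOf, Subgroup.mem_map]
  constructor
  · rintro ⟨⟨x, hx⟩, hc, rfl⟩
    rw [Subgroup.mem_center_iff] at hc
    exact ⟨hx, fun k hk => congrArg Subtype.val (hc ⟨k, hk⟩)⟩
  · rintro ⟨hg, hc⟩
    exact ⟨⟨g, hg⟩, Subgroup.mem_center_iff.2 fun k => Subtype.ext (hc k k.2), rfl⟩

theorem commute_of_forall_expU {x y : Mat n}
    (h : ∀ t : ℝ, Commute (expU ((t : ℂ) • x) : Mat n) y) : Commute x y := by
  have := mem_of_exp_mem (m := 1) (x := x)
    (W := LinearMap.ker (LinearMap.mulRight ℂ y - LinearMap.mulLeft ℂ y)) fun t => by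
      rw [LinearMap.mem_ker, LinearMap.sub_apply, LinearMap.mulRight_apply,
        LinearMap.mulLeft_apply, sub_eq_zero, one_mul]
      exact (h t).sub_left (Commute.one_left y)
  rw [LinearMap.mem_ker, LinearMap.sub_apply, LinearMap.mulRight_apply,
    LinearMap.mulLeft_apply, sub_eq_zero, one_mul] at this
  exact this

theorem commute_of_mem_lie {K : Subgroup (GL (Fin n) ℂ)} (hK : IsAlgebraicSubgroup K) {x y : Mat n}
    (hx : x ∈ lie K) (h : ∀ g ∈ K, Commute (g : Mat n) y) : Commute x y :=
  commute_of_forall_expU fun t => h _ ((mem_lie hK).1 hx t)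

/-- The elements of the Lie algebra of `G` fixed by `G`. -/
noncomputable def centralLie (G : Subgroup (GL (Fin n) ℂ)) : Submodule ℂ (Mat n) where
  carrier := {w | w ∈ lie G ∧ ∀ g ∈ G, Commute (g : Mat n) w}
  add_mem' ha hb := ⟨(lie G).add_mem ha.1 hb.1, fun g hg => (ha.2 g hg).add_right (hb.2 g hg)⟩
  zero_mem' := ⟨(lie G).zero_mem, fun _ _ => Commute.zero_right _⟩
  smul_mem' c _ ha := ⟨(lie G).smul_mem c ha.1, fun g hg => (ha.2 g hg).smul_right c⟩

theorem commute_expU {m w : Mat n} (h : Commute m w) : Commute m (expU w : Mat n) :=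
  Commute.exp_right h

theorem IsCartanSubgroup.centralLie_le {G H : Subgroup (GL (Fin n) ℂ)}
    (hG : IsConnectedReductive G) (hH : IsCartanSubgroup G H) : centralLie G ≤ lie H :=
  fun _ hw => hH.mem_lie_of_forall_commute hG hw.1 fun _ ht =>
    (commute_of_mem_lie hG.algebraic (lie_mono hH.prop.2 ht) hw.2).symm

theorem isAlgebraicSubgroup_centralizer (S : Set (GL (Fin n) ℂ)) :
    IsAlgebraicSubgroup (Subgroup.centralizer S) := by
  refine isAlgebraicSubgroup_iff.2 ⟨{F | ∃ k ∈ S, ∃ i j, F = fun m =>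
    ((k : Mat n) * m) i j - (m * (k : Mat n)) i j}, ?_, fun g => ?_⟩
  · rintro _ ⟨k, -, i, j, rfl⟩
    exact (IsPoly.mul_mat (fun i j => IsPoly.const ((k : Mat n) i j)) IsPoly.coord i j).sub
      (IsPoly.mul_mat IsPoly.coord (fun i j => IsPoly.const ((k : Mat n) i j)) i j)
  · rw [Subgroup.mem_centralizer_iff]
    constructor
    · rintro h _ ⟨k, hk, i, j, rfl⟩
      simp only
      rw [← Units.val_mul, h k hk, Units.val_mul, sub_self]
    · intro h k hk
      refine Units.ext ?_
      ext i j
      rw [Units.val_mul, Units.val_mul]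
      exact sub_eq_zero.1 (h _ ⟨k, hk, i, j, rfl⟩)

/-- The complex line through `w` exponentiates into the diagonalizable algebraic group of elements
of `H` centralizing `G`. The exponentials of its Lie algebra form a central torus. -/
theorem expU_mem_radical {G H : Subgroup (GL (Fin n) ℂ)} (hG : IsConnectedReductive G)
    (hH : IsCartanSubgroup G H) {w : Mat n} (hw : w ∈ centralLie G) : expU w ∈ radical G := by
  have hHT := hH.prop.1
  have hK := hHT.algebraic.inf (isAlgebraicSubgroup_centralizer (G : Set (GL (Fin n) ℂ)))
  obtain ⟨T, hT, hTexp⟩ := exists_isTorus_exp_lie hK hHT.isDiagonalizable_inf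
  have hTZ : T ≤ centerOf G := by
    intro g hg
    rw [← SetLike.mem_coe, hTexp] at hg
    obtain ⟨x, hx, rfl⟩ := hg
    have := expU_mem hK hx
    exact mem_centerOf.2 ⟨hH.prop.2 this.1, Subgroup.mem_centralizer_iff.1 this.2⟩
  refine (le_sSup (show T ∈ {T | IsTorus T ∧ T ≤ centerOf G} from ⟨hT, hTZ⟩) : T ≤ radical G) ?_
  rw [← SetLike.mem_coe, hTexp]
  refine ⟨w, ?_, rfl⟩
  rw [SetLike.mem_coe, mem_lie hK]
  intro t
  have htw := (centralLie G).smul_mem t hw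
  refine ⟨expU_mem hHT.algebraic (hH.centralLie_le hG htw), ?_⟩
  exact Subgroup.mem_centralizer_iff.2 fun k hk => Units.ext (commute_expU (htw.2 k hk))

theorem radical_le_centerOf (G : Subgroup (GL (Fin n) ℂ)) : radical G ≤ centerOf G :=
  sSup_le fun _ hT => hT.2

theorem IsCartanSubgroup.centerOf_le {G H : Subgroup (GL (Fin n) ℂ)}
    (hG : IsConnectedReductive G) (hH : IsCartanSubgroup G H) : centerOf G ≤ H := fun g hg => by
  rw [mem_centerOf] at hg
  refine hH.mem_of_commute hG hg.1 fun t ht => ?_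
  refine (commute_of_mem_lie hG.algebraic (lie_mono hH.prop.2 ht) fun k hk => ?_).symm
  have := congrArg (fun u : GL (Fin n) ℂ => (u : Mat n)) (hg.2 k hk)
  exact this

/-! ### A reductive group is generated by its derived group and its central torus -/

/-- A functional vanishing on the right side is `y ↦ tr(xy)` on `lie G`, by nondegeneracy. Vanishing
on all `k y k⁻¹ - y` makes `x` fixed by `G`; the replicas of `x` are then fixed too, and
orthogonality to them forces `x = 0`. -/
theorem IsConnectedReductive.lie_le {G H : Subgroup (GL (Fin n) ℂ)} (hG : IsConnectedReductive G)
    (hH : IsCartanSubgroup G H) :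
    lie G ≤ Submodule.span ℂ {v | ∃ k ∈ G, ∃ y ∈ lie G,
      v = (k : Mat n) * y * ((k⁻¹ : GL (Fin n) ℂ) : Mat n) - y} ⊔ centralLie G := by
  intro y₀ hy₀
  by_contra hnot
  obtain ⟨f, hf0, hf⟩ := Submodule.exists_le_ker_of_notMem hnot
  let B : lie G →ₗ[ℂ] Module.Dual ℂ (lie G) :=
    LinearMap.mk₂ ℂ (fun x y => ((x : Mat n) * (y : Mat n)).trace)
      (fun x x' y => by simp [add_mul]) (fun c x y => by simp)
      (fun x y y' => by simp [mul_add]) (fun c x y => by simp)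
  have hB : ∀ x y, B x y = ((x : Mat n) * (y : Mat n)).trace := fun _ _ => rfl
  have hinj : Function.Injective B := by
    rw [← LinearMap.ker_eq_bot, LinearMap.ker_eq_bot']
    intro x hx
    exact Subtype.ext (hG.eq_zero_of_trace x.2 fun y hy => LinearMap.congr_fun hx ⟨y, hy⟩)
  obtain ⟨⟨x, hx⟩, hxf⟩ := (LinearMap.injective_iff_surjective_of_finrank_eq_finrank
    Subspace.dual_finrank_eq.symm).1 hinj (f ∘ₗ (lie G).subtype)
  have hxf' : ∀ y ∈ lie G, f y = (x * y).trace := fun y hy =>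
    (LinearMap.congr_fun hxf ⟨y, hy⟩).symm
  have hconj : ∀ g ∈ G, (g : Mat n) * x * ((g⁻¹ : GL (Fin n) ℂ) : Mat n) = x := by
    intro g hg
    rw [← sub_eq_zero]
    refine hG.eq_zero_of_trace ((lie G).sub_mem (conj_mem_lie hG.algebraic hx hg) hx)
      fun y hy => ?_
    have h1 : f (((g⁻¹ : GL (Fin n) ℂ) : Mat n) * y * (((g⁻¹)⁻¹ : GL (Fin n) ℂ) : Mat n) - y) = 0 :=
      hf (Submodule.mem_sup_left (Submodule.subset_span ⟨g⁻¹, G.inv_mem hg, y, hy, rfl⟩))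
    rw [map_sub, hxf' _ (conj_mem_lie hG.algebraic hy (G.inv_mem hg)), hxf' y hy, inv_inv,
      ← mul_assoc, Matrix.trace_mul_comm, ← mul_assoc, ← mul_assoc] at h1
    rw [sub_mul, trace_sub, h1]
  have hxz : x ∈ centralLie G := ⟨hx, fun g hg => by
    have := congrArg (fun m : Mat n => m * (g : Mat n)) (hconj g hg)
    simp only [mul_assoc, Units.inv_mul, mul_one] at this
    exact this⟩
  obtain ⟨P, -, hP⟩ := hH.prop.1.exists_dg
  obtain ⟨d, rfl⟩ := hP x (hH.centralLie_le hG hxz)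
  have hd : d = 0 := by
    refine eq_zero_of_forall_sum_mul fun φ => ?_
    have hφ : dg P (φ ∘ d) ∈ centralLie G := ⟨replica_mem_lie_of_dg hG.algebraic hx φ, fun g hg =>
      commute_dg_comp (hxz.2 g hg) φ⟩
    have h1 : f (dg P (φ ∘ d)) = 0 := hf (Submodule.mem_sup_right hφ)
    rw [hxf' _ hφ.1, ← map_mul, trace_dg] at h1
    exact h1
  exact hf0 (by rw [hxf' y₀ hy₀, hd, map_zero, zero_mul, trace_zero])

theorem reaches_span {Q : Subgroup (GL (Fin n) ℂ)} {S : Set (Mat n)}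
    (h : ∀ v ∈ S, Reaches (Q : Set (GL (Fin n) ℂ)) (Submodule.span ℂ {v})) :
    Reaches (Q : Set (GL (Fin n) ℂ)) (Submodule.span ℂ S) := by
  classical
  obtain ⟨s, hs, hspan⟩ := (Submodule.fg_span_iff_fg_span_finset_subset S).1
    (IsNoetherian.noetherian (Submodule.span ℂ S))
  rw [hspan]
  clear hspan
  induction s using Finset.induction_on with
  | empty =>
    rw [Finset.coe_empty, Submodule.span_empty]
    refine (reaches_exp ⊥).mono ?_
    rintro _ ⟨x, hx, rfl⟩
    rw [SetLike.mem_coe, Submodule.mem_bot] at hx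
    rw [hx, expU_zero]
    exact Q.one_mem
  | insert a s _ ih =>
    rw [Finset.coe_insert] at hs ⊢
    rw [Submodule.span_insert]
    exact (h a (hs (Set.mem_insert _ _))).sup (ih fun x hx => hs (Set.mem_insert_of_mem _ hx))

/-- These products form a subgroup whose tangent directions fill `lie G`: commutators supply `k y
k⁻¹ - y` and the exponentials supply the central part. It contains a neighbourhood of `1` in the
connected group `G`. -/
theorem IsConnectedReductive.exists_mul_exp {G H : Subgroup (GL (Fin n) ℂ)}
    (hG : IsConnectedReductive G) (hH : IsCartanSubgroup G H) {g : GL (Fin n) ℂ} (hg : g ∈ G) :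
    ∃ d ∈ ⁅G, G⁆, ∃ w ∈ centralLie G, g = d * expU w := by
  have hzz : ∀ w ∈ centralLie G, ∀ w' ∈ centralLie G, Commute w w' := fun w hw w' hw' =>
    commute_of_mem_lie hG.algebraic hw.1 hw'.2
  have hzG : ∀ w ∈ centralLie G, ∀ k ∈ G, expU w * k = k * expU w := fun w hw k hk =>
    Units.ext (commute_expU (hw.2 k hk)).symm
  have hd : ∀ d ∈ ⁅G, G⁆, d ∈ G := fun d hd => commutator_self_le G hd
  let Q : Subgroup (GL (Fin n) ℂ) :=
    { carrier := {g | ∃ d ∈ ⁅G, G⁆, ∃ w ∈ centralLie G, g = d * expU w}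
      mul_mem' := by
        rintro _ _ ⟨d, hdd, w, hw, rfl⟩ ⟨d', hdd', w', hw', rfl⟩
        refine ⟨d * d', Subgroup.mul_mem _ hdd hdd', w + w', Submodule.add_mem _ hw hw', ?_⟩
        rw [expU_add (hzz w hw w' hw'), mul_assoc, ← mul_assoc (expU w), hzG w hw d' (hd _ hdd')]
        simp only [mul_assoc]
      one_mem' := ⟨1, Subgroup.one_mem _, 0, Submodule.zero_mem _, by simp⟩
      inv_mem' := by
        rintro _ ⟨d, hdd, w, hw, rfl⟩
        refine ⟨d⁻¹, Subgroup.inv_mem _ hdd, -w, Submodule.neg_mem _ hw, ?_⟩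
        rw [_root_.mul_inv_rev, ← expU_neg, hzG _ (Submodule.neg_mem _ hw) _ (G.inv_mem (hd _ hdd))] }
  have hQ : ∀ g, g ∈ Q ↔ ∃ d ∈ ⁅G, G⁆, ∃ w ∈ centralLie G, g = d * expU w := fun _ => Iff.rfl
  have hQG : Q ≤ G := by
    rintro _ ⟨d, hdd, w, hw, rfl⟩
    exact G.mul_mem (hd _ hdd) (expU_mem hG.algebraic hw.1)
  have h1 : Reaches (Q : Set (GL (Fin n) ℂ)) (centralLie G) := by
    refine (reaches_exp _).mono ?_
    rintro _ ⟨w, hw, rfl⟩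
    exact ⟨1, Subgroup.one_mem _, w, hw, (one_mul _).symm⟩
  have h2 : Reaches (Q : Set (GL (Fin n) ℂ)) (Submodule.span ℂ {v | ∃ k ∈ G, ∃ y ∈ lie G,
      v = (k : Mat n) * y * ((k⁻¹ : GL (Fin n) ℂ) : Mat n) - y}) := by
    refine reaches_span ?_
    rintro _ ⟨k, hk, y, hy, rfl⟩
    refine (reaches_commutator k y).mono ?_
    rintro _ ⟨t, rfl⟩
    refine ⟨_, ?_, 0, Submodule.zero_mem _, by rw [expU_zero, mul_one]⟩
    exact Subgroup.commutator_mem_commutator hk ((mem_lie hG.algebraic).1 hy t)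
  exact subset_of_eventually_mem ((h2.sup h1).eventually_mem hG.algebraic hQG (hG.lie_le hH))
    subset_rfl hG.connected.isPreconnected G.one_mem hg

/-- The eigenprojections of the central element `f` commute with `G`. Determinant one on each says
that an eigenvalue raised to its multiplicity is `1`, and a multiplicity, being at most `n`, divides
`n!`. -/
theorem IsTorus.pow_factorial_eq_one {G H : Subgroup (GL (Fin n) ℂ)} (hH : IsTorus H)
    {f : GL (Fin n) ℂ} (hfH : f ∈ H) (hfZ : f ∈ centerOf G) (hf : f ∈ isotypicSL G) :
    f ^ n.factorial = 1 := by
  classical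
  obtain ⟨P, hP, -⟩ := hH.exists_dg
  obtain ⟨c, hc⟩ := hP f hfH
  have hcomm : ∀ k ∈ G, Commute (k : Mat n) (dg P c) := fun k hk => by
    rw [← hc]
    exact congrArg (fun u : GL (Fin n) ℂ => (u : Mat n)) ((mem_centerOf.1 hfZ).2 k hk)
  have hpow : c ^ n.factorial = 1 := by
    ext j
    let e : Fin n → ℂ := (fun z => if z = c j then 1 else 0) ∘ c
    have he : e * e = e := by
      ext i
      simp only [e, Pi.mul_apply, Function.comp_apply]
      split_ifs <;> simp
    have h1 := hf.2 (dg P e) (by rw [← map_mul, he]) fun k hk => commute_dg_comp (hcomm k hk) _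
    rw [hc, ← map_mul, ← map_one (dg P), ← map_sub, ← map_add, det_dg] at h1
    have h2 : ∀ i, (c * e + (1 - e)) i = if c i = c j then c j else 1 := fun i => by
      simp only [e, Pi.add_apply, Pi.mul_apply, Pi.sub_apply, Pi.one_apply, Function.comp_apply]
      split_ifs with h
      · simp [h]
      · simp
    simp only [h2] at h1
    rw [Finset.prod_ite, Finset.prod_const, Finset.prod_const_one, mul_one] at h1
    have hpos : 0 < (Finset.univ.filter fun i => c i = c j).card :=
      Finset.card_pos.2 ⟨j, by simp⟩
    have hle : (Finset.univ.filter fun i => c i = c j).card ≤ n := by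
      simpa using Finset.card_le_univ (Finset.univ.filter fun i => c i = c j)
    obtain ⟨q, hq⟩ := Nat.dvd_factorial hpos hle
    rw [Pi.pow_apply, hq, pow_mul, h1, one_pow, Pi.one_apply]
  refine Units.ext ?_
  rw [Units.val_pow_eq_pow_val, hc, ← map_pow, hpow, map_one, Units.val_one]

/-- Write `exp(x / n!) = d * exp w`. The factor `exp w` is central and in `isotypicSL G`, so its
power `n!` is trivial and `exp x = d ^ n!`. -/
theorem IsCartanSubgroup.expU_mem_commutator {G H : Subgroup (GL (Fin n) ℂ)}
    (hG : IsConnectedReductive G) (hH : IsCartanSubgroup G H) {x : Mat n}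
    (hx : x ∈ lie (H ⊓ isotypicSL G)) : expU x ∈ ⁅G, G⁆ := by
  have hHT := hH.prop.1
  have hK := hHT.algebraic.inf hG.algebraic.isotypicSL
  have hN : (n.factorial : ℂ) ≠ 0 := Nat.cast_ne_zero.2 n.factorial_ne_zero
  set y := (n.factorial : ℂ)⁻¹ • x
  have hyK := expU_mem hK ((lie _).smul_mem (n.factorial : ℂ)⁻¹ hx)
  obtain ⟨d, hd, w, hw, h⟩ := hG.exists_mul_exp hH (hH.prop.2 hyK.1)
  have hxy : expU x = expU y ^ n.factorial := by
    rw [← expU_nsmul, ← Nat.cast_smul_eq_nsmul ℂ, smul_smul, mul_inv_cancel₀ hN, one_smul]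
  have hcomm : Commute d (expU w) := Units.ext (commute_expU (hw.2 d (commutator_self_le G hd)))
  have hw1 : expU w ^ n.factorial = 1 := by
    have hwr := radical_le_centerOf G (expU_mem_radical hG hH hw)
    refine hHT.pow_factorial_eq_one (hH.centerOf_le hG hwr) hwr ?_
    have : expU w = d⁻¹ * expU y := by rw [h, inv_mul_cancel_left]
    rw [this]
    exact Subgroup.mul_mem _ (Subgroup.inv_mem _ (commutator_le_isotypicSL G hd)) hyK.2
  rw [hxy, h, hcomm.mul_pow, hw1, mul_one]
  exact Subgroup.pow_mem _ hd _

/-! ### Real forms -/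

section
open scoped Matrix.Norms.Operator
attribute [local instance] ratNormedAlgebra

/-- Multiplicativity propagates differentiability from `0` to every point, and then `δ t * exp(-tu)`
has zero derivative. -/
theorem eq_exp_of_hasDerivAt {δ : ℂ → Mat n} {u : Mat n} (hmul : ∀ s t, δ (s + t) = δ s * δ t)
    (h0 : δ 0 = 1) (hu : HasDerivAt δ u 0) (t : ℂ) : δ t = NormedSpace.exp (t • u) := by
  have hδ : ∀ t, HasDerivAt δ (δ t * u) t := fun t => by
    have h1 : HasDerivAt (fun s => δ t * δ (s - t)) (δ t * u) t :=
      (HasDerivAt.comp_sub_const (f := δ) t t (by rwa [sub_self])).const_mul (δ t)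
    exact h1.congr_of_eventuallyEq (Eventually.of_forall fun s => by
      simp only
      rw [← hmul, add_sub_cancel])
  have he : ∀ t : ℂ, HasDerivAt (fun t : ℂ => NormedSpace.exp (t • -u))
      (-u * NormedSpace.exp (t • -u)) t := fun t => hasDerivAt_exp_smul_const' (-u) t
  have hconst : ∀ t, δ t * NormedSpace.exp (t • -u) = δ 0 * NormedSpace.exp ((0 : ℂ) • -u) :=
    fun t => is_const_of_deriv_eq_zero (f := fun t => δ t * NormedSpace.exp (t • -u))
      (fun t => ((hδ t).mul (he t)).differentiableAt) (fun t => by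
        refine ((hδ t).mul (he t)).deriv.trans ?_
        noncomm_ring) t 0
  have h1 := hconst t
  rw [h0, zero_smul, NormedSpace.exp_zero, mul_one] at h1
  have h2 : NormedSpace.exp (t • -u) * NormedSpace.exp (t • u) = 1 := by
    rw [smul_neg, ← coe_expU, ← coe_expU, expU_neg, Units.inv_mul]
  calc δ t = δ t * NormedSpace.exp (t • -u) * NormedSpace.exp (t • u) := by
        rw [mul_assoc, h2, mul_one]
    _ = _ := by rw [h1, one_mul]

theorem hasDerivAt_of_entries {δ : ℂ → Mat n} {t : ℂ}
    (h : ∀ i j, DifferentiableAt ℂ (fun s => δ s i j) t) : ∃ u, HasDerivAt δ u t := by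
  have h1 : DifferentiableAt ℂ (fun s => (fun i j => δ s i j : Fin n → Fin n → ℂ)) t :=
    differentiableAt_pi.2 fun i => differentiableAt_pi.2 fun j => h i j
  let L : (Fin n → Fin n → ℂ) →L[ℂ] Mat n :=
    LinearMap.toContinuousLinearMap (Matrix.ofLinearEquiv ℂ).toLinearMap
  have h2 : DifferentiableAt ℂ (fun s => L (fun i j => δ s i j)) t :=
    L.differentiableAt.comp t h1
  exact ⟨_, h2.hasDerivAt⟩

theorem differentiable_exp_entry (x : Mat n) (i j : Fin n) :
    Differentiable ℂ (fun s : ℂ => NormedSpace.exp (s • x) i j) := by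
  let L : Mat n →L[ℂ] ℂ := LinearMap.toContinuousLinearMap (Matrix.entryLinearMap ℂ ℂ i j)
  intro s
  exact (L.differentiableAt (x := NormedSpace.exp (s • x))).comp s
    (hasDerivAt_exp_smul_const x s).differentiableAt

end

theorem map_conj_exp (x : Mat n) :
    (NormedSpace.exp x).map conj = NormedSpace.exp (x.map (conj : ℂ → ℂ)) := by
  have h : ∀ y : Mat n, y.map (conj : ℂ → ℂ) = (yᵀ)ᴴ := fun y => rfl
  rw [h, h, ← Matrix.exp_transpose, ← Matrix.exp_conjTranspose]

/-- The differential of an antiholomorphic endomorphism. -/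
theorem IsAntiholomorphic.exists_differential {G : Subgroup (GL (Fin n) ℂ)} {σ : G →* G}
    (hσ : IsAntiholomorphic σ) {x : Mat n} (hx : ∀ t : ℂ, expU (t • x) ∈ G) :
    ∃ v : Mat n, ∀ t : ℂ, (σ ⟨expU (t • x), hx t⟩ : GL (Fin n) ℂ) = expU (conj t • v) := by
  -- Conjugating the entries of `σ(exp(tx))` undoes the antiholomorphy and yields a one-parameter
  -- group complex differentiable at `0`.
  let δ : ℂ → Mat n := fun t => ((σ ⟨expU (t • x), hx t⟩ : GL (Fin n) ℂ) : Mat n).map conj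
  have hmul : ∀ s t, δ (s + t) = δ s * δ t := fun s t => by
    have h1 : (⟨expU ((s + t) • x), hx _⟩ : G) = ⟨expU (s • x), hx s⟩ * ⟨expU (t • x), hx t⟩ :=
      Subtype.ext ((congrArg expU (add_smul s t x)).trans
        (expU_add (((Commute.refl x).smul_left s).smul_right t)))
    simp only [δ]
    rw [h1, map_mul, Subgroup.coe_mul, Units.val_mul]
    exact Matrix.map_mul (f := starRingEnd ℂ)
  have h0 : δ 0 = 1 := by
    have h1 : (⟨expU ((0 : ℂ) • x), hx _⟩ : G) = 1 := Subtype.ext (by simp)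
    simp only [δ]
    rw [h1, map_one, Subgroup.coe_one, Units.val_one]
    exact Matrix.map_one _ (map_zero _) (map_one _)
  obtain ⟨U, f, hU, h1U, hf, hσf⟩ := hσ 1
  have hcont : Continuous fun s : ℂ => entries (expU (s • x)) :=
    continuous_pi fun i => continuous_pi fun j => (differentiable_exp_entry x i j).continuous
  have hat : entries (expU ((0 : ℂ) • x)) ∈ U := by
    rw [zero_smul, expU_zero]
    exact h1U
  have hev : ∀ᶠ s in 𝓝 (0 : ℂ), entries (expU (s • x)) ∈ U :=
    hcont.continuousAt.eventually (hU.mem_nhds hat)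
  obtain ⟨u, hu⟩ := hasDerivAt_of_entries (δ := δ) (t := 0) fun i j => by
    have h1 : DifferentiableAt ℂ (fun s : ℂ => entries (expU (s • x))) 0 :=
      differentiableAt_pi.2 fun i => differentiableAt_pi.2 fun j => differentiable_exp_entry x i j 0
    have h2 : DifferentiableAt ℂ (fun s : ℂ => f (entries (expU (s • x)))) 0 :=
      DifferentiableAt.comp (0 : ℂ) (hf.differentiableAt (hU.mem_nhds hat)) h1
    have h3 := differentiableAt_pi.1 (differentiableAt_pi.1 h2 i) j
    refine h3.congr_of_eventuallyEq ?_
    filter_upwards [hev] with s hs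
    have := hσf ⟨expU (s • x), hx s⟩ hs i j
    simp only [δ, Matrix.map_apply]
    exact (congrArg conj this).trans (Complex.conj_conj _)
  refine ⟨u.map conj, fun t => Units.ext ?_⟩
  have h1 := eq_exp_of_hasDerivAt hmul h0 hu t
  have h2 := congrArg (fun m : Mat n => m.map (conj : ℂ → ℂ)) h1
  simp only [δ] at h2
  rw [map_conj_exp] at h2
  have h3 : (((σ ⟨expU (t • x), hx t⟩ : GL (Fin n) ℂ) : Mat n).map conj).map (conj : ℂ → ℂ) =
      ((σ ⟨expU (t • x), hx t⟩ : GL (Fin n) ℂ) : Mat n) := by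
    ext i j
    simp
  have h4 : (t • u).map (conj : ℂ → ℂ) = conj t • u.map (conj : ℂ → ℂ) := by
    ext i j
    simp
  rw [h3, h4] at h2
  exact h2

/-! ### Real points of a relatively compact Cartan subgroup. -/

section RealPoints

variable {G H : Subgroup (GL (Fin n) ℂ)} {σ : G →* G}

theorem mem_realPoints {K : Subgroup (GL (Fin n) ℂ)} {g : GL (Fin n) ℂ} :
    g ∈ realPoints σ K ↔ g ∈ K ∧ ∃ h : g ∈ G, (σ ⟨g, h⟩ : GL (Fin n) ℂ) = g := by
  rw [realPoints, Subgroup.mem_inf, Subgroup.mem_map]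
  refine and_congr_right fun _ => ⟨?_, fun ⟨h, hσ⟩ => ⟨⟨g, h⟩, Subtype.ext hσ, rfl⟩⟩
  rintro ⟨⟨x, hx⟩, h, rfl⟩
  exact ⟨hx, congrArg Subtype.val h⟩

theorem IsTorus.mul_comm_of_mem (hH : IsTorus H) {a b : GL (Fin n) ℂ} (ha : a ∈ H) (hb : b ∈ H) :
    a * b = b * a := by
  obtain ⟨P, hP, -⟩ := hH.exists_dg
  obtain ⟨d, hd⟩ := hP a ha
  obtain ⟨e, he⟩ := hP b hb
  refine Units.ext ?_
  rw [Units.val_mul, Units.val_mul, hd, he]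
  exact commute_dg P d e

theorem IsRelativelyCompactCartan.mul_map_mem (hσ : IsRealForm σ)
    (hH : IsRelativelyCompactCartan σ H) {a : G} (ha : (a : GL (Fin n) ℂ) ∈ H) :
    ((a * σ a : G) : GL (Fin n) ℂ) ∈ realPoints σ H := by
  have hσa := hH.defined_over_real a ha
  refine mem_realPoints.2 ⟨H.mul_mem ha hσa, (a * σ a).2, ?_⟩
  change ((σ (a * σ a) : G) : GL (Fin n) ℂ) = _
  rw [map_mul, hσ.involutive a]
  exact hH.cartan.prop.1.mul_comm_of_mem hσa ha

theorem map_mem_commutator {a : G} (ha : (a : GL (Fin n) ℂ) ∈ ⁅G, G⁆) :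
    (σ a : GL (Fin n) ℂ) ∈ ⁅G, G⁆ := by
  have htop : (⁅(⊤ : Subgroup G), (⊤ : Subgroup G)⁆ : Subgroup G).map G.subtype = ⁅G, G⁆ := by
    rw [Subgroup.map_commutator, ← MonoidHom.range_eq_map, Subgroup.range_subtype]
  rw [← htop] at ha ⊢
  obtain ⟨b, hb, hba⟩ := ha
  obtain rfl : b = a := Subtype.ext hba
  refine ⟨σ b, ?_, rfl⟩
  have h1 : (⁅(⊤ : Subgroup G), (⊤ : Subgroup G)⁆ : Subgroup G).map σ ≤ ⁅(⊤ : Subgroup G), (⊤ : Subgroup G)⁆ := by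
    rw [Subgroup.map_commutator]
    exact Subgroup.commutator_mono le_top le_top
  exact h1 ⟨b, hb, rfl⟩

theorem map_mem_centerOf (hσ : Function.Surjective σ) {a : G}
    (ha : (a : GL (Fin n) ℂ) ∈ centerOf G) : (σ a : GL (Fin n) ℂ) ∈ centerOf G := by
  refine mem_centerOf.2 ⟨(σ a).2, fun k hk => ?_⟩
  obtain ⟨b, hb⟩ := hσ ⟨k, hk⟩
  have h1 : b * a = a * b := Subtype.ext ((mem_centerOf.1 ha).2 b b.2)
  have h2 := congrArg (fun u : G => (u : GL (Fin n) ℂ)) (congrArg σ h1)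
  simp only [map_mul, hb] at h2
  exact h2

theorem IsRelativelyCompactCartan.exists_differential (hσ : IsRealForm σ)
    (hH : IsRelativelyCompactCartan σ H) {x : Mat n} (hx : x ∈ lie H) :
    ∃ v ∈ lie H, ∀ (t : ℂ) (h : expU (t • x) ∈ G),
      (σ ⟨expU (t • x), h⟩ : GL (Fin n) ℂ) = expU (conj t • v) := by
  have hHalg := hH.cartan.prop.1.algebraic
  have hx' := (mem_lie hHalg).1 hx
  obtain ⟨v, hv⟩ := hσ.antiholomorphic.exists_differential fun t => hH.cartan.prop.2 (hx' t)
  refine ⟨v, (mem_lie hHalg).2 fun t => ?_, fun t h => hv t⟩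
  have h1 := hH.defined_over_real ⟨_, hH.cartan.prop.2 (hx' (conj t))⟩ (hx' (conj t))
  rwa [hv, Complex.conj_conj] at h1

/-- The element is `a * σ a` with `a = exp(tx)`, fixed by `σ` because `H` is commutative. -/
theorem IsRelativelyCompactCartan.exp_add_mem (hσ : IsRealForm σ)
    (hH : IsRelativelyCompactCartan σ H) {x v : Mat n} (hx : x ∈ lie H) (hv : v ∈ lie H)
    (h : ∀ (t : ℂ) (h : expU (t • x) ∈ G),
      (σ ⟨expU (t • x), h⟩ : GL (Fin n) ℂ) = expU (conj t • v)) (t : ℂ) :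
    expU (t • x + conj t • v) ∈ realPoints σ H := by
  have hxH := (mem_lie hH.cartan.prop.1.algebraic).1 hx t
  have h1 := hH.mul_map_mem hσ (a := ⟨_, hH.cartan.prop.2 hxH⟩) hxH
  rw [Subgroup.coe_mul, h, ← expU_add] at h1
  · exact h1
  · exact ((hH.cartan.prop.1.commute hx hv).smul_left _).smul_right _

/-- The real points of a relatively compact Cartan subgroup are infinitesimally dense. -/
theorem IsRelativelyCompactCartan.commute_lie (hσ : IsRealForm σ)
    (hH : IsRelativelyCompactCartan σ H) {g : GL (Fin n) ℂ}
    (hg : ∀ k ∈ realPoints σ H, k * g = g * k) {x : Mat n} (hx : x ∈ lie H) :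
    Commute (g : Mat n) x := by
  obtain ⟨v, hv, h⟩ := hH.exists_differential hσ hx
  have hreal := hH.exp_add_mem hσ hx hv h
  have hcomm : ∀ k ∈ realPoints σ H, Commute (k : Mat n) (g : Mat n) := fun k hk =>
    congrArg (fun u : GL (Fin n) ℂ => (u : Mat n)) (hg k hk)
  -- Real and imaginary times give the real directions `x + v` and `i(x - v)`; `x` is a complex
  -- combination of the two.
  have h1 : Commute (x + v) (g : Mat n) := commute_of_forall_expU fun t => hcomm _ (by
    have := hreal t
    rwa [Complex.conj_ofReal, ← smul_add] at this)
  have h2 : Commute (Complex.I • x - Complex.I • v) (g : Mat n) :=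
    commute_of_forall_expU fun t => hcomm _ (by
      have := hreal (t * Complex.I)
      rw [map_mul, Complex.conj_ofReal, Complex.conj_I, mul_neg, neg_smul, ← sub_eq_add_neg,
        mul_smul, mul_smul, ← smul_sub] at this
      exact this)
  have h3 : x = (2⁻¹ : ℂ) • (x + v) + (-(2⁻¹ * Complex.I) : ℂ) • (Complex.I • x - Complex.I • v) := by
    rw [← smul_sub, smul_smul]
    have : -(2⁻¹ * Complex.I) * Complex.I = (2⁻¹ : ℂ) := by
      rw [neg_mul, mul_assoc, Complex.I_mul_I]
      ring
    rw [this, ← smul_add, add_add_sub_cancel, ← two_smul ℂ x, smul_smul]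
    norm_num
  rw [h3]
  exact ((h1.smul_left _).add_left (h2.smul_left _)).symm

/-- At `s = M / a` the bound would read `exp M ≤ M`. -/
theorem eq_zero_of_exp_bounded {a : ℝ} {M : ℝ} (h : ∀ s : ℝ, Real.exp (s * a) ≤ M) : a = 0 := by
  by_contra ha
  have h1 := h (M / a)
  rw [div_mul_cancel₀ _ ha] at h1
  linarith [Real.add_one_le_exp M]

theorem mem_identityComponent_of_exp {K : Subgroup (GL (Fin n) ℂ)} {x : Mat n}
    (h : ∀ t : ℝ, expU ((t : ℂ) • x) ∈ K) : expU x ∈ identityComponent K := by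
  let γ : ℝ → K := fun t => ⟨expU ((t : ℂ) • x), h t⟩
  have hγ : Continuous γ := by
    refine Continuous.subtype_mk (continuous_expU.comp ?_) _
    exact Complex.continuous_ofReal.smul continuous_const
  have hrange : Set.range γ ⊆ connectedComponent (1 : K) :=
    (isPreconnected_range hγ).subset_connectedComponent ⟨0, Subtype.ext (by simp [γ])⟩
  refine Subgroup.mem_map.2 ⟨γ 1, hrange ⟨1, rfl⟩, ?_⟩
  simp [γ]

/-- In a common eigenbasis let `c` and `e` be the eigenvalues of a logarithm of `d` and of its image
under the differential of `σ`. Compactness makes `c - e` real and torsion makes it purely imaginary,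
so the logarithm is itself real. -/
theorem IsRelativelyCompactCartan.exists_exp_of_torsion (hG : IsConnectedReductive G)
    (hσ : IsRealForm σ) (hH : IsRelativelyCompactCartan σ H) {d : G}
    (hd : (d : GL (Fin n) ℂ) ∈ H) (hdd : (d : GL (Fin n) ℂ) ∈ ⁅G, G⁆) {N : ℕ} (hN : N ≠ 0)
    (htors : (d * (σ d)⁻¹) ^ N = 1) :
    ∃ x : Mat n, expU x = d ∧ ∀ t : ℝ, expU ((t : ℂ) • x) ∈ realPoints σ H := by
  have hHT := hH.cartan.prop.1
  obtain ⟨x, hx, hxd⟩ := hH.cartan.exists_exp_of_mem_commutator hG hd hdd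
  have hxH : x ∈ lie H := lie_mono inf_le_left hx
  obtain ⟨v, hv, hxv⟩ := hH.exists_differential hσ hxH
  obtain ⟨P, -, hP⟩ := hHT.exists_dg
  obtain ⟨c, rfl⟩ := hP x hxH
  obtain ⟨e, rfl⟩ := hP v hv
  have hmemG : ∀ t : ℂ, expU (t • dg P c) ∈ G := fun t =>
    hH.cartan.prop.2 ((mem_lie hHT.algebraic).1 hxH t)
  have hexp : ∀ a : Fin n → ℂ, ∀ i, ((P : Mat n) * (expU (dg P a) : Mat n) *
      ((P⁻¹ : GL (Fin n) ℂ) : Mat n)) i i = Complex.exp (a i) := fun a i => by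
    rw [coe_expU, exp_dg, conj_dg, diagonal_apply_eq]
  have hre : ∀ i, (c i - e i).im = 0 := fun i => by
    have hcont : Continuous fun g : GL (Fin n) ℂ =>
        ((P : Mat n) * (g : Mat n) * ((P⁻¹ : GL (Fin n) ℂ) : Mat n)) i i :=
      ((IsPoly.coord i i).conj (P : Mat n) ((P⁻¹ : GL (Fin n) ℂ) : Mat n)).continuous.comp
        Units.continuous_val
    obtain ⟨M, hM⟩ := hH.compact.exists_bound_of_continuousOn hcont.continuousOn
    refine eq_zero_of_exp_bounded (M := M) fun s => ?_
    have hmem : expU (dg P fun i => -(s * Complex.I) * (c i - e i)) ∈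
        realPoints σ H ⊓ ⁅G, G⁆ := by
      have h1 : dg P (fun i => -(s * Complex.I) * (c i - e i)) =
          (-(s * Complex.I) : ℂ) • dg P c + conj (-(s * Complex.I) : ℂ) • dg P e := by
        rw [← map_smul, ← map_smul, ← map_add]
        congr 1
        ext i
        simp only [Pi.add_apply, Pi.smul_apply, smul_eq_mul, map_neg, map_mul,
          Complex.conj_ofReal, Complex.conj_I]
        ring
      refine ⟨?_, ?_⟩
      · rw [h1]
        exact hH.exp_add_mem hσ hxH hv hxv _
      · rw [h1, expU_add (((commute_dg P c e).smul_left _).smul_right _), ← hxv _ (hmemG _)]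
        have h2 := hH.cartan.expU_mem_commutator hG ((lie _).smul_mem (-(s * Complex.I) : ℂ) hx)
        exact Subgroup.mul_mem _ h2 (map_mem_commutator (a := ⟨_, hmemG _⟩) h2)
    have h1 := hM _ hmem
    rw [hexp, Complex.norm_exp] at h1
    have h2 : (-(s * Complex.I) * (c i - e i)).re = s * (c i - e i).im := by
      simp [Complex.mul_re, Complex.mul_im]
    rwa [h2] at h1
  have hσd : (σ d : GL (Fin n) ℂ) = expU (dg P e) := by
    have := hxv 1 (hmemG 1)
    simp only [one_smul, map_one] at this
    rw [← this]
    congr 2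
    exact Subtype.ext hxd.symm
  -- Torsion gives `exp(N (c i - e i)) = 1`; taking absolute values kills the real part.
  have hce : c = e := by
    ext i
    have h1 : expU (dg P (N • (c - e))) = 1 := by
      have h2 := congrArg (fun u : G => (u : GL (Fin n) ℂ)) htors
      simp only [Subgroup.coe_pow, Subgroup.coe_mul, Subgroup.coe_inv, Subgroup.coe_one] at h2
      rw [hσd, ← hxd, ← expU_neg, ← expU_add (commute_dg P c e).neg_right, ← expU_nsmul,
        ← sub_eq_add_neg, ← map_sub, ← map_nsmul] at h2
      exact h2
    have h2 := hexp (N • (c - e)) i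
    rw [h1, Units.val_one, mul_one, Units.mul_inv, one_apply_eq] at h2
    have h3 := congrArg norm h2
    rw [norm_one, Complex.norm_exp, eq_comm, Real.exp_eq_one_iff, Pi.smul_apply, nsmul_eq_mul,
      Pi.sub_apply, ← Complex.ofReal_natCast, Complex.re_ofReal_mul, mul_eq_zero] at h3
    have h4 := h3.resolve_left (Nat.cast_ne_zero.2 hN)
    exact sub_eq_zero.1 (Complex.ext h4 (hre i))
  subst hce
  refine ⟨dg P c, hxd, fun t => mem_realPoints.2
    ⟨(mem_lie hHT.algebraic).1 hxH _, hmemG _, ?_⟩⟩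
  rw [hxv, Complex.conj_ofReal]

/-- Elements of the real points of a relatively compact Cartan subgroup decompose into real
points of the radical and exponentials in the derived group. -/
theorem IsRelativelyCompactCartan.exists_mul_exp (hG : IsConnectedReductive G)
    (hσ : IsRealForm σ) (hH : IsRelativelyCompactCartan σ H) {h : GL (Fin n) ℂ}
    (hh : h ∈ realPoints σ H) : ∃ z ∈ realPoints σ (radical G), ∃ x : Mat n,
      h = z * expU x ∧ expU x ∈ ⁅G, G⁆ ∧ ∀ t : ℝ, expU ((t : ℂ) • x) ∈ realPoints σ H := by
  obtain ⟨hhH, hhG, hσh⟩ := mem_realPoints.1 hh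
  obtain ⟨d, hd, w, hw, hdw⟩ := hG.exists_mul_exp hH.cartan hhG
  have hzrad := expU_mem_radical hG hH.cartan hw
  have hzZ := radical_le_centerOf G hzrad
  have hzH := hH.cartan.centerOf_le hG hzZ
  have hdG := commutator_self_le G hd
  have hdH : d ∈ H := by
    rw [eq_mul_inv_of_mul_eq hdw.symm]
    exact H.mul_mem hhH (H.inv_mem hzH)
  set z : G := ⟨expU w, (mem_centerOf.1 hzZ).1⟩
  set d' : G := ⟨d, hdG⟩
  have hcomm : ∀ k : G, k * z = z * k := fun k => Subtype.ext ((mem_centerOf.1 hzZ).2 k k.2)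
  have hprod : σ d' * σ z = d' * z := by
    rw [← map_mul]
    refine Subtype.ext ?_
    have h1 : (⟨h, hhG⟩ : G) = d' * z := Subtype.ext hdw
    rw [← h1]
    exact hσh
  -- The left side lies in the derived group and the right side in the center, so this element of
  -- `H` is killed by `n!`.
  have hf : d' * (σ d')⁻¹ = σ z * z⁻¹ := by
    have h1 : d' = σ d' * σ z * z⁻¹ := eq_mul_inv_of_mul_eq hprod.symm
    obtain ⟨b, hb⟩ := hσ.involutive.surjective (σ d')⁻¹
    have h2 : (σ d')⁻¹ * (σ z * z⁻¹) = σ z * z⁻¹ * (σ d')⁻¹ := by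
      rw [← mul_assoc, ← hb, ← map_mul, hcomm, map_mul, mul_assoc, mul_assoc,
        (show Commute (σ b) z from hcomm (σ b)).inv_right.eq]
    rw [mul_assoc] at h1
    calc d' * (σ d')⁻¹ = σ d' * ((σ z * z⁻¹) * (σ d')⁻¹) := by
          rw [← mul_assoc, ← h1]
      _ = σ z * z⁻¹ := by rw [← h2, mul_inv_cancel_left]
  have htors : (d' * (σ d')⁻¹) ^ n.factorial = 1 := by
    refine Subtype.ext ?_
    have hσzZ := map_mem_centerOf hσ.involutive.surjective (a := z) hzZ
    refine hH.cartan.prop.1.pow_factorial_eq_one (G := G) ?_ ?_ ?_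
    · exact H.mul_mem hdH (H.inv_mem (hH.defined_over_real d' hdH))
    · rw [hf]
      exact Subgroup.mul_mem _ hσzZ (Subgroup.inv_mem _ hzZ)
    · exact commutator_le_isotypicSL G (Subgroup.mul_mem _ hd
        (Subgroup.inv_mem _ (map_mem_commutator (a := d') hd)))
  obtain ⟨x, hxd, hx⟩ := hH.exists_exp_of_torsion hG hσ (d := d') hdH hd n.factorial_ne_zero htors
  have hσd : σ d' = d' := by
    have h1 := (mem_realPoints.1 (hx 1)).2
    simp only [Complex.ofReal_one, one_smul] at h1
    obtain ⟨h2, h3⟩ := h1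
    have h4 : (⟨expU x, h2⟩ : G) = d' := Subtype.ext hxd
    rw [h4] at h3
    exact Subtype.ext (h3.trans hxd)
  have hσz : σ z = z := by
    rw [hσd] at hprod
    exact mul_left_cancel hprod
  refine ⟨z, mem_realPoints.2 ⟨hzrad, z.2, congrArg Subtype.val hσz⟩, x, ?_, ?_, hx⟩
  · rw [hxd, hdw]
    exact congrArg Subtype.val (hcomm d')
  · rw [hxd]
    exact hd

end RealPoints

end RealReductive

/-! ### The theorem. -/

theorem lemmal {n : ℕ} (G : Subgroup (GL (Fin n) ℂ))
    (hG : RealReductive.IsConnectedReductive G)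
    (σ : G →* G) (hσ : RealReductive.IsRealForm σ)
    (H : Subgroup (GL (Fin n) ℂ)) (hH : RealReductive.IsRelativelyCompactCartan σ H) :
    (RealReductive.centerOf (RealReductive.realPoints σ G) : Set (GL (Fin n) ℂ)) ⊆
        (RealReductive.realPoints σ (RealReductive.radical G) : Set (GL (Fin n) ℂ)) *
          (RealReductive.identityComponent (RealReductive.realPoints σ H) : Set (GL (Fin n) ℂ)) ∧
      (RealReductive.realPoints σ H : Set (GL (Fin n) ℂ)) =
        (RealReductive.realPoints σ (RealReductive.radical G) : Set (GL (Fin n) ℂ)) *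
          (RealReductive.realPoints σ (H ⊓ ⁅G, G⁆) : Set (GL (Fin n) ℂ)) := by
  refine ⟨fun g hg => ?_, Set.Subset.antisymm (fun h hh => ?_) ?_⟩
  · rw [SetLike.mem_coe, RealReductive.mem_centerOf] at hg
    obtain ⟨-, hgG, hσg⟩ := RealReductive.mem_realPoints.1 hg.1
    -- Since `H(ℝ) ⊂ G(ℝ)`, the element `g` commutes with `H(ℝ)`, hence with `lie H`, whose
    -- centralizer in `G` is contained in `H`.
    have hgH : g ∈ H := hH.cartan.mem_of_commute hG hgG fun t ht =>
      hH.commute_lie hσ (fun k hk => hg.2 k (inf_le_inf_right _ hH.cartan.prop.2 hk)) ht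
    obtain ⟨z, hz, x, rfl, -, hx⟩ := hH.exists_mul_exp hG hσ
      (RealReductive.mem_realPoints.2 ⟨hgH, hgG, hσg⟩)
    exact ⟨z, hz, _, RealReductive.mem_identityComponent_of_exp hx, rfl⟩
  · obtain ⟨z, hz, x, rfl, hxd, hx⟩ := hH.exists_mul_exp hG hσ hh
    have h1 := hx 1
    rw [Complex.ofReal_one, one_smul] at h1
    exact ⟨z, hz, _, ⟨⟨h1.1, hxd⟩, h1.2⟩, rfl⟩
  · rintro _ ⟨z, hz, d, hd, rfl⟩
    refine Subgroup.mul_mem _ ⟨?_, hz.2⟩ ⟨hd.1.1, hd.2⟩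
    exact hH.cartan.centerOf_le hG (RealReductive.radical_le_centerOf G hz.1)
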